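/- **Notation for partitions.** Every partition $\lambda$ has a unique tail decomposition $\lambda=(2\lambda_{2e},2\lambda_{2o},\lambda_{o,o},\lambda_{o,o},\lambda_0)$, where $\lambda_{2e}$ has even parts, $\lambda_{2o}$ and $\lambda_{o,o}$ have odd parts, and $\lambda_0$ has pairwise distinct odd parts $\lambda_0^1,\lambda_0^2,\dots$. Put $\lambda_{tail}=(\lambda_{2e},\lambda_{2o},\lambda_{o,o})$, let $l(\cdot)$ be the number of parts, $l(\lambda_{1,1})$ the number of ones in $\lambda_{o,o}$, $|\nu|$ the sum of the parts of $\nu$, and let $\setminus$ be removal of parts with multiplicity. For an integer $k$ and partitions $\alpha,\beta$ let $B(k,\alpha,\beta)$ be the maximal number of sign changes in a sequence $k_0=k,k_1,k_2,\dots$ in which each step adds a part of $\alpha$ or subtracts a part of $\beta$, each part being used exactly once. **Effective non-zigzag covers.** A tropical cover $\varphi:C\to\mathbb R\cup\{\pm\infty\}$ is a continuous map from a connected finite metric graph without $2$-valent vertices, whose ends have infinite length and whose inner edges have finite length; $\varphi$ is affine with slope $\pm\omega(e)$, $\omega(e)\in\mathbb Z_{>0}$, on every edge $e$, maps inner vertices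 to $\mathbb R$, maps exactly the leaves to $\pm\infty$, both values being attained, and is balanced at every inner vertex (the edges on the left and on the right have the same total weight). Let $r=l(\lambda)+l(\mu)+2g-2$ and $x_1<\dots<x_r$ be real. The cover has type $(g,\lambda,\mu,\underline x)$ if $b_1(C)=g$, the weights of the ends over $-\infty$ and over $+\infty$ form $\lambda$ and $\mu$, and every $x_i$ is the image of an inner vertex. A symmetric cycle is a pair of inner edges of equal weight with the same two endpoints; a symmetric fork is a pair of ends of equal weight at the same vertex. A string is a connected subgraph that is a closed one-dimensional submanifold of $C$ minus its leaves; it bends at a vertex if both of its edges there lie on the same side. A cover of type $(g,\lambda,\mu,\underline x)$ is *effective non-zigzag* if there are $n>1$ strings $S_1,\dots,S_n$ of odd-weight edges, containing no edge of a symmetric cycle or of a symmetric fork of odd weight, and connecting pieces $E_1,\dots,E_{n-1}$ of even-weight edges, $E_i$ joining a vertex of $S_i$ to a vertex of $S_{i+1}$, such that: * each $E_i$ either is a chain edge, cycle, edge, …, cycle, edge with any number ($\ge0$) of cycles (pairs of edges with the same endpoints) and neither $S_i$ nor $S_{i+1}$ bends at its vertex on $E_i$, or $E_i$ is a single edge and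 both strings bend there; * every connected component of $C\setminus(\bigcup S_i\cup\bigcup E_i)$ is a tail attached to a string, namely either a chain edge, cycle, …, edge, cycle, edge with any number ($\geq 0$) of symmetric cycles of odd weight, whose last edge is an end of weight $2o$ or is an inner edge followed by a symmetric fork of weights $o,o$ ($o$ odd); or a single end of weight $2e$ ($e$ even); * every inner vertex of every $E_i$ (including its two endpoints) is mapped to some $x_j$ with $j\le\lceil r/2\rceil$. $Z'_g(\lambda,\mu)$ is twice the number of isomorphism classes of effective non-zigzag covers of type $(g,\lambda,\mu,\underline x)$. The bounds below hold for every choice of $x_1<\dots<x_r$. **Condition.** For a finite set $A\subset\mathbb Z$ and $D\in\mathbb Z$ say that $D$ *exceeds* $A$ if either $A$ has a positive element and $D>0$, or $A$ has no positive element, has a negative element, and $D>|\max\{t\in A: t<0\}|$. Let $g\ge0$ and let $\lambda,\mu$ be partitions with $|\lambda|=|\mu|$. Assume one of: 1. $l(\lambda_0)=l(\mu_0)\ge1$, $l(\mu_{o,o})\ge1$, and $l(\mu)+2g-3l(\lambda_0)$ exceeds the set of all $t_{i,j}=\sum_{n\ne i}\lambda_0^n-\sum_{n\ne j}\mu_0^n$;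 2. $l(\lambda_0)>l(\mu_0)$, $2l(\mu_{1,1})>l(\lambda_0)-l(\mu_0)$, and $l(\mu)+2g-3l(\lambda_0)$ exceeds the set of all $t_{i,j}=\sum_{n\ne i,j}\lambda_0^n-\sum\mu_0^n-l(\lambda_0)+l(\mu_0)+2$, $i\neq j$; 3. $l(\mu_0)>l(\lambda_0)$, $l(\mu_{o,o})\ge1$, $2l(\lambda_{1,1})>l(\mu_0)-l(\lambda_0)$, and $l(\mu)+2g-3l(\mu_0)$ exceeds the set of all $t_j=\sum\lambda_0^n-\sum_{n\ne j}\mu_0^n-l(\lambda_0)+l(\mu_0)-1$. **Conclusion.** There are integers $0\le n_1\le l(\lambda_{o,o})$, $k>0$ and partitions $\lambda'_{tail}\subset\lambda_{tail}$, $\mu'_{tail}\subset\mu_{tail}$ such that $$Z'_g(\lambda,\mu)\ \ge\ n_1!\,(l(\lambda_{o,o})-n_1)!\,l(\mu_{o,o})!\,\lfloor B/2\rfloor!\,\lceil B/2\rceil!\qquad(*)$$ with $B=B\bigl(k,2(\lambda_{tail}\setminus\lambda'_{tail}),2(\mu_{tail}\setminus\mu'_{tail})\bigr)$. Explicitly,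 $(*)$ holds for the following data. For integers $l,w$ call sub-partitions $\lambda^*_{2o}\subset\lambda_{2o}$, $\lambda^*_{2e}\subset\lambda_{2e}$, $\lambda^*_{o,o}\subset\lambda_{o,o}$ *admissible* if $l+2|\lambda^*_{2o}|+2|\lambda^*_{2e}|+2|\lambda^*_{o,o}|>w$, and call $\lambda^*=(\lambda^*_{2o},\lambda^*_{2e},\lambda^*_{o,o})$ an *$(l,w)$-selection* if it is admissible, $n_1=l(\lambda^*_{o,o})$ is minimal among admissible triples, $m_1=l(\lambda^*_{2o})$ is minimal among those with this $n_1$, and $m_2=l(\lambda^*_{2e})$ is minimal among those with these $n_1,m_1$. Write $|\lambda^*|$ for the sum of all its parts, put $c=\tfrac12|l(\lambda_0)-l(\mu_0)|$ (an integer), and let $(1)^a$ be the partition with $a$ parts equal to one. * $l(\lambda_0)=l(\mu_0)$ and $t_{i_1,j_1}>0$: $n_1=0$, $\lambda'_{tail}=\mu'_{tail}=\emptyset$, $k=\sum\lambda_0^n-\sum_{n\ne j_1}\mu_0^n$. * $l(\lambda_0)=l(\mu_0)$, all $t_{i,j}\le0$, and $t_{i_1,j_1}$ is the largest negative value: for every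 $(\lambda_0^{i_1},|t_{i_1,j_1}|)$-selection $\lambda^*$, with its $n_1$, $\lambda'_{tail}=\lambda^*$, $\mu'_{tail}=\emptyset$, $k=\sum\lambda_0^n+2|\lambda^*|-\sum_{n\ne j_1}\mu_0^n$. * $l(\lambda_0)>l(\mu_0)$ and $t_{i_1,i_2}>0$ for some $i_1\neq i_2$: $n_1=0$, $\lambda'_{tail}=\emptyset$, $\mu'_{tail}=(1)^{c-1}$, $k=\sum_{n\ne i_2}\lambda_0^n-\sum\mu_0^n-2c+2$. * $l(\lambda_0)>l(\mu_0)$, all $t_{i,j}\le0$, and $t_{i_1,i_2}$, $i_1\neq i_2$, is the largest negative value: for every $(\lambda_0^{i_1},|t_{i_1,i_2}|)$-selection $\lambda^*$ (if there is one), with its $n_1$, $\lambda'_{tail}=\lambda^*$, $\mu'_{tail}=(1)^{c-1}$, $k=\sum_{n\ne i_2}\lambda_0^n+2|\lambda^*|-\sum\mu_0^n-2c+2$. * $l(\lambda_0)<l(\mu_0)$ and $t_{j_1}>0$: $n_1=0$, $\lambda'_{tail}=(1)^{c}$, $\mu'_{tail}=\emptyset$, $k=\sum\lambda_0^n-\sum_{n\ne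 j_1}\mu_0^n+2c$. * $l(\lambda_0)<l(\mu_0)$, all $t_j\le0$, and $t_{j_1}$ is the largest negative value: for every $(1,|t_{j_1}|)$-selection $\lambda^*$ with $(\lambda^*_{o,o},(1)^{c})\subset\lambda_{o,o}$, with its $n_1$, $\lambda'_{tail}=(\lambda^*,(1)^{c})$, $\mu'_{tail}=\emptyset$, $k=\sum\lambda_0^n+2|\lambda^*|-\sum_{n\ne j_1}\mu_0^n+2c$. -/

import Mathlib

/-! ### Partitions and their tail decomposition -/

namespace TailDec

/-- `λ_{2e}`: the halves of the parts divisible by four. -/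
def evenHalves (p : Multiset ℕ) : Multiset ℕ := (p.filter (fun n => 4 ∣ n)).map (fun n => n / 2)

/-- `λ_{2o}`: the halves of the parts congruent to two modulo four. -/
def oddHalves (p : Multiset ℕ) : Multiset ℕ := (p.filter (fun n => n % 4 = 2)).map (fun n => n / 2)

/-- `λ_{o,o}`: every odd part of multiplicity `c` is listed `⌊c / 2⌋` times. -/
def oddPairs (p : Multiset ℕ) : Multiset ℕ :=
  ∑ n ∈ p.toFinset.filter (fun n => Odd n), Multiset.replicate (p.count n / 2) n

/-- `λ_0`: the odd parts of odd multiplicity, each listed once. -/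
def single (p : Multiset ℕ) : Finset ℕ :=
  p.toFinset.filter (fun n => Odd n ∧ Odd (p.count n))

/-- `λ_tail = (λ_{2e}, λ_{2o}, λ_{o,o})`. -/
def tail (p : Multiset ℕ) : Multiset ℕ := evenHalves p + oddHalves p + oddPairs p

/-- The integer `∑ s` for a finite set of natural numbers. -/
def total (s : Finset ℕ) : ℤ := ∑ n ∈ s, (n : ℤ)

end TailDec

/-! ### Sign changes -/

/-- The number of consecutive pairs of opposite strict sign in a list of integers. -/
def signChanges : List ℤ → ℕ
  | [] => 0
  | [_] => 0
  | a :: b :: l => (if a * b < 0 then 1 else 0) + signChanges (b :: l)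

/-- `B(k, α, β)`: the maximal number of sign changes of a sequence `k₀ = k, k₁, k₂, …` in which
each step adds a part of `α` or subtracts a part of `β`, every part being used exactly once. -/
def maxSignChanges (k : ℤ) (α β : Multiset ℕ) : ℕ :=
  (Multiset.lists (α.map (fun n : ℕ => (n : ℤ)) + β.map (fun n : ℕ => -(n : ℤ)))).toFinset.sup
    (fun steps => signChanges (steps.scanl (· + ·) k))

/-- The partition `2α`. -/
def twice (α : Multiset ℕ) : Multiset ℕ := α.map (fun n => 2 * n)

/-! ### Tropical covers of the tropical projective line -/

/-- A tropical cover `φ : C → ℝ ∪ {±∞}` with at least one inner vertex.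
`V`, `E`, `L` are the inner vertices, the inner edges and the ends of the tropical curve `C` (every
leaf lies on exactly one end).  Since `φ` is affine with nonzero slope on every edge, an inner edge
`e` has a lower endpoint `src e` and an upper endpoint `tgt e`; the end `l` is attached to the inner
vertex `root l`, and its leaf is mapped to `+∞` if `side l = true` and to `-∞` otherwise.
`len e` is the length of an inner edge (ends have infinite length), `wE`, `wL` are the weights, and
`pos v` is `φ(v)`. These data determine `φ`. -/
structure TropicalCover where
  V : Type
  E : Type
  L : Type
  [fintypeV : Fintype V]
  [fintypeE : Fintype E]
  [fintypeL : Fintype L]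
  [decEqV : DecidableEq V]
  [decEqE : DecidableEq E]
  [decEqL : DecidableEq L]
  src : E → V
  tgt : E → V
  root : L → V
  side : L → Bool
  len : E → ℝ
  wE : E → ℕ
  wL : L → ℕ
  pos : V → ℝ
  nonempty : Nonempty V
  connected : ∀ u v : V, Relation.EqvGen (fun a b => ∃ e, src e = a ∧ tgt e = b) u v
  /-- inner vertices are not one-valent, and there are no two-valent vertices -/
  three_le_valence : ∀ v : V,
    3 ≤ (Finset.univ.filter (fun e => src e = v)).card
      + (Finset.univ.filter (fun e => tgt e = v)).card
      + (Finset.univ.filter (fun l => root l = v)).card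
  len_pos : ∀ e, 0 < len e
  wE_pos : ∀ e, 0 < wE e
  wL_pos : ∀ l, 0 < wL l
  /-- on the inner edge `e`, the map `φ` is affine with slope `wE e` -/
  slope : ∀ e, pos (tgt e) = pos (src e) + wE e * len e
  exists_left : ∃ l, side l = false
  exists_right : ∃ l, side l = true
  /-- the balancing condition -/
  balanced : ∀ v : V,
    ∑ e ∈ Finset.univ.filter (fun e => tgt e = v), wE e
        + ∑ l ∈ Finset.univ.filter (fun l => root l = v ∧ side l = false), wL l
      = ∑ e ∈ Finset.univ.filter (fun e => src e = v), wE e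
        + ∑ l ∈ Finset.univ.filter (fun l => root l = v ∧ side l = true), wL l

namespace TropicalCover

attribute [instance] fintypeV fintypeE fintypeL decEqV decEqE decEqL

/-- An isomorphism of tropical covers: an isometry of the curves without their leaves which commutes
with the maps to the tropical projective line (in particular it preserves weights). -/
structure Iso (C D : TropicalCover) where
  onV : C.V ≃ D.V
  onE : C.E ≃ D.E
  onL : C.L ≃ D.L
  src_eq : ∀ e, D.src (onE e) = onV (C.src e)
  tgt_eq : ∀ e, D.tgt (onE e) = onV (C.tgt e)
  root_eq : ∀ l, D.root (onL l) = onV (C.root l)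
  side_eq : ∀ l, D.side (onL l) = C.side l
  len_eq : ∀ e, D.len (onE e) = C.len e
  wE_eq : ∀ e, D.wE (onE e) = C.wE e
  wL_eq : ∀ l, D.wL (onL l) = C.wL l
  pos_eq : ∀ v, D.pos (onV v) = C.pos v

/-- The relation of being isomorphic. -/
def isoSetoid : Setoid TropicalCover where
  r C D := Nonempty (Iso C D)
  iseqv :=
    { refl := fun C => ⟨⟨Equiv.refl _, Equiv.refl _, Equiv.refl _, fun _ => rfl, fun _ => rfl,
        fun _ => rfl, fun _ => rfl, fun _ => rfl, fun _ => rfl, fun _ => rfl, fun _ => rfl⟩⟩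
      symm := by
        rintro C D ⟨f⟩
        refine ⟨⟨f.onV.symm, f.onE.symm, f.onL.symm, fun e => ?_, fun e => ?_, fun l => ?_,
          fun l => ?_, fun e => ?_, fun e => ?_, fun l => ?_, fun v => ?_⟩⟩
        · rw [Equiv.eq_symm_apply, ← f.src_eq, Equiv.apply_symm_apply]
        · rw [Equiv.eq_symm_apply, ← f.tgt_eq, Equiv.apply_symm_apply]
        · rw [Equiv.eq_symm_apply, ← f.root_eq, Equiv.apply_symm_apply]
        · rw [← f.side_eq, Equiv.apply_symm_apply]
        · rw [← f.len_eq, Equiv.apply_symm_apply]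
        · rw [← f.wE_eq, Equiv.apply_symm_apply]
        · rw [← f.wL_eq, Equiv.apply_symm_apply]
        · rw [← f.pos_eq, Equiv.apply_symm_apply]
      trans := by
        rintro C D F ⟨f⟩ ⟨h⟩
        refine ⟨⟨f.onV.trans h.onV, f.onE.trans h.onE, f.onL.trans h.onL, fun e => ?_,
          fun e => ?_, fun l => ?_, fun l => ?_, fun e => ?_, fun e => ?_, fun l => ?_,
          fun v => ?_⟩⟩
        · simp [h.src_eq, f.src_eq]
        · simp [h.tgt_eq, f.tgt_eq]
        · simp [h.root_eq, f.root_eq]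
        · simp [h.side_eq, f.side_eq]
        · simp [h.len_eq, f.len_eq]
        · simp [h.wE_eq, f.wE_eq]
        · simp [h.wL_eq, f.wL_eq]
        · simp [h.pos_eq, f.pos_eq] }

variable (C : TropicalCover)

/-- The cover has type `(g, λ, μ, x)`: the curve has genus (first Betti number) `g`, the weights of
the ends over `-∞` and over `+∞` form `λ` and `μ`, and every `x i` is the image of an inner vertex.
The degree, read off near `-∞`, is then the sum of the parts of `λ`. -/
def HasType (g : ℕ) (lam mu : Multiset ℕ) {r : ℕ} (x : Fin r → ℝ) : Prop :=
  Fintype.card C.E + 1 = Fintype.card C.V + g ∧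
  (Finset.univ.filter (fun l => C.side l = false)).val.map C.wL = lam ∧
  (Finset.univ.filter (fun l => C.side l = true)).val.map C.wL = mu ∧
  ∀ i, ∃ v, C.pos v = x i

/-- All edges: inner edges and ends. -/
abbrev Edge := C.E ⊕ C.L

/-- The weight of an edge. -/
def weight : C.Edge → ℕ
  | Sum.inl e => C.wE e
  | Sum.inr l => C.wL l

/-- The edge lies to the left of its inner vertex `v`. -/
def Enters : C.Edge → C.V → Prop
  | Sum.inl e, v => C.tgt e = v
  | Sum.inr l, v => C.root l = v ∧ C.side l = false

/-- The edge lies to the right of its inner vertex `v`. -/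
def Exits : C.Edge → C.V → Prop
  | Sum.inl e, v => C.src e = v
  | Sum.inr l, v => C.root l = v ∧ C.side l = true

/-- The edge is adjacent to the inner vertex `v`. -/
def Touches (a : C.Edge) (v : C.V) : Prop := C.Enters a v ∨ C.Exits a v

/-- The inner vertices of the subgraph formed by a set of edges. -/
def verts (T : Set C.Edge) : Set C.V := {v | ∃ a ∈ T, C.Touches a v}

/-- The edges of the symmetric cycles (two inner edges of equal weight with the same two endpoints)
and of the symmetric odd forks (two ends of equal odd weight at the same vertex). -/
def symEdges : Set C.Edge :=
  {a | (∃ e e', a = Sum.inl e ∧ e ≠ e' ∧ C.src e = C.src e' ∧ C.tgt e = C.tgt e' ∧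
          C.wE e = C.wE e') ∨
       (∃ l l', a = Sum.inr l ∧ l ≠ l' ∧ C.root l = C.root l' ∧ C.wL l = C.wL l' ∧
          Odd (C.wL l))}

/-- A string: a connected subgraph, given by its edges, which is a closed one-dimensional
submanifold of the curve without its leaves, i.e. each of its inner vertices is adjacent to exactly
two of its edges. -/
def IsString (S : Set C.Edge) : Prop :=
  S.Nonempty ∧
  (∀ a ∈ S, ∀ b ∈ S, Relation.ReflTransGen
    (fun p q => p ∈ S ∧ q ∈ S ∧ ∃ v, C.Touches p v ∧ C.Touches q v) a b) ∧
  ∀ v ∈ C.verts S, {a | a ∈ S ∧ C.Touches a v}.ncard = 2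

/-- The string `S` turns at `v`: two of its edges lie on the same side of `v`. -/
def BendsAt (S : Set C.Edge) (v : C.V) : Prop :=
  ∃ a ∈ S, ∃ b ∈ S, a ≠ b ∧ ((C.Enters a v ∧ C.Enters b v) ∨ (C.Exits a v ∧ C.Exits b v))

/-- The string `S` passes through `v` without turning. -/
def UnbentAt (S : Set C.Edge) (v : C.V) : Prop :=
  ∃ a ∈ S, ∃ b ∈ S, C.Enters a v ∧ C.Exits b v

/-- The endpoint of an inner edge at which one starts when travelling to the right (`s = true`) or
to the left (`s = false`). -/
def near (s : Bool) (e : C.E) : C.V := if s then C.src e else C.tgt e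

/-- The endpoint of an inner edge at which one arrives when travelling to the right (`s = true`) or
to the left (`s = false`). -/
def far (s : Bool) (e : C.E) : C.V := if s then C.tgt e else C.src e

/-- `Necklace P s v u T`: the edges `T` form, travelling in the direction `s` from `v` to `u`, an
alternating sequence edge, cycle, edge, cycle, …, edge, cycle (possibly empty) where a cycle is a
pair of inner edges with the same two endpoints, and the pair satisfies `P`. -/
inductive Necklace (P : C.E → C.E → Prop) (s : Bool) : C.V → C.V → Set C.Edge → Prop
  | nil (v : C.V) : Necklace P s v v ∅
  | cons (e a b : C.E) (u : C.V) (T : Set C.Edge) (hab : a ≠ b)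
      (ha : C.near s a = C.far s e) (hb : C.near s b = C.far s e) (hf : C.far s a = C.far s b)
      (hP : P a b) (h : Necklace P s (C.far s a) u T) :
      Necklace P s (C.near s e) u ({Sum.inl e, Sum.inl a, Sum.inl b} ∪ T)

/-- The two edges of a cycle have the same odd weight. -/
def OddSymmetric (a b : C.E) : Prop := C.wE a = C.wE b ∧ Odd (C.wE a)

/-- The edges `T` form a tail at the vertex `v`, pointing to the left or to the right:
any number of symmetric cycles of odd weight and then either a single end of weight `2o` or a
symmetric fork of ends of weight `o, o`, with `o` odd; or just one end of weight `2e`, `e` even. -/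
def IsTail (v : C.V) (T : Set C.Edge) : Prop :=
  (∃ (s : Bool) (u : C.V) (U : Set C.Edge), C.Necklace C.OddSymmetric s v u U ∧
    ((∃ l, C.root l = u ∧ C.side l = s ∧ C.wL l % 4 = 2 ∧ T = U ∪ {Sum.inr l}) ∨
     (∃ e l l', C.near s e = u ∧ C.root l = C.far s e ∧ C.root l' = C.far s e ∧
        C.side l = s ∧ C.side l' = s ∧ l ≠ l' ∧ C.wL l = C.wL l' ∧ Odd (C.wL l) ∧
        T = U ∪ {Sum.inl e, Sum.inr l, Sum.inr l'}))) ∨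
  (∃ l, C.root l = v ∧ 4 ∣ C.wL l ∧ T = {Sum.inr l})

/-- The edges `T`, all of even weight, attach the string `S` to the string `S'`.  Either `T` is a
chain of inner edges and any number of cycles, and neither string turns at its vertex on
`T`; or `T` is a single inner edge, and both strings turn at their vertices on `T`. -/
def IsConnector (S S' T : Set C.Edge) : Prop :=
  (∀ a ∈ T, Even (C.weight a)) ∧
  ((∃ (s : Bool) (v : C.V) (U : Set C.Edge) (e : C.E),
      C.Necklace (fun _ _ => True) s v (C.near s e) U ∧ T = U ∪ {Sum.inl e} ∧
      C.UnbentAt S v ∧ C.UnbentAt S' (C.far s e)) ∨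
   (∃ (s : Bool) (e : C.E), T = {Sum.inl e} ∧
      C.BendsAt S (C.near s e) ∧ C.BendsAt S' (C.far s e)))

/-- An effective non-zigzag cover with respect to `x 0 < x 1 < … < x (r - 1)`. There are at least
two strings `S i` of odd edges avoiding the symmetric cycles and symmetric odd forks; consecutive
strings are attached by the `Q i`; all other edges belong to tails attached to the strings; and the
inner vertices of the `Q i` are mapped to the first `⌈r / 2⌉` of the points.  (In a cover of type
`(g, λ, μ, x)` all vertices are three-valent, so each tail is a connected component of the complement
of the strings and the connecting pieces.) -/
def IsEffectiveNonZigzag {r : ℕ} (x : Fin r → ℝ) : Prop :=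
  ∃ (n : ℕ) (S : Fin (n + 2) → Set C.Edge) (Q : Fin (n + 1) → Set C.Edge),
    (∀ i, C.IsString (S i) ∧ ∀ a ∈ S i, Odd (C.weight a) ∧ a ∉ C.symEdges) ∧
    (∀ i j, i ≠ j → Disjoint (S i) (S j)) ∧
    (∀ i : Fin (n + 1), C.IsConnector (S i.castSucc) (S i.succ) (Q i)) ∧
    (∀ a, a ∉ (⋃ i, S i) ∪ (⋃ i, Q i) → ∃ (v : C.V) (T : Set C.Edge), a ∈ T ∧
      Disjoint T ((⋃ i, S i) ∪ (⋃ i, Q i)) ∧ v ∈ C.verts (⋃ i, S i) ∧ C.IsTail v T) ∧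
    (∀ i, ∀ v ∈ C.verts (Q i), ∃ j : Fin r, C.pos v = x j ∧ (j : ℕ) + 1 ≤ (r + 1) / 2)

end TropicalCover

/-- The number `r = l(λ) + l(μ) + 2g - 2` of simple branch points. -/
def branchCount (g : ℕ) (lam mu : Multiset ℕ) : ℕ := lam.card + mu.card + 2 * g - 2

/-- The effective non-zigzag number `Z'_g(λ, μ)`, computed with the branch points `x`: twice the
number of isomorphism classes of effective non-zigzag covers of type `(g, λ, μ, x)`. -/
noncomputable def effectiveNonZigzagNumber (g : ℕ) (lam mu : Multiset ℕ)
    (x : Fin (branchCount g lam mu) → ℝ) : ℕ∞ :=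
  2 * (Quotient.mk TropicalCover.isoSetoid ''
    {C | C.HasType g lam mu x ∧ C.IsEffectiveNonZigzag x}).encard

/-- `N ≤ Z'_g(λ, μ)`, whatever the branch points `x_1 < … < x_r` are. -/
def BoundsEffectiveNumber (g : ℕ) (lam mu : Multiset ℕ) (N : ℕ) : Prop :=
  ∀ x : Fin (branchCount g lam mu) → ℝ, StrictMono x →
    (N : ℕ∞) ≤ effectiveNonZigzagNumber g lam mu x

/-! ### The numerical conditions -/

open TailDec

/-- `∑_{n ≠ i} λ_0^n - ∑_{n ≠ j} μ_0^n`, where `a = λ_0^i` and `b = μ_0^j`. -/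
def excessEq (lam mu : Multiset ℕ) (a b : ℕ) : ℤ :=
  total ((single lam).erase a) - total ((single mu).erase b)

/-- `∑_{n ≠ i, j} λ_0^n - ∑ μ_0^n - l(λ_0) + l(μ_0) + 2`, where `a = λ_0^i` and `b = λ_0^j`. -/
def excessGt (lam mu : Multiset ℕ) (a b : ℕ) : ℤ :=
  total (((single lam).erase a).erase b) - total (single mu)
    - (single lam).card + (single mu).card + 2

/-- `∑ λ_0^n - ∑_{n ≠ j} μ_0^n - l(λ_0) + l(μ_0) - 1`, where `b = μ_0^j`. -/
def excessLt (lam mu : Multiset ℕ) (b : ℕ) : ℤ :=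
  total (single lam) - total ((single mu).erase b)
    - (single lam).card + (single mu).card - 1

/-- The set of all values `∑_{n ≠ i} λ_0^n - ∑_{n ≠ j} μ_0^n`. -/
def excessEqSet (lam mu : Multiset ℕ) : Set ℤ :=
  {t | ∃ a ∈ single lam, ∃ b ∈ single mu, t = excessEq lam mu a b}

/-- The set of all values of `excessGt` on two different parts of `λ_0`. -/
def excessGtSet (lam mu : Multiset ℕ) : Set ℤ :=
  {t | ∃ a ∈ single lam, ∃ b ∈ single lam, a ≠ b ∧ t = excessGt lam mu a b}

/-- The set of all values of `excessLt` on the parts of `μ_0`. -/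
def excessLtSet (lam mu : Multiset ℕ) : Set ℤ :=
  {t | ∃ b ∈ single mu, t = excessLt lam mu b}

/-- `t` is the largest negative element of `A`. -/
def IsMaxNegative (A : Set ℤ) (t : ℤ) : Prop := IsGreatest {s | s ∈ A ∧ s < 0} t

/-- `D > 0` if `A` has a positive element, and `D > |t|` for the largest negative element `t` of `A`
(which has to exist) otherwise. -/
def Exceeds (D : ℤ) (A : Set ℤ) : Prop :=
  ((∃ t ∈ A, 0 < t) ∧ 0 < D) ∨ ((∀ t ∈ A, t ≤ 0) ∧ ∃ t, IsMaxNegative A t ∧ |t| < D)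

/-- The sufficient conditions for the existence of effective non-zigzag covers. -/
def ExistenceCondition (g : ℕ) (lam mu : Multiset ℕ) : Prop :=
  ((single lam).card = (single mu).card ∧ 1 ≤ (single lam).card ∧ 1 ≤ (oddPairs mu).card ∧
    Exceeds ((mu.card : ℤ) + 2 * g - 3 * (single lam).card) (excessEqSet lam mu)) ∨
  ((single mu).card < (single lam).card ∧
    (single lam).card < 2 * (oddPairs mu).count 1 + (single mu).card ∧
    Exceeds ((mu.card : ℤ) + 2 * g - 3 * (single lam).card) (excessGtSet lam mu)) ∨
  ((single lam).card < (single mu).card ∧ 1 ≤ (oddPairs mu).card ∧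
    (single mu).card < 2 * (oddPairs lam).count 1 + (single lam).card ∧
    Exceeds ((mu.card : ℤ) + 2 * g - 3 * (single mu).card) (excessLtSet lam mu))

/-- Sub-multisets `A, F, H` of `λ_{2o}, λ_{2e}, λ_{o,o}` satisfy `l + 2 ∑ A + 2 ∑ F + 2 ∑ H > w`. -/
def IsAdmissible (lam : Multiset ℕ) (l w : ℤ) (A F H : Multiset ℕ) : Prop :=
  A ≤ oddHalves lam ∧ F ≤ evenHalves lam ∧ H ≤ oddPairs lam ∧
  w < l + 2 * (A.sum : ℤ) + 2 * (F.sum : ℤ) + 2 * (H.sum : ℤ)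

/-- `A = λ_{2o}^*`, `F = λ_{2e}^*`, `H = λ_{o,o}^*`: an admissible triple for which, in this order,
`n₁ = |H|` is minimal, `m₁ = |A|` is minimal given `n₁`, and `m₂ = |F|` is minimal given
`n₁` and `m₁`. -/
def IsStarSelection (lam : Multiset ℕ) (l w : ℤ) (A F H : Multiset ℕ) : Prop :=
  IsAdmissible lam l w A F H ∧
  (∀ A' F' H', IsAdmissible lam l w A' F' H' → H.card ≤ H'.card) ∧
  (∀ A' F' H', IsAdmissible lam l w A' F' H' → H'.card = H.card → A.card ≤ A'.card) ∧
  (∀ A' F' H', IsAdmissible lam l w A' F' H' → H'.card = H.card → A'.card = A.card →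
    F.card ≤ F'.card)

/-- `n₁! · (l(λ_{o,o}) - n₁)! · l(μ_{o,o})! · ⌊B / 2⌋! · ⌈B / 2⌉!`. -/
def factorialBound (lam mu : Multiset ℕ) (n₁ B : ℕ) : ℕ :=
  n₁.factorial * ((oddPairs lam).card - n₁).factorial * (oddPairs mu).card.factorial *
    (B / 2).factorial * ((B + 1) / 2).factorial

/-! The bound is proved by exhibiting enough covers of one combinatorial shape. A main string starts
at an odd end over -∞ and carries a signed flow that stays odd. At one of its vertices, the
junction, an even flow t ≠ 0 arrives from a chain of side strings; every other vertex carries a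
tail, which changes the flow by an even amount. Each side string joins an odd end over -∞ to an odd
end over +∞ and hands the accumulated difference of these weights on through an edge of even weight.
All cycles sit in a single tail that ends in a fork over +∞. The selected tails λ* come before the
junction and make the flow behind it equal to k > 0. The remaining tails follow in an order for
which the flow changes sign B times, and the main string bends exactly at these sign changes.

Three independent choices produce many covers of this shape. (1) Behind the junction the vertices
may be ordered as follows: the minima of the main string in any order, the upward passages along the
string, the downward passages backwards, the maxima in any order (`pair_sublist_late`). Minima and
maxima alternate, which gives ⌊B/2⌋! ⌈B/2⌉! orders (`crossings_eq`). (2) The vertex of a fork over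
+∞ may be placed anywhere after the vertex from which its stem emanates, that of a fork over -∞
anywhere before. This gives products of odd numbers that dominate factorials
(`prod_mul_card_insertions_le`). (3) The pairs of weights of the n + 1 side strings may be permuted
as long as the flow through every connecting edge has the sign of t. By the cycle lemma at least n!
permutations qualify (`factorial_le_card_positivePerms`). When l(λ₀) ≠ l(μ₀), some pairs of ones are
broken up to serve as ends of strings instead of forks, and these permutations, together with the
additional places for forks behind the junction, make up for the forks lost.

Different choices give non-isomorphic covers. An isomorphism fixes the first vertex of the chain,
the only one with odd ends on both sides, and from there it is forced to be the identity along the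
chain, the main string and the tails (`rigid`, `cover_injective`).

The vertices of the connecting edges have to lie among the first ⌈r/2⌉. Only the main string before
the junction, the chain itself and forks over -∞ can come before them, so this is an inequality
between numbers of parts (`isOrder_of_mem_orders`). It follows from the numerical hypothesis because
a minimal selection has no superfluous part, whence 2 l(λ*) ≤ |t_{i,j}| + 1
(`IsStarSelection.two_mul_card_le`).

The three cases differ in which odd parts become ends of the main string and of the side strings.
For l(λ₀) > l(μ₀) it may happen that no selection is admissible; then all tails of λ fit before the
junction, and the general form holds with B = 0 (`boundsEffectiveNumber_of_all_tails`). -/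

set_option linter.unusedSectionVars false
set_option linter.unusedDecidableInType false
set_option linter.unusedFintypeInType false

/-! ### Tropical covers from signed flows -/

/-- A graph with signed flows: the flow `z e` runs from `tail e` to `head e` if it is positive and
backwards otherwise, and the signed flow `σ l` enters at `root l` through the end `l`. -/
structure FlowGraph (V E L : Type) where
  tail : E → V
  head : E → V
  z : E → ℤ
  root : L → V
  σ : L → ℤ

namespace FlowGraph

variable {V E L : Type} [Fintype V] [Fintype E] [Fintype L] [DecidableEq V] [DecidableEq E]
  [DecidableEq L] (G : FlowGraph V E L)

/-- The sum over the half-edges at `v` of three functions on heads, tails and ends. -/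
def incidence (fh ft : E → ℤ) (fl : L → ℤ) (v : V) : ℤ :=
  (∑ e, if G.head e = v then fh e else 0) + (∑ e, if G.tail e = v then ft e else 0)
    + ∑ l, if G.root l = v then fl l else 0

/-- The lower endpoint of an edge. -/
def low (e : E) : V := if 0 < G.z e then G.tail e else G.head e

/-- The upper endpoint of an edge. -/
def high (e : E) : V := if 0 < G.z e then G.head e else G.tail e

/-- The conditions under which a graph with flows and positions of its vertices is a tropical
cover. -/
structure Realizable (pos : V → ℝ) : Prop where
  nonempty : Nonempty V
  connected : ∀ u v, Relation.EqvGen (fun a b => ∃ e, G.tail e = a ∧ G.head e = b) u v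
  valence : ∀ v, G.incidence (fun _ => 1) (fun _ => 1) (fun _ => 1) v = 3
  balance : ∀ v, G.incidence G.z (fun e => -G.z e) G.σ v = 0
  z_ne : ∀ e, G.z e ≠ 0
  σ_ne : ∀ l, G.σ l ≠ 0
  left : ∃ l, 0 < G.σ l
  right : ∃ l, G.σ l < 0
  pos_lt : ∀ e, pos (G.low e) < pos (G.high e)

variable {G} {pos : V → ℝ}

theorem low_high_cases (e : E) : (G.low e = G.tail e ∧ G.high e = G.head e) ∨
    (G.low e = G.head e ∧ G.high e = G.tail e) := by
  unfold low high
  by_cases h : 0 < G.z e <;> simp [h]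

theorem card_filter_low_add_high (v : V) :
    (((Finset.univ.filter (fun e => G.low e = v)).card
      + (Finset.univ.filter (fun e => G.high e = v)).card
      + (Finset.univ.filter (fun l => G.root l = v)).card : ℕ) : ℤ)
      = G.incidence (fun _ => 1) (fun _ => 1) (fun _ => 1) v := by
  unfold incidence
  push_cast [Finset.card_filter]
  rw [← Finset.sum_add_distrib, ← Finset.sum_add_distrib]
  congr 1
  refine Finset.sum_congr rfl fun e _ => ?_
  rcases low_high_cases (G := G) e with ⟨h1, h2⟩ | ⟨h1, h2⟩ <;> rw [h1, h2]
  ring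

/-- Reversing an edge of negative flow moves its term to the other side of the equation and replaces
it by its absolute value, so signed conservation and balancing are the same identity, term by term.
-/
theorem flow_balanced (v : V) (h : G.incidence G.z (fun e => -G.z e) G.σ v = 0) :
    ∑ e ∈ Finset.univ.filter (fun e => G.high e = v), (G.z e).natAbs
        + ∑ l ∈ Finset.univ.filter (fun l => G.root l = v ∧ decide (G.σ l < 0) = false),
            (G.σ l).natAbs
      = ∑ e ∈ Finset.univ.filter (fun e => G.low e = v), (G.z e).natAbs
        + ∑ l ∈ Finset.univ.filter (fun l => G.root l = v ∧ decide (G.σ l < 0) = true),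
            (G.σ l).natAbs := by
  zify
  simp only [Finset.sum_filter]
  refine sub_eq_zero.1 (Eq.trans ?_ h)
  unfold incidence
  rw [add_sub_add_comm, ← Finset.sum_sub_distrib, ← Finset.sum_sub_distrib,
    ← Finset.sum_add_distrib]
  congr 1
  · refine Finset.sum_congr rfl fun e _ => ?_
    unfold low high
    by_cases hz : 0 < G.z e
    · simp only [hz, if_true, abs_of_pos hz]
      split_ifs <;> ring
    · simp only [hz, if_false, abs_of_nonpos (not_lt.1 hz)]
      split_ifs <;> ring
  · refine Finset.sum_congr rfl fun l _ => ?_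
    by_cases hz : G.σ l < 0
    · simp only [hz, decide_true, abs_of_neg hz]
      split_ifs <;> simp_all
    · simp only [hz, decide_false, abs_of_nonneg (not_lt.1 hz)]
      split_ifs <;> simp_all

variable (G)

/-- The tropical cover given by a graph with flows and positions of its vertices. -/
noncomputable def toCover (pos : V → ℝ) (h : G.Realizable pos) : TropicalCover where
  V := V
  E := E
  L := L
  src := G.low
  tgt := G.high
  root := G.root
  side l := decide (G.σ l < 0)
  len e := (pos (G.high e) - pos (G.low e)) / (G.z e).natAbs
  wE e := (G.z e).natAbs
  wL l := (G.σ l).natAbs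
  pos := pos
  nonempty := h.nonempty
  connected u v := by
    have := h.connected u v
    induction this with
    | rel a b hab =>
      obtain ⟨e, rfl, rfl⟩ := hab
      rcases low_high_cases (G := G) e with ⟨h1, h2⟩ | ⟨h1, h2⟩
      · exact .rel _ _ ⟨e, h1, h2⟩
      · exact .symm _ _ (.rel _ _ ⟨e, h1, h2⟩)
    | refl a => exact .refl a
    | symm a b _ ih => exact .symm _ _ ih
    | trans a b c _ _ ih1 ih2 => exact .trans _ _ _ ih1 ih2
  three_le_valence v := by
    have h1 := h.valence v
    rw [← card_filter_low_add_high] at h1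
    exact_mod_cast h1.ge
  len_pos e := by
    have h1 := h.pos_lt e
    have h2 : 0 < (G.z e).natAbs := Int.natAbs_pos.2 (h.z_ne e)
    have h3 : (0 : ℝ) < (G.z e).natAbs := by exact_mod_cast h2
    exact div_pos (sub_pos.2 h1) h3
  wE_pos e := Int.natAbs_pos.2 (h.z_ne e)
  wL_pos l := Int.natAbs_pos.2 (h.σ_ne l)
  slope e := by
    have h2 : 0 < (G.z e).natAbs := Int.natAbs_pos.2 (h.z_ne e)
    have h3 : ((G.z e).natAbs : ℝ) ≠ 0 := by exact_mod_cast h2.ne'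
    rw [mul_div_cancel₀ _ h3]
    ring
  exists_left := by
    obtain ⟨l, hl⟩ := h.left
    exact ⟨l, by simpa using hl.le⟩
  exists_right := by
    obtain ⟨l, hl⟩ := h.right
    exact ⟨l, by simpa using hl⟩
  balanced v := flow_balanced v (h.balance v)

end FlowGraph

/-! ### Chains of strings -/

/-- The shape of a cover consisting of `n + 1` side strings and a main string with `m + 1` vertices.
The main string starts with the flow `a0`, which changes by `δ j` at the `j`-th vertex. At the vertex
`j0` the chain of side strings is attached, at the other vertices there are tails; those with
`fork j` end in a fork, and the one at `sp` contains `g` cycles. -/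
structure Shape where
  n : ℕ
  m : ℕ
  g : ℕ
  δ : ℕ → ℤ
  fork : ℕ → Bool
  j0 : Fin (m + 1)
  sp : Fin (m + 1)
  fork_sp : fork sp = true
  fork_j0 : fork j0 = false
  a0 : ℤ

namespace Shape

variable (S : Shape)

/-- The vertices of the main string which carry a fork tail. -/
abbrev Fk := {j : Fin (S.m + 1) // S.fork j = true}

/-- The vertices of the main string which carry a single end. -/
abbrev Sg := {j : Fin (S.m + 1) // j ≠ S.j0 ∧ S.fork j = false}

instance : DecidableEq S.Fk := fun _ _ => decidable_of_iff _ Subtype.ext_iff.symm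

/-- The vertices: `vP i` is the vertex of the `i`-th side string from which the flow to the next
string emanates, `vQ i` the vertex of the side string `i + 1` at which the flow from the previous
string arrives, `vM j` are the vertices of the main string, `vF j` those of the forks and `vC i b`
those of the cycles. -/
inductive Vx
  | vP (i : Fin (S.n + 1))
  | vQ (i : Fin S.n)
  | vM (j : Fin (S.m + 1))
  | vF (j : S.Fk)
  | vC (i : Fin S.g) (b : Bool)

/-- The inner edges: `eC i` are the connecting edges, `eI i` the middle edges of the side strings,
`eM i` the inner edges of the main string, `eS j` the stems of the forks, `eL i` the edges before the
cycles and `eA i b` the edges of the cycles. -/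
inductive Ed
  | eC (i : Fin (S.n + 1))
  | eI (i : Fin S.n)
  | eM (i : Fin S.m)
  | eS (j : S.Fk)
  | eL (i : Fin S.g)
  | eA (i : Fin S.g) (b : Bool)

/-- The ends: `lStart` and `lFinal` are the ends of the main string, `lA i` and `lB i` those of the
side strings, `lS j` are the single ends and `lF j b` the ends of the forks. -/
inductive En
  | lStart
  | lFinal
  | lA (i : Fin (S.n + 1))
  | lB (i : Fin (S.n + 1))
  | lS (j : S.Sg)
  | lF (j : S.Fk) (b : Bool)

open Vx Ed En

variable {S}

def vxEquiv : Fin (S.n + 1) ⊕ Fin S.n ⊕ Fin (S.m + 1) ⊕ S.Fk ⊕ (Fin S.g × Bool) ≃ S.Vx where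
  toFun
    | .inl i => vP i
    | .inr (.inl i) => vQ i
    | .inr (.inr (.inl j)) => vM j
    | .inr (.inr (.inr (.inl j))) => vF j
    | .inr (.inr (.inr (.inr (i, b)))) => vC i b
  invFun
    | vP i => .inl i
    | vQ i => .inr (.inl i)
    | vM j => .inr (.inr (.inl j))
    | vF j => .inr (.inr (.inr (.inl j)))
    | vC i b => .inr (.inr (.inr (.inr (i, b))))
  left_inv := by rintro (_ | _ | _ | _ | _) <;> rfl
  right_inv := by rintro (_ | _ | _ | _ | _) <;> rfl

def edEquiv : Fin (S.n + 1) ⊕ Fin S.n ⊕ Fin S.m ⊕ S.Fk ⊕ Fin S.g ⊕ (Fin S.g × Bool) ≃ S.Ed where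
  toFun
    | .inl i => eC i
    | .inr (.inl i) => eI i
    | .inr (.inr (.inl i)) => eM i
    | .inr (.inr (.inr (.inl j))) => eS j
    | .inr (.inr (.inr (.inr (.inl i)))) => eL i
    | .inr (.inr (.inr (.inr (.inr (i, b))))) => eA i b
  invFun
    | eC i => .inl i
    | eI i => .inr (.inl i)
    | eM i => .inr (.inr (.inl i))
    | eS j => .inr (.inr (.inr (.inl j)))
    | eL i => .inr (.inr (.inr (.inr (.inl i))))
    | eA i b => .inr (.inr (.inr (.inr (.inr (i, b)))))
  left_inv := by rintro (_ | _ | _ | _ | _ | _) <;> rfl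
  right_inv := by rintro (_ | _ | _ | _ | _ | _) <;> rfl

def enEquiv : Unit ⊕ Unit ⊕ Fin (S.n + 1) ⊕ Fin (S.n + 1) ⊕ S.Sg ⊕ (S.Fk × Bool) ≃ S.En where
  toFun
    | .inl _ => lStart
    | .inr (.inl _) => lFinal
    | .inr (.inr (.inl i)) => lA i
    | .inr (.inr (.inr (.inl i))) => lB i
    | .inr (.inr (.inr (.inr (.inl j)))) => lS j
    | .inr (.inr (.inr (.inr (.inr (j, b))))) => lF j b
  invFun
    | lStart => .inl ()
    | lFinal => .inr (.inl ())
    | lA i => .inr (.inr (.inl i))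
    | lB i => .inr (.inr (.inr (.inl i)))
    | lS j => .inr (.inr (.inr (.inr (.inl j))))
    | lF j b => .inr (.inr (.inr (.inr (.inr (j, b)))))
  left_inv := by rintro (_ | _ | _ | _ | _ | _) <;> rfl
  right_inv := by rintro (_ | _ | _ | _ | _ | _) <;> rfl

noncomputable instance : DecidableEq S.Vx := Classical.decEq _

noncomputable instance : DecidableEq S.Ed := Classical.decEq _

noncomputable instance : DecidableEq S.En := Classical.decEq _

instance : Fintype S.Vx := Fintype.ofEquiv _ vxEquiv

instance : Fintype S.Ed := Fintype.ofEquiv _ edEquiv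

instance : Fintype S.En := Fintype.ofEquiv _ enEquiv

/-- The vertex at which the `i`-th connecting edge arrives. -/
def qv : Fin (S.n + 1) → S.Vx := Fin.lastCases (vM S.j0) (fun i => vQ i)

@[simp] theorem qv_last : qv (Fin.last S.n) = vM S.j0 := by simp [qv]
@[simp] theorem qv_castSucc (i : Fin S.n) : qv i.castSucc = vQ i := by simp [qv]

/-- The vertices on the special tail from which the edges not in cycles emanate. -/
def cp : Fin (S.g + 1) → S.Vx := Fin.cases (vM S.sp) (fun i => vC i true)

@[simp] theorem cp_zero : cp 0 = vM S.sp := rfl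
@[simp] theorem cp_succ (i : Fin S.g) : cp i.succ = vC i true := rfl

/-- The vertex from which the stem of a fork emanates. -/
def base (j : S.Fk) : S.Vx := if j.1 = S.sp then cp (Fin.last S.g) else vM j.1

/-- The vertex of the starting end of a side string. -/
def rootA : Fin (S.n + 1) → S.Vx := Fin.cases (vP 0) (fun i => vQ i)

@[simp] theorem rootA_zero : (rootA 0 : S.Vx) = vP 0 := rfl
@[simp] theorem rootA_succ (i : Fin S.n) : rootA i.succ = vQ i := rfl

variable (S)

def tail : S.Ed → S.Vx
  | eC i => vP i
  | eI i => vQ i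
  | eM i => vM i.castSucc
  | eS j => base j
  | eL i => cp i.castSucc
  | eA i _ => vC i false

def head : S.Ed → S.Vx
  | eC i => qv i
  | eI i => vP i.succ
  | eM i => vM i.succ
  | eS j => vF j
  | eL i => vC i false
  | eA i _ => vC i true

def root : S.En → S.Vx
  | lStart => vM 0
  | lFinal => vM (Fin.last S.m)
  | lA i => rootA i
  | lB i => vP i
  | lS j => vM j.1
  | lF j _ => vF j

/-- The flow on the main string before the `j`-th vertex. -/
def val (j : ℕ) : ℤ := S.a0 + ∑ i ∈ Finset.range j, S.δ i

variable {S}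

/-- The flow from the `i`-th side string to the next one. -/
def conFlow (A B : Fin (S.n + 1) → ℤ) (i : Fin (S.n + 1)) : ℤ :=
  ∑ j ∈ Finset.univ.filter (fun j => j ≤ i), (A j - B j)

variable (S)

def flowE (A B : Fin (S.n + 1) → ℤ) : S.Ed → ℤ
  | eC i => conFlow A B i
  | eI i => A i.succ + conFlow A B i.castSucc
  | eM i => S.val (i + 1)
  | eS j => -S.δ j.1
  | eL _ => -S.δ S.sp
  | eA _ _ => -(S.δ S.sp / 2)

def flowL (A B : Fin (S.n + 1) → ℤ) : S.En → ℤ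
  | lStart => S.a0
  | lFinal => -S.val (S.m + 1)
  | lA i => A i
  | lB i => -B i
  | lS j => S.δ j.1
  | lF j _ => S.δ j.1 / 2

/-- The graph with flows of the given shape, in which the side strings have the flow `A i` at the
start and `B i` at the end. -/
def graph (A B : Fin (S.n + 1) → ℤ) : FlowGraph S.Vx S.Ed S.En where
  tail := S.tail
  head := S.head
  z := S.flowE A B
  root := S.root
  σ := S.flowL A B

variable {S}

theorem sp_ne_j0 : S.sp ≠ S.j0 := by
  intro h
  have h1 := S.fork_sp
  rw [h, S.fork_j0] at h1
  exact absurd h1 (by decide)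

theorem conFlow_zero (A B : Fin (S.n + 1) → ℤ) : conFlow A B 0 = A 0 - B 0 := by
  simp [conFlow, Finset.filter_eq']

theorem conFlow_succ (A B : Fin (S.n + 1) → ℤ) (i : Fin S.n) :
    conFlow A B i.succ = conFlow A B i.castSucc + (A i.succ - B i.succ) := by
  unfold conFlow
  have : Finset.univ.filter (fun j => j ≤ i.succ)
      = insert i.succ (Finset.univ.filter (fun j => j ≤ i.castSucc)) := by
    ext j
    simp only [Finset.mem_filter, Finset.mem_univ, true_and, Finset.mem_insert, Fin.le_def,
      Fin.ext_iff, Fin.val_succ, Fin.val_castSucc]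
    omega
  rw [this, Finset.sum_insert (by simp [Fin.le_def]), add_comm]

theorem val_succ (j : ℕ) : S.val (j + 1) = S.val j + S.δ j := by
  simp [val, Finset.sum_range_succ, add_assoc]

theorem val_zero : S.val 0 = S.a0 := by simp [val]

/-! ### Half-edges at each kind of vertex: valence and conservation of flow -/

section Incidence

variable (A B : Fin (S.n + 1) → ℤ) (fh ft : S.Ed → ℤ) (fl : S.En → ℤ)

theorem sum_ends (v : S.Vx) : (∑ l, if S.root l = v then fl l else 0) =
    (if vM 0 = v then fl lStart else 0) + (if vM (Fin.last S.m) = v then fl lFinal else 0)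
    + (∑ i, if rootA i = v then fl (lA i) else 0) + (∑ i, if vP i = v then fl (lB i) else 0)
    + (∑ j : S.Sg, if vM j.1 = v then fl (lS j) else 0)
    + ∑ j : S.Fk, if vF j = v then fl (lF j true) + fl (lF j false) else 0 := by
  rw [← Equiv.sum_comp enEquiv]
  simp only [Fintype.sum_sum_type, Fintype.sum_prod_type, Fintype.sum_bool, Finset.univ_unique,
    Finset.sum_singleton]
  have : ∀ j : S.Fk, ((if vF j = v then fl (lF j true) else 0)
      + if vF j = v then fl (lF j false) else 0)
      = if vF j = v then fl (lF j true) + fl (lF j false) else 0 := by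
    intro j; split_ifs <;> simp
  simp only [← this, add_assoc]
  rfl

theorem sum_heads (v : S.Vx) : (∑ e, if S.head e = v then fh e else 0) =
    (∑ i, if qv i = v then fh (eC i) else 0) + (∑ i : Fin S.n, if vP i.succ = v then fh (eI i) else 0)
    + (∑ i : Fin S.m, if vM i.succ = v then fh (eM i) else 0)
    + (∑ j : S.Fk, if vF j = v then fh (eS j) else 0)
    + (∑ i : Fin S.g, if vC i false = v then fh (eL i) else 0)
    + ∑ i : Fin S.g, if vC i true = v then fh (eA i true) + fh (eA i false) else 0 := by
  rw [← Equiv.sum_comp edEquiv]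
  simp only [Fintype.sum_sum_type, Fintype.sum_prod_type, Fintype.sum_bool]
  have : ∀ j : Fin S.g, ((if vC j true = v then fh (eA j true) else 0)
      + if vC j true = v then fh (eA j false) else 0)
      = if vC j true = v then fh (eA j true) + fh (eA j false) else 0 := by
    intro j; split_ifs <;> simp
  simp only [← this, add_assoc]
  rfl

theorem sum_tails (v : S.Vx) : (∑ e, if S.tail e = v then ft e else 0) =
    (∑ i, if vP i = v then ft (eC i) else 0) + (∑ i : Fin S.n, if vQ i = v then ft (eI i) else 0)
    + (∑ i : Fin S.m, if vM i.castSucc = v then ft (eM i) else 0)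
    + (∑ j : S.Fk, if base j = v then ft (eS j) else 0)
    + (∑ i : Fin S.g, if cp i.castSucc = v then ft (eL i) else 0)
    + ∑ i : Fin S.g, if vC i false = v then ft (eA i true) + ft (eA i false) else 0 := by
  rw [← Equiv.sum_comp edEquiv]
  simp only [Fintype.sum_sum_type, Fintype.sum_prod_type, Fintype.sum_bool]
  have : ∀ j : Fin S.g, ((if vC j false = v then ft (eA j true) else 0)
      + if vC j false = v then ft (eA j false) else 0)
      = if vC j false = v then ft (eA j true) + ft (eA j false) else 0 := by
    intro j; split_ifs <;> simp
  simp only [← this, add_assoc]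
  rfl

/-- The edge of the special tail, not in a cycle, which emanates from `cp k`. -/
def spEdge : Fin (S.g + 1) → S.Ed := Fin.lastCases (eS ⟨S.sp, S.fork_sp⟩) (fun i => eL i)

/-- The stem of the special fork starts behind the last cycle and not on the main string. Taken out
of the sum over forks, it completes the edges before the cycles to a family indexed by the vertices
`cp k`. -/
theorem sum_stems_add_links (v : S.Vx) :
    (∑ j : S.Fk, if base j = v then ft (eS j) else 0)
      + (∑ i : Fin S.g, if cp i.castSucc = v then ft (eL i) else 0)
    = (∑ j : S.Fk, if j.1 ≠ S.sp ∧ vM j.1 = v then ft (eS j) else 0)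
      + ∑ k : Fin (S.g + 1), if cp k = v then ft (spEdge k) else 0 := by
  rw [Fin.sum_univ_castSucc]
  simp only [spEdge, Fin.lastCases_castSucc, Fin.lastCases_last]
  have h : (∑ j : S.Fk, if base j = v then ft (eS j) else 0)
      = ∑ j : S.Fk, ((if j.1 ≠ S.sp ∧ vM j.1 = v then ft (eS j) else 0)
        + if j = ⟨S.sp, S.fork_sp⟩ then (if cp (Fin.last S.g) = v then
            ft (eS ⟨S.sp, S.fork_sp⟩) else 0) else 0) := by
    refine Finset.sum_congr rfl fun j _ => ?_
    by_cases hj : j.1 = S.sp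
    · have : j = ⟨S.sp, S.fork_sp⟩ := Subtype.ext hj
      subst this
      simp [base]
    · have : j ≠ ⟨S.sp, S.fork_sp⟩ := fun h => hj (congrArg Subtype.val h)
      simp [base, hj, this]
  rw [h, Finset.sum_add_distrib, Finset.sum_ite_eq' Finset.univ]
  simp only [Finset.mem_univ, if_true]
  ring

theorem incidence_eq (v : S.Vx) : (S.graph A B).incidence fh ft fl v =
    ((∑ i, if qv i = v then fh (eC i) else 0)
      + (∑ i : Fin S.n, if vP i.succ = v then fh (eI i) else 0)
      + (∑ i : Fin S.m, if vM i.succ = v then fh (eM i) else 0)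
      + (∑ j : S.Fk, if vF j = v then fh (eS j) else 0)
      + (∑ i : Fin S.g, if vC i false = v then fh (eL i) else 0)
      + ∑ i : Fin S.g, if vC i true = v then fh (eA i true) + fh (eA i false) else 0)
    + ((∑ i, if vP i = v then ft (eC i) else 0) + (∑ i : Fin S.n, if vQ i = v then ft (eI i) else 0)
      + (∑ i : Fin S.m, if vM i.castSucc = v then ft (eM i) else 0)
      + ((∑ j : S.Fk, if j.1 ≠ S.sp ∧ vM j.1 = v then ft (eS j) else 0)
        + ∑ k : Fin (S.g + 1), if cp k = v then ft (spEdge k) else 0)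
      + ∑ i : Fin S.g, if vC i false = v then ft (eA i true) + ft (eA i false) else 0)
    + ((if vM 0 = v then fl lStart else 0) + (if vM (Fin.last S.m) = v then fl lFinal else 0)
      + (∑ i, if rootA i = v then fl (lA i) else 0) + (∑ i, if vP i = v then fl (lB i) else 0)
      + (∑ j : S.Sg, if vM j.1 = v then fl (lS j) else 0)
      + ∑ j : S.Fk, if vF j = v then fl (lF j true) + fl (lF j false) else 0) := by
  rw [← sum_stems_add_links, ← sum_ends, ← sum_heads]
  refine (congrArg₂ _ (congrArg₂ _ rfl ?_) rfl : _)
  refine Eq.trans (sum_tails ft v) ?_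
  ring

theorem incidence_vP_zero : (S.graph A B).incidence fh ft fl (vP 0) =
    ft (eC 0) + fl (lA 0) + fl (lB 0) := by
  -- `qv` is exceptional at its last index, `cp` and `rootA` at the index zero; once these terms are
  -- split off, every condition compares two constructors.
  rw [incidence_eq, Fin.sum_univ_castSucc (n := S.n), Fin.sum_univ_succ (n := S.g),
    Fin.sum_univ_succ (f := fun i => if rootA i = vP 0 then _ else _)]
  simp [Fin.succ_ne_zero, add_assoc]

theorem incidence_vP_succ (k : Fin S.n) : (S.graph A B).incidence fh ft fl (vP k.succ) =
    fh (eI k) + ft (eC k.succ) + fl (lB k.succ) := by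
  rw [incidence_eq, Fin.sum_univ_castSucc (n := S.n), Fin.sum_univ_succ (n := S.g),
    Fin.sum_univ_succ (f := fun i => if rootA i = vP k.succ then _ else _)]
  simp [(Fin.succ_ne_zero _).symm]

theorem incidence_vQ (k : Fin S.n) : (S.graph A B).incidence fh ft fl (vQ k) =
    fh (eC k.castSucc) + ft (eI k) + fl (lA k.succ) := by
  rw [incidence_eq, Fin.sum_univ_castSucc (n := S.n), Fin.sum_univ_succ (n := S.g),
    Fin.sum_univ_succ (f := fun i => if rootA i = vQ k then _ else _)]
  simp

theorem incidence_vF (k : S.Fk) : (S.graph A B).incidence fh ft fl (vF k) =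
    fh (eS k) + (fl (lF k true) + fl (lF k false)) := by
  rw [incidence_eq, Fin.sum_univ_castSucc (n := S.n), Fin.sum_univ_succ (n := S.g),
    Fin.sum_univ_succ (f := fun i => if rootA i = vF k then _ else _)]
  simp

theorem incidence_vC_false (k : Fin S.g) : (S.graph A B).incidence fh ft fl (vC k false) =
    fh (eL k) + (ft (eA k true) + ft (eA k false)) := by
  rw [incidence_eq, Fin.sum_univ_castSucc (n := S.n), Fin.sum_univ_succ (n := S.g),
    Fin.sum_univ_succ (f := fun i => if rootA i = vC k false then _ else _)]
  simp

theorem incidence_vC_true (k : Fin S.g) : (S.graph A B).incidence fh ft fl (vC k true) =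
    fh (eA k true) + fh (eA k false) + ft (spEdge k.succ) := by
  rw [incidence_eq, Fin.sum_univ_castSucc (n := S.n), Fin.sum_univ_succ (n := S.g),
    Fin.sum_univ_succ (f := fun i => if rootA i = vC k true then _ else _)]
  simp

theorem incidence_vM (k : Fin (S.m + 1)) : (S.graph A B).incidence fh ft fl (vM k) =
    (Fin.cases (fl lStart) (fun i => fh (eM i)) k : ℤ)
    + (Fin.lastCases (fl lFinal) (fun i => ft (eM i)) k : ℤ)
    + ((if S.j0 = k then fh (eC (Fin.last S.n)) else 0)
      + (∑ j : S.Fk, if j.1 ≠ S.sp ∧ j.1 = k then ft (eS j) else 0)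
      + (if S.sp = k then ft (spEdge 0) else 0)
      + ∑ j : S.Sg, if j.1 = k then fl (lS j) else 0) := by
  have h1 : (Fin.cases (fl lStart) (fun i => fh (eM i)) k : ℤ)
      = (if 0 = k then fl lStart else 0) + ∑ i : Fin S.m, if i.succ = k then fh (eM i) else 0 := by
    induction k using Fin.cases with
    | zero => simp [Fin.succ_ne_zero]
    | succ i => simp [(Fin.succ_ne_zero _).symm]
  have h2 : (Fin.lastCases (fl lFinal) (fun i => ft (eM i)) k : ℤ)
      = (if Fin.last S.m = k then fl lFinal else 0)
        + ∑ i : Fin S.m, if i.castSucc = k then ft (eM i) else 0 := by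
    induction k using Fin.lastCases with
    | last => simp [(Fin.castSucc_lt_last _).ne]
    | cast i => simp [(Fin.castSucc_lt_last _).ne']
  rw [incidence_eq, Fin.sum_univ_castSucc (n := S.n), Fin.sum_univ_succ (n := S.g),
    Fin.sum_univ_succ (f := fun i => if rootA i = vM k then _ else _), h1, h2]
  simp
  ring

theorem incidence_vM_j0 : (S.graph A B).incidence fh ft fl (vM S.j0) =
    (Fin.cases (fl lStart) (fun i => fh (eM i)) S.j0 : ℤ)
    + (Fin.lastCases (fl lFinal) (fun i => ft (eM i)) S.j0 : ℤ) + fh (eC (Fin.last S.n)) := by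
  rw [incidence_vM, if_pos rfl, if_neg sp_ne_j0, Finset.sum_eq_zero, Finset.sum_eq_zero]
  · ring
  · intro j _
    rw [if_neg j.2.1]
  · intro j _
    rw [if_neg]
    rintro ⟨-, h⟩
    have := j.2
    rw [h, S.fork_j0] at this
    exact absurd this (by decide)

theorem incidence_vM_sp : (S.graph A B).incidence fh ft fl (vM S.sp) =
    (Fin.cases (fl lStart) (fun i => fh (eM i)) S.sp : ℤ)
    + (Fin.lastCases (fl lFinal) (fun i => ft (eM i)) S.sp : ℤ) + ft (spEdge 0) := by
  rw [incidence_vM, if_neg sp_ne_j0.symm, if_pos rfl, Finset.sum_eq_zero, Finset.sum_eq_zero]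
  · ring
  · intro j _
    rw [if_neg]
    intro h
    have := j.2.2
    rw [h, S.fork_sp] at this
    exact absurd this (by decide)
  · intro j _
    rw [if_neg (fun h => h.1 h.2)]

theorem incidence_vM_fork (k : S.Fk) (hk : k.1 ≠ S.sp) :
    (S.graph A B).incidence fh ft fl (vM k.1) =
    (Fin.cases (fl lStart) (fun i => fh (eM i)) k.1 : ℤ)
    + (Fin.lastCases (fl lFinal) (fun i => ft (eM i)) k.1 : ℤ) + ft (eS k) := by
  have hk0 : S.j0 ≠ k.1 := by
    intro h
    have := k.2
    rw [← h, S.fork_j0] at this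
    exact absurd this (by decide)
  rw [incidence_vM, if_neg hk0, if_neg hk.symm, Finset.sum_eq_single k, if_pos ⟨hk, rfl⟩,
    Finset.sum_eq_zero]
  · ring
  · intro j _
    rw [if_neg]
    intro h
    have := j.2.2
    rw [h, k.2] at this
    exact absurd this (by decide)
  · intro j _ hj
    rw [if_neg]
    rintro ⟨-, h⟩
    exact hj (Subtype.ext h)
  · simp

theorem incidence_vM_single (k : S.Sg) :
    (S.graph A B).incidence fh ft fl (vM k.1) =
    (Fin.cases (fl lStart) (fun i => fh (eM i)) k.1 : ℤ)
    + (Fin.lastCases (fl lFinal) (fun i => ft (eM i)) k.1 : ℤ) + fl (lS k) := by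
  have hk : S.sp ≠ k.1 := by
    intro h
    have := k.2.2
    rw [← h, S.fork_sp] at this
    exact absurd this (by decide)
  rw [incidence_vM, if_neg k.2.1.symm, if_neg hk, Finset.sum_eq_zero, Finset.sum_eq_single k,
    if_pos rfl]
  · ring
  · intro j _ hj
    rw [if_neg]
    intro h
    exact hj (Subtype.ext h)
  · simp
  · intro j _
    rw [if_neg]
    rintro ⟨-, h⟩
    have := j.2
    rw [h, k.2.2] at this
    exact absurd this (by decide)

end Incidence

theorem main_cases {motive : Fin (S.m + 1) → Prop} (h0 : motive S.j0) (hs : motive S.sp)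
    (hf : ∀ k : S.Fk, k.1 ≠ S.sp → motive k.1) (h1 : ∀ k : S.Sg, motive k.1) (j : Fin (S.m + 1)) :
    motive j := by
  by_cases hj0 : j = S.j0
  · exact hj0 ▸ h0
  by_cases hsp : j = S.sp
  · exact hsp ▸ hs
  by_cases hfk : S.fork j = true
  · exact hf ⟨j, hfk⟩ hsp
  · exact h1 ⟨j, hj0, by simpa using hfk⟩

theorem valence_eq (A B : Fin (S.n + 1) → ℤ) (v : S.Vx) :
    (S.graph A B).incidence (fun _ => 1) (fun _ => 1) (fun _ => 1) v = 3 := by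
  have hc : ∀ k : Fin (S.m + 1), (Fin.cases (motive := fun _ => ℤ) 1 (fun _ => 1) k : ℤ) = 1 := by
    intro k; induction k using Fin.cases <;> simp
  have hl : ∀ k : Fin (S.m + 1),
      (Fin.lastCases (motive := fun _ => ℤ) 1 (fun _ => 1) k : ℤ) = 1 := by
    intro k; induction k using Fin.lastCases <;> simp
  rcases v with i | i | j | j | ⟨i, b⟩
  · induction i using Fin.cases with
    | zero => rw [incidence_vP_zero]; norm_num
    | succ i => rw [incidence_vP_succ]; norm_num
  · rw [incidence_vQ]; norm_num
  · induction j using main_cases with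
    | h0 => rw [incidence_vM_j0, hc, hl]; norm_num
    | hs => rw [incidence_vM_sp, hc, hl]; norm_num
    | hf k hk => rw [incidence_vM_fork _ _ _ _ _ k hk, hc, hl]; norm_num
    | h1 k => rw [incidence_vM_single _ _ _ _ _ k, hc, hl]; norm_num
  · rw [incidence_vF]; norm_num
  · cases b
    · rw [incidence_vC_false]; norm_num
    · rw [incidence_vC_true]; norm_num

theorem flowE_spEdge (A B : Fin (S.n + 1) → ℤ) (k : Fin (S.g + 1)) :
    S.flowE A B (spEdge k) = -S.δ S.sp := by
  induction k using Fin.lastCases <;> simp [spEdge, flowE]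

/-- On the main string conservation is the recursion for `val`, on the side strings the recursion
for `conFlow`, and `h0` links the two at the junction. The evenness in `hf` is needed since forks
and cycles split a flow into two equal halves. -/
theorem balance_eq (A B : Fin (S.n + 1) → ℤ) (h0 : conFlow A B (Fin.last S.n) = S.δ S.j0)
    (hf : ∀ j : S.Fk, 2 * (S.δ j.1 / 2) = S.δ j.1) (v : S.Vx) :
    (S.graph A B).incidence (S.flowE A B) (fun e => -S.flowE A B e) (S.flowL A B) v = 0 := by
  have hc : ∀ k : Fin (S.m + 1), (Fin.cases (motive := fun _ => ℤ) (S.flowL A B lStart)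
      (fun i => S.flowE A B (eM i)) k : ℤ) = S.val k := by
    intro k; induction k using Fin.cases <;> simp [flowL, flowE, val_zero]
  have hl : ∀ k : Fin (S.m + 1), (Fin.lastCases (motive := fun _ => ℤ) (S.flowL A B lFinal)
      (fun i => -S.flowE A B (eM i)) k : ℤ) = -S.val (k + 1) := by
    intro k; induction k using Fin.lastCases <;> simp [flowL, flowE]
  rcases v with i | i | j | j | ⟨i, b⟩
  · induction i using Fin.cases with
    | zero => rw [incidence_vP_zero]; simp [flowE, flowL, conFlow_zero]
    | succ i => rw [incidence_vP_succ]; simp [flowE, flowL, conFlow_succ]; ring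
  · rw [incidence_vQ]; simp [flowE, flowL]
  · induction j using main_cases with
    | h0 => rw [incidence_vM_j0, hc, hl, val_succ]; simp [flowE, h0]
    | hs => rw [incidence_vM_sp, hc, hl, val_succ, flowE_spEdge]; simp
    | hf k hk => rw [incidence_vM_fork _ _ _ _ _ k hk, hc, hl, val_succ]; simp [flowE]
    | h1 k => rw [incidence_vM_single _ _ _ _ _ k, hc, hl, val_succ]; simp [flowL]
  · rw [incidence_vF]
    have := hf j
    simp only [flowE, flowL]; linarith
  · have := hf ⟨S.sp, S.fork_sp⟩
    cases b
    · rw [incidence_vC_false]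
      simp only [flowE]; linarith
    · rw [incidence_vC_true, flowE_spEdge]
      simp only [flowE]; linarith

theorem graph_connected (u v : S.Vx) :
    Relation.EqvGen (fun a b => ∃ e, S.tail e = a ∧ S.head e = b) u v := by
  set R : S.Vx → S.Vx → Prop := fun a b => ∃ e, S.tail e = a ∧ S.head e = b with hR
  have edge : ∀ e, Relation.EqvGen R (S.tail e) (S.head e) := fun e => .rel _ _ ⟨e, rfl, rfl⟩
  have hM : ∀ j : Fin (S.m + 1), Relation.EqvGen R (vM j) (vM 0) := by
    intro j
    induction j using Fin.induction with
    | zero => exact .refl _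
    | succ i ih => exact .trans _ _ _ (.symm _ _ (edge (eM i))) ih
  have hP : ∀ i : Fin (S.n + 1), Relation.EqvGen R (vP i) (vM 0) := by
    intro i
    induction i using Fin.reverseInduction with
    | last =>
      have := edge (eC (Fin.last S.n))
      simp only [tail, head, qv_last] at this
      exact this.trans _ _ _ (hM _)
    | cast i ih =>
      have h1 := edge (eC i.castSucc)
      have h2 := edge (eI i)
      simp only [tail, head, qv_castSucc] at h1 h2
      exact (h1.trans _ _ _ h2).trans _ _ _ ih
  have hcp : ∀ k : Fin (S.g + 1), Relation.EqvGen R (cp k) (vM 0) := by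
    intro k
    induction k using Fin.induction with
    | zero => exact hM _
    | succ i ih =>
      have h1 := edge (eL i)
      have h2 := edge (eA i true)
      exact .trans _ _ _ (.symm _ _ (.trans _ _ _ h1 h2)) ih
  have hall : ∀ w : S.Vx, Relation.EqvGen R w (vM 0) := by
    rintro (i | i | j | j | ⟨i, b⟩)
    · exact hP i
    · exact .trans _ _ _ (edge (eI i)) (hP _)
    · exact hM j
    · refine .trans _ _ _ (.symm _ _ (edge (eS j))) ?_
      change Relation.EqvGen R (base j) (vM 0)
      unfold base
      split_ifs
      · exact hcp _
      · exact hM _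
    · cases b
      · exact .trans _ _ _ (.symm _ _ (edge (eL i))) (hcp _)
      · exact hcp i.succ
  exact .trans _ _ _ (hall u) (.symm _ _ (hall v))

end Shape

namespace Shape

open Vx Ed En

variable {S : Shape}

/-! ### Realizing a shape by tropical covers -/

variable (S)

/-- The conditions on the main string and its tails. -/
structure MainOK : Prop where
  a0_odd : Odd S.a0
  val_pos : ∀ j : ℕ, j ≤ S.j0 + 1 → 0 < S.val j
  δ_sp : S.δ S.sp < 0
  even : ∀ j : Fin (S.m + 1), Even (S.δ j)
  δ_ne : ∀ j : S.Sg, S.δ j.1 ≠ 0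
  fork_odd : ∀ j : S.Fk, Odd (S.δ j.1 / 2)

/-- The conditions on the side strings; the flows point to the main string if `b = true`. -/
structure SideOK (b : Bool) (A B : Fin (S.n + 1) → ℤ) : Prop where
  A_odd : ∀ i, Odd (A i)
  B_odd : ∀ i, Odd (B i)
  A_sign : ∀ i, if b then 0 < A i else A i < 0
  B_sign : ∀ i, if b then 0 < B i else B i < 0
  con_sign : ∀ i, if b then 0 < conFlow A B i else conFlow A B i < 0
  con_last : conFlow A B (Fin.last S.n) = S.δ S.j0

/-- Whether the flow on an edge is positive. -/
def up (b : Bool) : S.Ed → Bool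
  | eC _ => b
  | eI _ => b
  | eM i => decide (0 < S.val (i + 1))
  | eS j => decide (S.δ j.1 < 0)
  | eL _ => true
  | eA _ _ => true

/-- The lower endpoint of an edge. -/
def lo (b : Bool) (e : S.Ed) : S.Vx := if S.up b e then S.tail e else S.head e

/-- The upper endpoint of an edge. -/
def hi (b : Bool) (e : S.Ed) : S.Vx := if S.up b e then S.head e else S.tail e

/-- A linear order of the vertices, given as a list, which is compatible with the flows and has the
vertices of the connecting edges in its first half. -/
structure IsOrder (b : Bool) (ord : List S.Vx) : Prop where
  nodup : ord.Nodup
  mem : ∀ v, v ∈ ord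
  before : ∀ e, ord.idxOf (S.lo b e) < ord.idxOf (S.hi b e)
  early_vP : ∀ i, ord.idxOf (vP i) + 1 ≤ (ord.length + 1) / 2
  early_qv : ∀ i, ord.idxOf (qv i) + 1 ≤ (ord.length + 1) / 2

variable {S}

/-- The edges of odd flow. -/
def isOdd : S.Ed → Bool
  | eC _ => false
  | eI _ => true
  | eM _ => true
  | eS _ => false
  | eL _ => false
  | eA _ _ => true

/-! ### Parities and signs of the flows -/

section Flows

variable {b : Bool} {A B : Fin (S.n + 1) → ℤ}

theorem MainOK.val_odd (hM : S.MainOK) (j : ℕ) (hj : j ≤ S.m + 1) : Odd (S.val j) := by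
  unfold val
  refine hM.a0_odd.add_even ?_
  refine Finset.even_sum _ fun i hi => ?_
  exact hM.even ⟨i, lt_of_lt_of_le (Finset.mem_range.1 hi) hj⟩

theorem SideOK.conFlow_even (hS : S.SideOK b A B) (i : Fin (S.n + 1)) : Even (conFlow A B i) :=
  Finset.even_sum _ fun j _ => (hS.A_odd j).sub_odd (hS.B_odd j)

/-- Parity depends only on the kind of edge and not on the chosen flows. Since isomorphisms preserve
weights, they therefore preserve the kinds up to parity. -/
theorem odd_flowE (hM : S.MainOK) (hS : S.SideOK b A B) (e : S.Ed) :
    Odd (S.flowE A B e) ↔ isOdd e = true := by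
  rcases e with i | i | i | j | i | ⟨i, c⟩
  · simpa [isOdd, flowE] using hS.conFlow_even i
  · simpa [isOdd, flowE] using (hS.A_odd i.succ).add_even (hS.conFlow_even _)
  · simpa [isOdd, flowE] using hM.val_odd (i + 1) (by omega)
  · simpa [isOdd, flowE] using hM.even j.1
  · simpa [isOdd, flowE] using hM.even S.sp
  · simpa [isOdd, flowE] using hM.fork_odd ⟨S.sp, S.fork_sp⟩

theorem two_mul_half (hM : S.MainOK) (j : Fin (S.m + 1)) : 2 * (S.δ j / 2) = S.δ j :=
  Int.two_mul_ediv_two_of_even (hM.even j)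

/-- The orientation is the same for all admissible flows of the side strings. Hence the order of the
vertices and these flows can be chosen independently of each other. -/
theorem flowE_up (hM : S.MainOK) (hS : S.SideOK b A B) (e : S.Ed) :
    0 < S.flowE A B e ↔ S.up b e = true := by
  rcases e with i | i | i | j | i | ⟨i, c⟩
  · have := hS.con_sign i
    cases b
    · simpa [up, flowE] using (show conFlow A B i < 0 from by simpa using this).le
    · simpa [up, flowE] using this
  · have h1 := hS.con_sign i.castSucc
    have h2 := hS.A_sign i.succ
    cases b <;> simp only [up, flowE] <;> simp at h1 h2 ⊢ <;> omega
  · simp [up, flowE]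
  · simp [up, flowE]
  · simpa [up, flowE] using hM.δ_sp
  · have := hM.δ_sp
    have h2 := two_mul_half hM S.sp
    simp only [up, flowE, iff_true]; omega

theorem flowE_ne (hM : S.MainOK) (hS : S.SideOK b A B) (e : S.Ed) : S.flowE A B e ≠ 0 := by
  rcases e with i | i | i | j | i | ⟨i, c⟩
  · have := hS.con_sign i
    cases b <;> simp at this <;> simp only [flowE] <;> omega
  · have h1 := hS.con_sign i.castSucc
    have h2 := hS.A_sign i.succ
    cases b <;> simp at h1 h2 <;> simp only [flowE] <;> omega
  · intro h
    have h2 := (odd_flowE hM hS (eM i)).2 rfl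
    rw [h] at h2
    exact absurd h2 (by decide)
  · have h1 := hM.fork_odd j
    intro h
    simp only [flowE, neg_eq_zero] at h
    rw [h] at h1
    exact absurd h1 (by decide)
  · have := hM.δ_sp
    simp only [flowE]; omega
  · intro h
    have h2 := (odd_flowE hM hS (eA i c)).2 rfl
    rw [h] at h2
    exact absurd h2 (by decide)

theorem flowL_ne (hM : S.MainOK) (hS : S.SideOK b A B) (l : S.En) : S.flowL A B l ≠ 0 := by
  rcases l with _ | _ | i | i | j | ⟨j, c⟩
  · have := hM.val_pos 0 (by omega)
    rw [val_zero] at this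
    simp only [flowL]; omega
  · have := hM.val_odd (S.m + 1) le_rfl
    intro h
    simp only [flowL, neg_eq_zero] at h
    rw [h] at this
    exact absurd this (by decide)
  · have := hS.A_sign i
    cases b <;> simp at this <;> simp only [flowL] <;> omega
  · have := hS.B_sign i
    cases b <;> simp at this <;> simp only [flowL] <;> omega
  · exact hM.δ_ne j
  · have := hM.fork_odd j
    intro h
    simp only [flowL] at h
    rw [h] at this
    exact absurd this (by decide)

theorem low_eq (hM : S.MainOK) (hS : S.SideOK b A B) (e : S.Ed) :
    (S.graph A B).low e = S.lo b e := by
  have h := flowE_up hM hS e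
  by_cases h1 : S.up b e = true
  · simp only [FlowGraph.low, graph, lo, h.2 h1, h1, if_true]
  · have h2 := mt h.1 h1
    simp [FlowGraph.low, graph, lo, h2, h1]

theorem high_eq (hM : S.MainOK) (hS : S.SideOK b A B) (e : S.Ed) :
    (S.graph A B).high e = S.hi b e := by
  have h := flowE_up hM hS e
  by_cases h1 : S.up b e = true
  · simp only [FlowGraph.high, graph, hi, h.2 h1, h1, if_true]
  · have h2 := mt h.1 h1
    simp [FlowGraph.high, graph, hi, h2, h1]

end Flows

/-- The positions of the vertices in a linear order. -/
noncomputable def posOf {r : ℕ} (x : Fin r → ℝ) (ord : List S.Vx) (v : S.Vx) : ℝ :=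
  if h : ord.idxOf v < r then x ⟨ord.idxOf v, h⟩ else 0

theorem IsOrder.posOf_eq {b : Bool} {ord : List S.Vx} (h : S.IsOrder b ord) {r : ℕ}
    (hr : ord.length = r) (x : Fin r → ℝ) (v : S.Vx) :
    posOf x ord v = x ⟨ord.idxOf v, hr ▸ List.idxOf_lt_length_of_mem (h.mem v)⟩ := by
  unfold posOf
  rw [dif_pos]

theorem realizable {b : Bool} {A B : Fin (S.n + 1) → ℤ} (hM : S.MainOK) (hS : S.SideOK b A B)
    {ord : List S.Vx} (ho : S.IsOrder b ord) {r : ℕ} (hr : ord.length = r) {x : Fin r → ℝ}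
    (hx : StrictMono x) : (S.graph A B).Realizable (posOf x ord) where
  nonempty := ⟨vM 0⟩
  connected := graph_connected
  valence := valence_eq A B
  balance := balance_eq A B hS.con_last (fun j => two_mul_half hM j.1)
  z_ne := flowE_ne hM hS
  σ_ne := flowL_ne hM hS
  left := ⟨lStart, by simpa [graph, flowL, val_zero] using hM.val_pos 0 (by omega)⟩
  right := ⟨lF ⟨S.sp, S.fork_sp⟩ true, by
    have h1 := hM.δ_sp
    have h2 := two_mul_half hM S.sp
    simp only [graph, flowL]; omega⟩
  pos_lt e := by
    rw [low_eq hM hS, high_eq hM hS, ho.posOf_eq hr, ho.posOf_eq hr]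
    exact hx (ho.before e)

/-- The cover given by flows on the side strings and an order of the vertices. -/
noncomputable def cover {b : Bool} {A B : Fin (S.n + 1) → ℤ} (hM : S.MainOK)
    (hS : S.SideOK b A B) {ord : List S.Vx} (ho : S.IsOrder b ord) {r : ℕ} (hr : ord.length = r)
    {x : Fin r → ℝ} (hx : StrictMono x) : TropicalCover :=
  (S.graph A B).toCover (posOf x ord) (realizable hM hS ho hr hx)

end Shape

/-! ### The type of the covers: genus and weights of the ends -/

namespace FlowGraph

variable {V E L : Type} [Fintype V] [Fintype E] [Fintype L] [DecidableEq V] [DecidableEq E]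
  [DecidableEq L] (G : FlowGraph V E L)

/-- The sign of the flow at an end tells over which side it lies, so splitting the multiset of end
flows by sign recovers λ and μ. A zero part of μ would be counted on the left, hence `hmu`. -/
theorem toCover_hasType {pos : V → ℝ} (h : G.Realizable pos) {g : ℕ} {lam mu : Multiset ℕ}
    (hcard : Fintype.card E + 1 = Fintype.card V + g) (hmu : ∀ n ∈ mu, 0 < n)
    (hends : Finset.univ.val.map G.σ
      = lam.map (fun n : ℕ => (n : ℤ)) + mu.map (fun n : ℕ => -(n : ℤ)))
    {r : ℕ} {x : Fin r → ℝ} (hx : ∀ i, ∃ v, pos v = x i) :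
    (G.toCover pos h).HasType g lam mu x := by
  refine ⟨hcard, ?_, ?_, hx⟩
  · have h1 : (Finset.univ.filter (fun l : L => decide (G.σ l < 0) = false)).val.map
        (fun l => (G.σ l).natAbs)
        = ((Finset.univ.val.map G.σ).filter (fun t => ¬ t < 0)).map Int.natAbs := by
      rw [Multiset.filter_map, Multiset.map_map, Finset.filter_val]
      refine congrArg₂ _ rfl (Multiset.filter_congr fun l _ => ?_)
      simp
    refine h1.trans ?_
    rw [hends, Multiset.filter_add, Multiset.filter_eq_self.2, Multiset.filter_eq_nil.2]
    · simp
    · simp only [Multiset.mem_map, forall_exists_index, and_imp]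
      rintro _ n hn rfl
      have := hmu n hn
      simp [this]
    · simp
  · have h1 : (Finset.univ.filter (fun l : L => decide (G.σ l < 0) = true)).val.map
        (fun l => (G.σ l).natAbs)
        = ((Finset.univ.val.map G.σ).filter (fun t => t < 0)).map Int.natAbs := by
      rw [Multiset.filter_map, Multiset.map_map, Finset.filter_val]
      refine congrArg₂ _ rfl (Multiset.filter_congr fun l _ => ?_)
      simp
    refine h1.trans ?_
    rw [hends, Multiset.filter_add, Multiset.filter_eq_nil.2, Multiset.filter_eq_self.2]
    · simp
    · simp only [Multiset.mem_map, forall_exists_index, and_imp]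
      rintro _ n hn rfl
      have := hmu n hn
      simp [this]
    · simp

end FlowGraph

namespace Shape

open Vx Ed En

variable {S : Shape} {b : Bool} {A B : Fin (S.n + 1) → ℤ} {ord : List S.Vx} {r : ℕ}
  {x : Fin r → ℝ}

/-- Without the cycles the graph is a tree; each cycle adds three edges and two vertices. -/
theorem card_edges : Fintype.card S.Ed + 1 = Fintype.card S.Vx + S.g := by
  rw [← Fintype.card_congr (edEquiv (S := S)), ← Fintype.card_congr (vxEquiv (S := S))]
  simp only [Fintype.card_sum, Fintype.card_prod, Fintype.card_fin, Fintype.card_bool]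
  omega

theorem cover_hasType (hM : S.MainOK) (hS : S.SideOK b A B) (ho : S.IsOrder b ord)
    (hr : ord.length = r) (hx : StrictMono x) {lam mu : Multiset ℕ} (hmu : ∀ n ∈ mu, 0 < n)
    (hends : Finset.univ.val.map (S.flowL A B)
      = lam.map (fun n : ℕ => (n : ℤ)) + mu.map (fun n : ℕ => -(n : ℤ))) :
    (cover hM hS ho hr hx).HasType S.g lam mu x := by
  refine FlowGraph.toCover_hasType _ _ card_edges hmu hends fun i => ?_
  refine ⟨ord[i.1]'(hr ▸ i.2), ?_⟩
  rw [ho.posOf_eq hr]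
  congr 1
  ext
  exact List.Nodup.idxOf_getElem ho.nodup _ _

/-! ### The covers are effective non-zigzag covers -/

/-- The edges of the `i`-th side string. -/
def sideString (i : Fin (S.n + 1)) : Set (S.Ed ⊕ S.En) :=
  {a | a = .inr (lA i) ∨ a = .inr (lB i) ∨ ∃ k : Fin S.n, k.succ = i ∧ a = .inl (eI k)}

/-- The edges of the main string. -/
def mainString : Set (S.Ed ⊕ S.En) :=
  {a | a = .inr lStart ∨ a = .inr lFinal ∨ ∃ k, a = .inl (eM k)}

/-- The strings. -/
def strings : Fin (S.n + 2) → Set (S.Ed ⊕ S.En) := Fin.lastCases mainString sideString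

@[simp] theorem strings_last : (strings (Fin.last (S.n + 1)) : Set (S.Ed ⊕ S.En)) = mainString := by
  simp [strings]

@[simp] theorem strings_castSucc (i : Fin (S.n + 1)) :
    (strings i.castSucc : Set (S.Ed ⊕ S.En)) = sideString i := by
  simp [strings]

/-- The edges of the tails. -/
def isTailEdge : S.Ed ⊕ S.En → Bool
  | .inl (eS _) => true
  | .inl (eL _) => true
  | .inl (eA _ _) => true
  | .inr (lS _) => true
  | .inr (lF _ _) => true
  | _ => false

theorem isTailEdge_of_mem_strings {i : Fin (S.n + 2)} {a : S.Ed ⊕ S.En} (h : a ∈ strings i) :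
    isTailEdge a = false := by
  induction i using Fin.lastCases with
  | last =>
    rw [strings_last] at h
    rcases h with rfl | rfl | ⟨k, rfl⟩ <;> rfl
  | cast i =>
    rw [strings_castSucc] at h
    rcases h with rfl | rfl | ⟨k, _, rfl⟩ <;> rfl

theorem strings_disjoint {i j : Fin (S.n + 2)} (hij : i ≠ j) :
    Disjoint (strings i : Set (S.Ed ⊕ S.En)) (strings j) := by
  rw [Set.disjoint_left]
  intro a hi hj
  induction i using Fin.lastCases with
  | last =>
    induction j using Fin.lastCases with
    | last => exact hij rfl
    | cast j =>
      rw [strings_last] at hi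
      rw [strings_castSucc] at hj
      rcases hi with rfl | rfl | ⟨k, rfl⟩ <;> simp [sideString] at hj
  | cast i =>
    induction j using Fin.lastCases with
    | last =>
      rw [strings_castSucc] at hi
      rw [strings_last] at hj
      rcases hi with rfl | rfl | ⟨k, _, rfl⟩ <;> simp [mainString] at hj
    | cast j =>
      have hij' : i ≠ j := fun h => hij (h ▸ rfl)
      rw [strings_castSucc] at hi hj
      rcases hi with rfl | rfl | ⟨k, rfl, rfl⟩ <;> simp [sideString] at hj <;> simp_all

theorem mem_union_iff (a : S.Ed ⊕ S.En) :
    a ∈ (⋃ i, strings i) ∪ (⋃ i : Fin (S.n + 1), {Sum.inl (eC i)}) ↔ isTailEdge a = false := by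
  constructor
  · rintro (h | h)
    · obtain ⟨i, hi⟩ := Set.mem_iUnion.1 h
      exact isTailEdge_of_mem_strings hi
    · obtain ⟨i, rfl⟩ := Set.mem_iUnion.1 h
      rfl
  · have hmain : ∀ a : S.Ed ⊕ S.En, a ∈ mainString → a ∈ ⋃ i, strings i := fun a ha =>
      Set.mem_iUnion.2 ⟨Fin.last _, by rwa [strings_last]⟩
    have hside : ∀ i (a : S.Ed ⊕ S.En), a ∈ sideString i → a ∈ ⋃ i, strings i := fun i a ha =>
      Set.mem_iUnion.2 ⟨i.castSucc, by rwa [strings_castSucc]⟩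
    rcases a with (i | i | i | i | i | i) | (_ | _ | i | i | i | i)
    · exact fun _ => .inr (Set.mem_iUnion.2 ⟨i, rfl⟩)
    · exact fun _ => .inl (hside i.succ _ (.inr (.inr ⟨i, rfl, rfl⟩)))
    · exact fun _ => .inl (hmain _ (.inr (.inr ⟨i, rfl⟩)))
    · exact fun h => absurd h (by simp [isTailEdge])
    · exact fun h => absurd h (by simp [isTailEdge])
    · exact fun h => absurd h (by simp [isTailEdge])
    · exact fun _ => .inl (hmain _ (.inl rfl))
    · exact fun _ => .inl (hmain _ (.inr (.inl rfl)))
    · exact fun _ => .inl (hside i _ (.inl rfl))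
    · exact fun _ => .inl (hside i _ (.inr (.inl rfl)))
    · exact fun h => absurd h (by simp [isTailEdge])
    · exact fun h => absurd h (by simp [isTailEdge])

section Cover

variable (hM : S.MainOK) (hS : S.SideOK b A B) (ho : S.IsOrder b ord) (hr : ord.length = r)
  (hx : StrictMono x)

theorem touches_inl (e : S.Ed) (v : S.Vx) :
    (cover hM hS ho hr hx).Touches (.inl e) v ↔ S.tail e = v ∨ S.head e = v := by
  change (S.graph A B).high e = v ∨ (S.graph A B).low e = v ↔ _
  rcases FlowGraph.low_high_cases (G := S.graph A B) e with ⟨h1, h2⟩ | ⟨h1, h2⟩ <;>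
    rw [h1, h2] <;> simp only [graph]
  exact or_comm

theorem touches_inr (l : S.En) (v : S.Vx) :
    (cover hM hS ho hr hx).Touches (.inr l) v ↔ S.root l = v := by
  change (S.root l = v ∧ decide (S.flowL A B l < 0) = false) ∨
    (S.root l = v ∧ decide (S.flowL A B l < 0) = true) ↔ _
  cases decide (S.flowL A B l < 0) <;> simp

theorem enters_inl (e : S.Ed) (v : S.Vx) :
    (cover hM hS ho hr hx).Enters (.inl e) v ↔ S.hi b e = v := by
  rw [← high_eq hM hS]; rfl

theorem exits_inl (e : S.Ed) (v : S.Vx) :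
    (cover hM hS ho hr hx).Exits (.inl e) v ↔ S.lo b e = v := by
  rw [← low_eq hM hS]; rfl

theorem enters_inr (l : S.En) (v : S.Vx) :
    (cover hM hS ho hr hx).Enters (.inr l) v ↔ S.root l = v ∧ 0 < S.flowL A B l := by
  have := flowL_ne hM hS l
  change S.root l = v ∧ decide (S.flowL A B l < 0) = false ↔ _
  simp only [decide_eq_false_iff_not]
  refine and_congr_right fun _ => ?_
  omega

theorem exits_inr (l : S.En) (v : S.Vx) :
    (cover hM hS ho hr hx).Exits (.inr l) v ↔ S.root l = v ∧ S.flowL A B l < 0 := by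
  change S.root l = v ∧ decide (S.flowL A B l < 0) = true ↔ _
  simp

end Cover

/-- The edge through which the main string arrives at a vertex. -/
def inM : Fin (S.m + 1) → S.Ed ⊕ S.En := Fin.cases (.inr lStart) (fun i => .inl (eM i))

/-- The edge through which the main string leaves a vertex. -/
def outM : Fin (S.m + 1) → S.Ed ⊕ S.En := Fin.lastCases (.inr lFinal) (fun i => .inl (eM i))

/-- The edge through which a side string arrives at its last vertex. -/
def inP : Fin (S.n + 1) → S.Ed ⊕ S.En := Fin.cases (.inr (lA 0)) (fun i => .inl (eI i))

theorem inM_ne_outM (j : Fin (S.m + 1)) : (inM j : S.Ed ⊕ S.En) ≠ outM j := by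
  induction j using Fin.cases with
  | zero =>
    rw [show (inM 0 : S.Ed ⊕ S.En) = .inr lStart from rfl]
    induction (0 : Fin (S.m + 1)) using Fin.lastCases <;> simp [outM]
  | succ i =>
    rcases Fin.eq_castSucc_or_eq_last i.succ with ⟨k, hk⟩ | h
    · rw [hk]
      simp only [outM, Fin.lastCases_castSucc]
      rw [← hk]
      simp only [inM, Fin.cases_succ, ne_eq, Sum.inl.injEq, eM.injEq]
      rintro rfl
      have := congrArg Fin.val hk
      simp at this
    · rw [h]
      simp only [outM, Fin.lastCases_last]
      rw [← h]
      simp [inM]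

theorem mem_mainString_touch {a : S.Ed ⊕ S.En} (j : Fin (S.m + 1)) :
    (a ∈ mainString ∧ ((∃ e, a = .inl e ∧ (S.tail e = vM j ∨ S.head e = vM j)) ∨
      ∃ l, a = .inr l ∧ S.root l = vM j)) ↔ a = inM j ∨ a = outM j := by
  have h1 : a = inM j ↔ (a = .inr lStart ∧ 0 = j) ∨ ∃ k : Fin S.m, a = .inl (eM k) ∧ k.succ = j := by
    induction j using Fin.cases with
    | zero => simp [inM, Fin.succ_ne_zero]
    | succ i => simp [inM, (Fin.succ_ne_zero _).symm]
  have h2 : a = outM j ↔ (a = .inr lFinal ∧ Fin.last S.m = j) ∨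
      ∃ k : Fin S.m, a = .inl (eM k) ∧ k.castSucc = j := by
    induction j using Fin.lastCases with
    | last => simp [outM, (Fin.castSucc_lt_last _).ne]
    | cast i => simp [outM, (Fin.castSucc_lt_last _).ne']
  rw [h1, h2]
  constructor
  · rintro ⟨rfl | rfl | ⟨k, rfl⟩, h⟩
    · simp [root] at h; simp [h]
    · simp [root] at h; simp [h]
    · simp [tail, head] at h
      rcases h with h | h <;> simp [h]
  · rintro ((⟨rfl, rfl⟩ | ⟨k, rfl, rfl⟩) | (⟨rfl, rfl⟩ | ⟨k, rfl, rfl⟩))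
    · exact ⟨.inl rfl, .inr ⟨_, rfl, rfl⟩⟩
    · exact ⟨.inr (.inr ⟨k, rfl⟩), .inl ⟨_, rfl, .inr rfl⟩⟩
    · exact ⟨.inr (.inl rfl), .inr ⟨_, rfl, rfl⟩⟩
    · exact ⟨.inr (.inr ⟨k, rfl⟩), .inl ⟨_, rfl, .inl rfl⟩⟩

end Shape

namespace Shape

open Vx Ed En

variable {S : Shape} {b : Bool} {A B : Fin (S.n + 1) → ℤ} {ord : List S.Vx} {r : ℕ}
  {x : Fin r → ℝ}

/-! ### The strings of the cover -/

section Cover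

variable (hM : S.MainOK) (hS : S.SideOK b A B) (ho : S.IsOrder b ord) (hr : ord.length = r)
  (hx : StrictMono x)

theorem touches_iff (a : S.Ed ⊕ S.En) (v : S.Vx) : (cover hM hS ho hr hx).Touches a v ↔
    (∃ e, a = .inl e ∧ (S.tail e = v ∨ S.head e = v)) ∨ ∃ l, a = .inr l ∧ S.root l = v := by
  rcases a with e | l
  · refine (touches_inl hM hS ho hr hx e v).trans ?_; simp
  · refine (touches_inr hM hS ho hr hx l v).trans ?_; simp

/-- Adjacency is symmetric, so it is enough to connect every edge with one base edge `c`; naming the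
two edges at a vertex replaces counting them. -/
theorem isString_of {T : Set (S.Ed ⊕ S.En)} (c : S.Ed ⊕ S.En) (hc : c ∈ T)
    (hconn : ∀ a ∈ T, Relation.ReflTransGen (fun p q => p ∈ T ∧ q ∈ T ∧
      ∃ v, (cover hM hS ho hr hx).Touches p v ∧ (cover hM hS ho hr hx).Touches q v) a c)
    (h2 : ∀ v, ∀ a ∈ T, (cover hM hS ho hr hx).Touches a v → ∃ p q, p ≠ q ∧
      ∀ a', (a' ∈ T ∧ (cover hM hS ho hr hx).Touches a' v) ↔ a' = p ∨ a' = q) :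
    (cover hM hS ho hr hx).IsString T := by
  refine ⟨⟨c, hc⟩, fun a ha a' ha' => ?_, fun v hv => ?_⟩
  · refine (hconn a ha).trans ?_
    have : ∀ p q, Relation.ReflTransGen (fun p q => p ∈ T ∧ q ∈ T ∧
        ∃ v, (cover hM hS ho hr hx).Touches p v ∧ (cover hM hS ho hr hx).Touches q v) p q →
        Relation.ReflTransGen (fun p q => p ∈ T ∧ q ∈ T ∧
        ∃ v, (cover hM hS ho hr hx).Touches p v ∧ (cover hM hS ho hr hx).Touches q v) q p := by
      intro p q hpq
      induction hpq with
      | refl => exact .refl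
      | tail _ h ih =>
        obtain ⟨h1, h2, v, h3, h4⟩ := h
        exact .head ⟨h2, h1, v, h4, h3⟩ ih
    exact this _ _ (hconn a' ha')
  · obtain ⟨a, ha, hav⟩ := hv
    obtain ⟨p, q, hpq, h⟩ := h2 v a ha hav
    rw [← Set.ncard_pair hpq]
    congr 1
    ext a'
    exact h a'

theorem mainString_isString : (cover hM hS ho hr hx).IsString mainString := by
  have key : ∀ j (a : S.Ed ⊕ S.En), (a ∈ mainString ∧ (cover hM hS ho hr hx).Touches a (vM j)) ↔
      a = inM j ∨ a = outM j := by
    intro j a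
    rw [touches_iff, mem_mainString_touch]
  refine isString_of hM hS ho hr hx (.inr lStart) (.inl rfl) ?_ ?_
  · have hstep : ∀ j, Relation.ReflTransGen (fun p q => p ∈ mainString ∧ q ∈ mainString ∧
        ∃ v, (cover hM hS ho hr hx).Touches p v ∧ (cover hM hS ho hr hx).Touches q v)
        (outM j) (inM j) := by
      intro j
      have h1 := (key j (inM j)).2 (.inl rfl)
      have h2 := (key j (outM j)).2 (.inr rfl)
      exact .single ⟨h2.1, h1.1, _, h2.2, h1.2⟩
    have hin : ∀ j, Relation.ReflTransGen (fun p q => p ∈ mainString ∧ q ∈ mainString ∧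
        ∃ v, (cover hM hS ho hr hx).Touches p v ∧ (cover hM hS ho hr hx).Touches q v)
        (inM j) (.inr lStart) := by
      intro j
      induction j using Fin.induction with
      | zero => exact .refl
      | succ i ih =>
        have := hstep i.castSucc
        simp only [outM, Fin.lastCases_castSucc] at this
        exact this.trans ih
    rintro a (rfl | rfl | ⟨k, rfl⟩)
    · exact .refl
    · have := hstep (Fin.last _)
      simp only [outM, Fin.lastCases_last] at this
      exact this.trans (hin _)
    · exact hin k.succ
  · intro v a ha hav
    obtain ⟨j, rfl⟩ : ∃ j, v = vM j := by
      replace hav := (touches_iff hM hS ho hr hx a v).1 hav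
      rcases ha with rfl | rfl | ⟨k, rfl⟩
      · simp [root] at hav; exact ⟨_, hav.symm⟩
      · simp [root] at hav; exact ⟨_, hav.symm⟩
      · simp [tail, head] at hav
        rcases hav with h | h <;> exact ⟨_, h.symm⟩
    exact ⟨_, _, inM_ne_outM j, key j⟩

theorem sideString_touch_vP (i : Fin (S.n + 1)) (a : S.Ed ⊕ S.En) :
    (a ∈ sideString i ∧ (cover hM hS ho hr hx).Touches a (vP i)) ↔
      a = inP i ∨ a = .inr (lB i) := by
  rw [touches_iff]
  constructor
  · rintro ⟨rfl | rfl | ⟨k, rfl, rfl⟩, h⟩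
    · induction i using Fin.cases with
      | zero => exact .inl rfl
      | succ i => simp [root] at h
    · exact .inr rfl
    · exact .inl rfl
  · rintro (rfl | rfl)
    · induction i using Fin.cases with
      | zero => exact ⟨.inl rfl, .inr ⟨_, rfl, rfl⟩⟩
      | succ k => exact ⟨.inr (.inr ⟨k, rfl, rfl⟩), .inl ⟨_, rfl, .inr rfl⟩⟩
    · exact ⟨.inr (.inl rfl), .inr ⟨_, rfl, rfl⟩⟩

theorem sideString_touch_vQ (k : Fin S.n) (a : S.Ed ⊕ S.En) :
    (a ∈ sideString k.succ ∧ (cover hM hS ho hr hx).Touches a (vQ k)) ↔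
      a = .inr (lA k.succ) ∨ a = .inl (eI k) := by
  rw [touches_iff]
  constructor
  · rintro ⟨rfl | rfl | ⟨k', hk, rfl⟩, h⟩
    · exact .inl rfl
    · simp [root] at h
    · rw [Fin.succ_inj.1 hk]
      exact .inr rfl
  · rintro (rfl | rfl)
    · exact ⟨.inl rfl, .inr ⟨_, rfl, rfl⟩⟩
    · exact ⟨.inr (.inr ⟨k, rfl, rfl⟩), .inl ⟨_, rfl, .inl rfl⟩⟩

theorem sideString_isString (i : Fin (S.n + 1)) :
    (cover hM hS ho hr hx).IsString (sideString i) := by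
  refine isString_of hM hS ho hr hx (.inr (lB i)) (.inr (.inl rfl)) ?_ ?_
  · have h1 : Relation.ReflTransGen (fun p q => p ∈ sideString i ∧ q ∈ sideString i ∧
        ∃ v, (cover hM hS ho hr hx).Touches p v ∧ (cover hM hS ho hr hx).Touches q v)
        (inP i) (.inr (lB i)) := by
      have h1 := (sideString_touch_vP hM hS ho hr hx i (inP i)).2 (.inl rfl)
      have h2 := (sideString_touch_vP hM hS ho hr hx i (.inr (lB i))).2 (.inr rfl)
      exact .single ⟨h1.1, h2.1, _, h1.2, h2.2⟩
    rintro a (rfl | rfl | ⟨k, rfl, rfl⟩)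
    · induction i using Fin.cases with
      | zero => exact h1
      | succ k =>
        have h3 := (sideString_touch_vQ hM hS ho hr hx k (.inr (lA k.succ))).2 (.inl rfl)
        have h4 := (sideString_touch_vQ hM hS ho hr hx k (.inl (eI k))).2 (.inr rfl)
        exact .trans (.single ⟨h3.1, h4.1, _, h3.2, h4.2⟩) h1
    · exact .refl
    · exact h1
  · intro v a ha hav
    obtain rfl | ⟨k, rfl, rfl⟩ : v = vP i ∨ ∃ k, i = Fin.succ k ∧ v = vQ k := by
      replace hav := (touches_iff hM hS ho hr hx a v).1 hav
      rcases ha with rfl | rfl | ⟨k, rfl, rfl⟩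
      · simp [root] at hav
        induction i using Fin.cases with
        | zero => exact .inl hav.symm
        | succ k => exact .inr ⟨k, rfl, hav.symm⟩
      · simp [root] at hav
        exact .inl hav.symm
      · simp [tail, head] at hav
        rcases hav with h | h
        · exact .inr ⟨k, rfl, h.symm⟩
        · exact .inl h.symm
    · refine ⟨_, _, ?_, sideString_touch_vP hM hS ho hr hx i⟩
      induction i using Fin.cases <;> simp [inP]
    · exact ⟨_, _, by simp, sideString_touch_vQ hM hS ho hr hx k⟩

theorem qv_eq_vQ {i : Fin (S.n + 1)} {k : Fin S.n} : qv i = vQ k ↔ i = k.castSucc := by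
  induction i using Fin.lastCases with
  | last => simpa using (Fin.castSucc_lt_last k).ne'
  | cast i => simp

theorem qv_ne_vP {i k : Fin (S.n + 1)} : (qv i : S.Vx) ≠ vP k := by
  induction i using Fin.lastCases <;> simp

theorem cp_ne_vP {i : Fin (S.g + 1)} {k : Fin (S.n + 1)} : (cp i : S.Vx) ≠ vP k := by
  induction i using Fin.cases <;> simp

theorem base_cases (j : S.Fk) : (∃ k, base j = vM k) ∨ ∃ k, base j = cp k := by
  unfold base
  split_ifs
  · exact .inr ⟨_, rfl⟩
  · exact .inl ⟨_, rfl⟩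

/-- The junction and the special tail occupy different vertices of the main string. Consequently the
two ends of the main string are never at the same vertex. -/
theorem m_ne_zero : S.m ≠ 0 := by
  intro h
  have : Subsingleton (Fin (S.m + 1)) := by rw [h]; exact inferInstanceAs (Subsingleton (Fin 1))
  exact sp_ne_j0 (Subsingleton.elim S.sp S.j0)

theorem endpoints_of_low_eq {e e' : S.Ed} {c c' : Bool} (h1 : S.lo c e = S.lo c' e')
    (h2 : S.hi c e = S.hi c' e') : (S.tail e = S.tail e' ∧ S.head e = S.head e') ∨
      (S.tail e = S.head e' ∧ S.head e = S.tail e') := by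
  unfold lo at h1
  unfold hi at h2
  split_ifs at h1 h2 <;> simp [h1, h2]

/-- The only parallel edges of the graph are the pairs forming the cycles. -/
theorem string_edge_unique {e e' : S.Ed} (he : (∃ k, e = eI k) ∨ ∃ k, e = eM k)
    (h : (S.tail e = S.tail e' ∧ S.head e = S.head e') ∨
      (S.tail e = S.head e' ∧ S.head e = S.tail e')) : e = e' := by
  rcases he with ⟨k, rfl⟩ | ⟨k, rfl⟩
  · rcases e' with i | i | i | i | i | ⟨i, c⟩
    · simp only [tail, head, reduceCtorEq, false_and, false_or] at h
      obtain ⟨h1, h2⟩ := h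
      rw [eq_comm, qv_eq_vQ] at h1
      have := Vx.vP.inj h2
      rw [h1] at this
      have := congrArg Fin.val this
      simp at this
    · simpa [tail, head] using h
    · simp [tail, head] at h
    · simp [tail, head] at h
    · simp [tail, head] at h
    · simp [tail, head] at h
  · rcases e' with i | i | i | i | i | ⟨i, c⟩
    · simp [tail, head] at h
    · simp [tail, head] at h
    · simp only [tail, head, Vx.vM.injEq] at h
      rcases h with h | h
      · rw [Fin.castSucc_inj.1 h.1]
      · have h1 := congrArg Fin.val h.1
        have h2 := congrArg Fin.val h.2
        simp at h1 h2
        omega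
    · simp [tail, head] at h
    · simp [tail, head] at h
    · simp [tail, head] at h

/-- An inner edge of a string has no parallel edge. Apart from forks, two odd ends share a vertex
only at the start of the chain, and there their weights differ by the nonzero flow to the next
string. -/
theorem string_not_symEdge {i : Fin (S.n + 2)} {a : S.Ed ⊕ S.En} (ha : a ∈ strings i) :
    a ∉ (cover hM hS ho hr hx).symEdges := by
  rintro (⟨e, e', rfl, hne, h1, h2, h3⟩ | ⟨l, l', rfl, hne, h1, h2, h3⟩)
  · refine hne (string_edge_unique ?_ ?_)
    · induction i using Fin.lastCases with
      | last =>
        rw [strings_last] at ha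
        rcases ha with h | h | ⟨k, h⟩
        · cases h
        · cases h
        · exact .inr ⟨k, Sum.inl.inj h⟩
      | cast i =>
        rw [strings_castSucc] at ha
        rcases ha with h | h | ⟨k, _, h⟩
        · cases h
        · cases h
        · exact .inl ⟨k, Sum.inl.inj h⟩
    · refine endpoints_of_low_eq (c := b) (c' := b) ?_ ?_
      · exact (low_eq hM hS e).symm.trans (h1.trans (low_eq hM hS e'))
      · exact (high_eq hM hS e).symm.trans (h2.trans (high_eq hM hS e'))
  · change S.root l = S.root l' at h1
    change (S.flowL A B l).natAbs = (S.flowL A B l').natAbs at h2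
    change Odd (S.flowL A B l).natAbs at h3
    have hS2 : ∀ j : S.Sg, ¬ Odd (S.flowL A B (lS j)).natAbs := by
      intro j
      rw [Int.natAbs_odd, Int.not_odd_iff_even]
      exact hM.even j.1
    -- `conFlow A B 0 = A 0 - B 0` is nonzero, and `A 0`, `B 0` have the same sign.
    have h0 : (S.flowL A B (lA 0)).natAbs ≠ (S.flowL A B (lB 0)).natAbs := by
      have c1 := hS.con_sign 0
      have c2 := hS.A_sign 0
      have c3 := hS.B_sign 0
      rw [conFlow_zero] at c1
      simp only [flowL]
      cases b <;> simp at c1 c2 c3 <;> omega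
    have hlast : (Fin.last S.m) ≠ 0 := fun h => m_ne_zero (congrArg Fin.val h)
    rcases l with _ | _ | i | i | j | ⟨j, c⟩
    · rcases l' with _ | _ | i | i | j | ⟨j, c⟩
      · exact hne rfl
      · simp only [root, Vx.vM.injEq] at h1; exact hlast h1.symm
      · induction i using Fin.cases <;> simp [root] at h1
      · simp [root] at h1
      · rw [h2] at h3; exact hS2 j h3
      · simp [root] at h1
    · rcases l' with _ | _ | i | i | j | ⟨j, c⟩
      · simp only [root, Vx.vM.injEq] at h1; exact hlast h1
      · exact hne rfl
      · induction i using Fin.cases <;> simp [root] at h1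
      · simp [root] at h1
      · rw [h2] at h3; exact hS2 j h3
      · simp [root] at h1
    · rcases l' with _ | _ | i' | i' | j | ⟨j, c⟩
      · induction i using Fin.cases <;> simp [root] at h1
      · induction i using Fin.cases <;> simp [root] at h1
      · refine hne (congrArg _ ?_)
        induction i using Fin.cases <;> induction i' using Fin.cases <;> simp_all [root]
      · induction i using Fin.cases with
        | zero =>
          simp only [root, rootA_zero, Vx.vP.injEq] at h1
          rw [← h1] at h2; exact h0 h2
        | succ k => simp [root] at h1
      · rw [h2] at h3; exact hS2 j h3
      · induction i using Fin.cases <;> simp [root] at h1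
    · rcases l' with _ | _ | i' | i' | j | ⟨j, c⟩
      · simp [root] at h1
      · simp [root] at h1
      · induction i' using Fin.cases with
        | zero =>
          simp only [root, rootA_zero, Vx.vP.injEq] at h1
          rw [h1] at h2; exact h0 h2.symm
        | succ k => simp [root] at h1
      · simp only [root, Vx.vP.injEq] at h1
        exact hne (congrArg _ h1)
      · rw [h2] at h3; exact hS2 j h3
      · simp [root] at h1
    · exact hS2 j h3
    · exact absurd (isTailEdge_of_mem_strings ha) (by simp [isTailEdge])

theorem string_odd {i : Fin (S.n + 2)} {a : S.Ed ⊕ S.En} (ha : a ∈ strings i) :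
    Odd ((cover hM hS ho hr hx).weight a) := by
  induction i using Fin.lastCases with
  | last =>
    rw [strings_last] at ha
    rcases ha with rfl | rfl | ⟨k, rfl⟩
    · change Odd (S.a0).natAbs
      exact Int.natAbs_odd.2 hM.a0_odd
    · change Odd (-S.val (S.m + 1)).natAbs
      rw [Int.natAbs_neg]
      exact Int.natAbs_odd.2 (hM.val_odd _ le_rfl)
    · change Odd (S.flowE A B (eM k)).natAbs
      exact Int.natAbs_odd.2 ((odd_flowE hM hS _).2 rfl)
  | cast i =>
    rw [strings_castSucc] at ha
    rcases ha with rfl | rfl | ⟨k, _, rfl⟩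
    · change Odd (A i).natAbs
      exact Int.natAbs_odd.2 (hS.A_odd i)
    · change Odd (-B i).natAbs
      rw [Int.natAbs_neg]
      exact Int.natAbs_odd.2 (hS.B_odd i)
    · change Odd (S.flowE A B (eI k)).natAbs
      exact Int.natAbs_odd.2 ((odd_flowE hM hS _).2 rfl)

end Cover

end Shape

namespace Shape

open Vx Ed En

variable {S : Shape} {b : Bool} {A B : Fin (S.n + 1) → ℤ} {ord : List S.Vx} {r : ℕ}
  {x : Fin r → ℝ}

/-! ### Tails, connecting edges, and the effectiveness of the cover -/

section Cover

variable (hM : S.MainOK) (hS : S.SideOK b A B) (ho : S.IsOrder b ord) (hr : ord.length = r)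
  (hx : StrictMono x)

theorem near_eq (c : Bool) (e : S.Ed) : (cover hM hS ho hr hx).near c e =
    if c = S.up b e then S.tail e else S.head e := by
  have h1 : (cover hM hS ho hr hx).src e = S.lo b e := low_eq hM hS e
  have h2 : (cover hM hS ho hr hx).tgt e = S.hi b e := high_eq hM hS e
  unfold TropicalCover.near
  rw [h1, h2]
  unfold lo hi
  cases c <;> cases S.up b e <;> rfl

theorem far_eq (c : Bool) (e : S.Ed) : (cover hM hS ho hr hx).far c e =
    if c = S.up b e then S.head e else S.tail e := by
  have h1 : (cover hM hS ho hr hx).src e = S.lo b e := low_eq hM hS e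
  have h2 : (cover hM hS ho hr hx).tgt e = S.hi b e := high_eq hM hS e
  unfold TropicalCover.far
  rw [h1, h2]
  unfold lo hi
  cases c <;> cases S.up b e <;> rfl

/-- The edges of the special tail from the `k`-th cycle on. -/
def cycleEdges (k : Fin (S.g + 1)) : Set (S.Ed ⊕ S.En) :=
  {a | ∃ i : Fin S.g, k ≤ i.castSucc ∧ (a = .inl (eL i) ∨ ∃ c, a = .inl (eA i c))}

/-- The special tail has δ < 0, so its flow leaves the main string to the right. `Necklace` grows at
its start, hence the induction from the last cycle backwards. -/
theorem necklace (k : Fin (S.g + 1)) :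
    (cover hM hS ho hr hx).Necklace (cover hM hS ho hr hx).OddSymmetric true (cp k)
      (cp (Fin.last S.g)) (cycleEdges k) := by
  induction k using Fin.reverseInduction with
  | last =>
    have : (cycleEdges (Fin.last S.g) : Set (S.Ed ⊕ S.En)) = ∅ := by
      ext a
      simp only [cycleEdges, Set.mem_ofPred_eq, Set.mem_empty_iff_false, iff_false]
      rintro ⟨i, hi, -⟩
      exact absurd hi (not_le.2 (Fin.castSucc_lt_last i))
    rw [this]
    exact .nil _
  | cast i ih =>
    have h1 : (cycleEdges i.castSucc : Set (S.Ed ⊕ S.En))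
        = {Sum.inl (eL i), Sum.inl (eA i true), Sum.inl (eA i false)} ∪ cycleEdges i.succ := by
      ext a
      simp only [cycleEdges, Set.mem_ofPred_eq, Set.mem_union, Set.mem_insert_iff,
        Set.mem_singleton_iff]
      constructor
      · rintro ⟨j, hj, h⟩
        rcases eq_or_lt_of_le (Fin.castSucc_le_castSucc_iff.1 hj) with rfl | hlt
        · left
          rcases h with rfl | ⟨c, rfl⟩
          · exact .inl rfl
          · cases c
            · exact .inr (.inr rfl)
            · exact .inr (.inl rfl)
        · exact .inr ⟨j, hlt, h⟩
      · rintro ((rfl | rfl | rfl) | ⟨j, hj, h⟩)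
        · exact ⟨i, le_rfl, .inl rfl⟩
        · exact ⟨i, le_rfl, .inr ⟨true, rfl⟩⟩
        · exact ⟨i, le_rfl, .inr ⟨false, rfl⟩⟩
        · exact ⟨j, (Fin.castSucc_le_succ i).trans hj, h⟩
    have h2 : (cover hM hS ho hr hx).near true (eL i) = cp i.castSucc := by
      rw [near_eq]; rfl
    have h3 : (cover hM hS ho hr hx).far true (eL i) = vC i false := by
      rw [far_eq]; rfl
    have h4 : ∀ c, (cover hM hS ho hr hx).near true (eA i c) = vC i false := by
      intro c; rw [near_eq]; rfl
    have h5 : ∀ c, (cover hM hS ho hr hx).far true (eA i c) = vC i true := by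
      intro c; rw [far_eq]; rfl
    rw [h1, ← h2]
    refine TropicalCover.Necklace.cons (C := cover hM hS ho hr hx)
      (P := (cover hM hS ho hr hx).OddSymmetric) (eL i) (eA i true) (eA i false) _ _
      (fun h => by cases h)
      ((h4 _).trans h3.symm) ((h4 _).trans h3.symm) ((h5 _).trans (h5 _).symm) ⟨rfl, ?_⟩ ?_
    · change Odd (S.flowE A B (eA i true)).natAbs
      exact Int.natAbs_odd.2 ((odd_flowE hM hS _).2 rfl)
    · rw [h5]
      exact ih

theorem isTail_single (j : S.Sg) :
    (cover hM hS ho hr hx).IsTail (vM j.1) {Sum.inr (lS j)} := by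
  have h1 : (cover hM hS ho hr hx).wL (lS j) = (S.δ j.1).natAbs := rfl
  have h2 := hM.even j.1
  -- An even weight is either divisible by four, giving a tail of the form 2e, or two modulo four,
  -- giving the form 2o with no cycles.
  by_cases h4 : 4 ∣ (S.δ j.1).natAbs
  · exact .inr ⟨lS j, rfl, h1 ▸ h4, rfl⟩
  · refine .inl ⟨(cover hM hS ho hr hx).side (lS j), vM j.1, ∅, .nil _, .inl
      ⟨lS j, rfl, rfl, ?_, (Set.empty_union _).symm⟩⟩
    rw [h1]
    rw [← Int.natAbs_even, Nat.even_iff] at h2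
    omega

/-- The edges of the tail with a fork at `j`. -/
def forkTail (j : S.Fk) : Set (S.Ed ⊕ S.En) :=
  (if j.1 = S.sp then cycleEdges 0 else ∅) ∪ {Sum.inl (eS j), Sum.inr (lF j true), Sum.inr (lF j false)}

theorem isTail_fork (j : S.Fk) :
    (cover hM hS ho hr hx).IsTail (vM j.1) (forkTail j) := by
  have hodd := hM.fork_odd j
  have hδ := two_mul_half hM j.1
  have hne : S.δ j.1 ≠ 0 := by
    intro h
    rw [h] at hodd
    exact absurd hodd (by decide)
  -- A negative δ means that flow leaves the main string, so the tail points to the right; only the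
  -- special tail has a nonempty necklace.
  refine .inl ⟨decide (S.δ j.1 < 0), base j, if j.1 = S.sp then cycleEdges 0 else ∅, ?_, .inr
    ⟨eS j, lF j true, lF j false, ?_, ?_, ?_, ?_, ?_, fun h => (by cases h), rfl, ?_, rfl⟩⟩
  · by_cases hj : j.1 = S.sp
    · have h1 : decide (S.δ j.1 < 0) = true := by
        rw [hj]; simpa using hM.δ_sp
      rw [h1]
      simp only [hj, if_true, base]
      exact necklace hM hS ho hr hx 0
    · simp only [hj, if_false, base]
      exact .nil _
  · exact (near_eq hM hS ho hr hx _ (eS j)).trans (if_pos rfl)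
  · exact ((far_eq hM hS ho hr hx _ (eS j)).trans (if_pos rfl)).symm
  · exact ((far_eq hM hS ho hr hx _ (eS j)).trans (if_pos rfl)).symm
  · change decide (S.δ j.1 / 2 < 0) = decide (S.δ j.1 < 0)
    rw [decide_eq_decide]; omega
  · change decide (S.δ j.1 / 2 < 0) = decide (S.δ j.1 < 0)
    rw [decide_eq_decide]; omega
  · change Odd (S.δ j.1 / 2).natAbs
    exact Int.natAbs_odd.2 hodd

theorem inP_side (i : Fin (S.n + 1)) :
    (if b then (cover hM hS ho hr hx).Enters (inP i) (vP i)
      else (cover hM hS ho hr hx).Exits (inP i) (vP i)) := by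
  induction i using Fin.cases with
  | zero =>
    have := hS.A_sign 0
    cases b
    · exact (exits_inr hM hS ho hr hx (lA 0) (vP 0)).2 ⟨rfl, this⟩
    · exact (enters_inr hM hS ho hr hx (lA 0) (vP 0)).2 ⟨rfl, this⟩
  | succ k =>
    cases b
    · exact (exits_inl hM hS ho hr hx (eI k) (vP k.succ)).2 rfl
    · exact (enters_inl hM hS ho hr hx (eI k) (vP k.succ)).2 rfl

theorem unbent_vP (i : Fin (S.n + 1)) :
    (cover hM hS ho hr hx).UnbentAt (sideString i) (vP i) := by
  have h1 := inP_side hM hS ho hr hx i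
  have h2 := hS.B_sign i
  have m1 : inP i ∈ sideString i :=
    ((sideString_touch_vP hM hS ho hr hx i (inP i)).2 (.inl rfl)).1
  have m2 : (Sum.inr (lB i) : S.Ed ⊕ S.En) ∈ sideString i := .inr (.inl rfl)
  cases b
  · exact ⟨.inr (lB i), m2, inP i, m1,
      (enters_inr hM hS ho hr hx (lB i) (vP i)).2 ⟨rfl, by simpa [flowL] using h2⟩, h1⟩
  · exact ⟨inP i, m1, .inr (lB i), m2, h1,
      (exits_inr hM hS ho hr hx (lB i) (vP i)).2 ⟨rfl, by simpa [flowL] using h2⟩⟩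

theorem unbent_vQ (k : Fin S.n) :
    (cover hM hS ho hr hx).UnbentAt (sideString k.succ) (vQ k) := by
  have h2 := hS.A_sign k.succ
  have m1 : (Sum.inl (eI k) : S.Ed ⊕ S.En) ∈ sideString k.succ := .inr (.inr ⟨k, rfl, rfl⟩)
  have m2 : (Sum.inr (lA k.succ) : S.Ed ⊕ S.En) ∈ sideString k.succ := .inl rfl
  cases b
  · exact ⟨.inl (eI k), m1, .inr (lA k.succ), m2,
      (enters_inl hM hS ho hr hx (eI k) (vQ k)).2 rfl,
      (exits_inr hM hS ho hr hx (lA k.succ) (vQ k)).2 ⟨rfl, h2⟩⟩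
  · exact ⟨.inr (lA k.succ), m2, .inl (eI k), m1,
      (enters_inr hM hS ho hr hx (lA k.succ) (vQ k)).2 ⟨rfl, h2⟩,
      (exits_inl hM hS ho hr hx (eI k) (vQ k)).2 rfl⟩

theorem enters_inM {j : Fin (S.m + 1)} (hj : 0 < S.val j) :
    (cover hM hS ho hr hx).Enters (inM j) (vM j) := by
  induction j using Fin.cases with
  | zero =>
    exact (enters_inr hM hS ho hr hx lStart (vM 0)).2 ⟨rfl, by simpa [flowL, val_zero] using hj⟩
  | succ i =>
    refine (enters_inl hM hS ho hr hx (eM i) (vM i.succ)).2 ?_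
    have : S.up b (eM i) = true := by simpa [up] using hj
    simp [hi, this, head]

theorem exits_outM {j : Fin (S.m + 1)} (hj : 0 < S.val (j + 1)) :
    (cover hM hS ho hr hx).Exits (outM j) (vM j) := by
  induction j using Fin.lastCases with
  | last =>
    have := (exits_inr hM hS ho hr hx lFinal (vM (Fin.last S.m))).2
      ⟨rfl, by simpa [flowL] using hj⟩
    have h0 : (outM (Fin.last S.m) : S.Ed ⊕ S.En) = .inr lFinal := by simp [outM]
    rw [h0]
    exact this
  | cast i =>
    have : S.up b (eM i) = true := by simpa [up] using hj
    have h2 := (exits_inl hM hS ho hr hx (eM i) (vM i.castSucc)).2 (by simp [lo, this, tail])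
    have h0 : (outM i.castSucc : S.Ed ⊕ S.En) = .inl (eM i) := by simp [outM]
    rw [h0]
    exact h2

/-- Positivity of `val` is required exactly up to the index `S.j0 + 1` in order to orient both main
edges at the junction upwards. -/
theorem unbent_j0 : (cover hM hS ho hr hx).UnbentAt mainString (vM S.j0) :=
  ⟨inM S.j0, ((mem_mainString_touch S.j0).2 (.inl rfl)).1, outM S.j0,
    ((mem_mainString_touch S.j0).2 (.inr rfl)).1,
    enters_inM hM hS ho hr hx (hM.val_pos _ (by omega)),
    exits_outM hM hS ho hr hx (hM.val_pos _ le_rfl)⟩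

/-- Every connecting piece is a single edge, that is, a chain with no cycle; all the genus sits in
the special tail. -/
theorem isConnector (i : Fin (S.n + 1)) :
    (cover hM hS ho hr hx).IsConnector (strings i.castSucc) (strings i.succ) {Sum.inl (eC i)} := by
  refine ⟨?_, .inl ⟨b, vP i, ∅, eC i, ?_, (Set.empty_union _).symm, ?_, ?_⟩⟩
  · rintro a rfl
    change Even (conFlow A B i).natAbs
    exact Int.natAbs_even.2 (hS.conFlow_even i)
  · have h : (cover hM hS ho hr hx).near b (eC i) = vP i :=
      (near_eq hM hS ho hr hx b (eC i)).trans (if_pos rfl)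
    rw [h]
    exact .nil _
  · rw [strings_castSucc]
    exact unbent_vP hM hS ho hr hx i
  · have h : (cover hM hS ho hr hx).far b (eC i) = qv i :=
      (far_eq hM hS ho hr hx b (eC i)).trans (if_pos rfl)
    rw [h]
    induction i using Fin.lastCases with
    | last =>
      rw [qv_last, Fin.succ_last, strings_last]
      exact unbent_j0 hM hS ho hr hx
    | cast k =>
      rw [qv_castSucc, Fin.succ_castSucc, strings_castSucc]
      exact unbent_vQ hM hS ho hr hx k

theorem vM_mem_verts (j : Fin (S.m + 1)) :
    vM j ∈ (cover hM hS ho hr hx).verts (⋃ i, strings i) := by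
  have h := (mem_mainString_touch (a := inM j) j).2 (.inl rfl)
  refine ⟨inM j, Set.mem_iUnion.2 ⟨Fin.last _, by rw [strings_last]; exact h.1⟩, ?_⟩
  exact (touches_iff hM hS ho hr hx (inM j) (vM j)).2 h.2

theorem tails_cover (a : S.Ed ⊕ S.En)
    (ha : a ∉ (⋃ i, strings i) ∪ (⋃ i : Fin (S.n + 1), {Sum.inl (eC i)})) :
    ∃ (j : Fin (S.m + 1)) (T : Set (S.Ed ⊕ S.En)), a ∈ T ∧ (∀ c ∈ T, isTailEdge c = true) ∧
      (cover hM hS ho hr hx).IsTail (vM j) T := by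
  have hfork : ∀ (j : S.Fk), ∀ c ∈ forkTail j, isTailEdge c = true := by
    rintro j c (hc | rfl | rfl | rfl)
    · split_ifs at hc
      · obtain ⟨i, -, rfl | ⟨c, rfl⟩⟩ := hc <;> rfl
      · exact absurd hc (Set.notMem_empty _)
    · rfl
    · rfl
    · rfl
  have hsp : ∀ c : S.Ed ⊕ S.En, c ∈ cycleEdges 0 → c ∈ forkTail ⟨S.sp, S.fork_sp⟩ := by
    intro c hc
    refine .inl ?_
    rw [if_pos rfl]
    exact hc
  rw [mem_union_iff, Bool.not_eq_false] at ha
  rcases a with (i | i | i | i | i | ⟨i, c⟩) | (_ | _ | i | i | i | ⟨i, c⟩)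
  · cases ha
  · cases ha
  · cases ha
  · exact ⟨i.1, forkTail i, .inr (.inl rfl), hfork i, isTail_fork hM hS ho hr hx i⟩
  · exact ⟨_, _, hsp _ ⟨i, Fin.zero_le _, .inl rfl⟩, hfork _, isTail_fork hM hS ho hr hx _⟩
  · exact ⟨_, _, hsp _ ⟨i, Fin.zero_le _, .inr ⟨c, rfl⟩⟩, hfork _, isTail_fork hM hS ho hr hx _⟩
  · cases ha
  · cases ha
  · cases ha
  · cases ha
  · exact ⟨i.1, {Sum.inr (lS i)}, rfl, by rintro c rfl; rfl, isTail_single hM hS ho hr hx i⟩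
  · refine ⟨i.1, forkTail i, ?_, hfork i, isTail_fork hM hS ho hr hx i⟩
    cases c
    · exact .inr (.inr (.inr rfl))
    · exact .inr (.inr (.inl rfl))

theorem cover_effective : (cover hM hS ho hr hx).IsEffectiveNonZigzag x := by
  refine ⟨S.n, strings, fun i => {Sum.inl (eC i)}, fun i => ⟨?_, fun a ha => ⟨?_, ?_⟩⟩,
    fun i j => strings_disjoint, isConnector hM hS ho hr hx, ?_, ?_⟩
  · induction i using Fin.lastCases with
    | last => rw [strings_last]; exact mainString_isString hM hS ho hr hx
    | cast i => rw [strings_castSucc]; exact sideString_isString hM hS ho hr hx i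
  · exact string_odd hM hS ho hr hx ha
  · exact string_not_symEdge hM hS ho hr hx ha
  · intro a ha
    obtain ⟨j, T, haT, hT, htail⟩ := tails_cover hM hS ho hr hx a ha
    refine ⟨vM j, T, haT, ?_, vM_mem_verts hM hS ho hr hx j, htail⟩
    refine Set.disjoint_left.2 ?_
    intro c hc hc'
    have h1 := (mem_union_iff c).1 hc'
    rw [hT c hc] at h1
    cases h1
  · rintro i v ⟨a, rfl, hav⟩
    have key : ∀ v : S.Vx, ord.idxOf v + 1 ≤ (ord.length + 1) / 2 →
        ∃ j : Fin r, (cover hM hS ho hr hx).pos v = x j ∧ (j : ℕ) + 1 ≤ (r + 1) / 2 := by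
      intro v hv
      exact ⟨_, ho.posOf_eq hr x v, hr ▸ hv⟩
    rcases (touches_inl hM hS ho hr hx (eC i) v).1 hav with rfl | rfl
    · exact key _ (ho.early_vP i)
    · exact key _ (ho.early_qv i)

end Cover

end Shape

namespace Shape

open Vx Ed En

variable {S : Shape} {b : Bool} {A B A' B' : Fin (S.n + 1) → ℤ} {ord ord' : List S.Vx} {r : ℕ}
  {x : Fin r → ℝ}

/-! ### Rigidity -/

variable (S) in
/-- Adjacency along an edge of odd (`c = true`) or even (`c = false`) flow. -/
def Adj (c : Bool) (v w : S.Vx) : Prop :=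
  ∃ e, isOdd e = c ∧ ((S.tail e = v ∧ S.head e = w) ∨ (S.tail e = w ∧ S.head e = v))

theorem adj_tail_head (e : S.Ed) : S.Adj (isOdd e) (S.tail e) (S.head e) :=
  ⟨e, rfl, .inl ⟨rfl, rfl⟩⟩

theorem adj_head_tail (e : S.Ed) : S.Adj (isOdd e) (S.head e) (S.tail e) :=
  ⟨e, rfl, .inr ⟨rfl, rfl⟩⟩

/-- The vertex following `cp k` on the special tail. -/
def nx : Fin (S.g + 1) → S.Vx := Fin.lastCases (vF ⟨S.sp, S.fork_sp⟩) (fun i => vC i false)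

theorem base_ne_vP {j : S.Fk} {k : Fin (S.n + 1)} : base j ≠ vP k := by
  rcases base_cases j with ⟨k', h⟩ | ⟨k', h⟩ <;> rw [h]
  · simp
  · exact cp_ne_vP

theorem base_eq_vM {j : S.Fk} {k : Fin (S.m + 1)} (h : base j = vM k) : k = j.1 := by
  unfold base at h
  split_ifs at h with hj
  · rw [hj]
    generalize Fin.last S.g = l at h
    induction l using Fin.cases with
    | zero => simpa using h.symm
    | succ i => simp at h
  · simpa using h.symm

theorem base_eq_vC {j : S.Fk} {k : Fin S.g} (h : base j = vC k true) :
    j.1 = S.sp ∧ Fin.last S.g = k.succ := by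
  unfold base at h
  split_ifs at h with hj
  · refine ⟨hj, ?_⟩
    generalize Fin.last S.g = l at h
    induction l using Fin.cases with
    | zero => simp at h
    | succ i => simpa using h

/-- This and the following lemmas on `Adj` list the possible neighbours of a vertex along edges of a
given parity. Whenever there is only one, a map preserving parities that fixes the vertex must fix
the neighbour. -/
theorem Adj.of_vP {i : Fin (S.n + 1)} {w : S.Vx} (h : S.Adj false (vP i) w) : w = qv i := by
  obtain ⟨e, he, h⟩ := h
  rcases e with k | k | k | k | k | ⟨k, c⟩
  · rcases h with ⟨h1, h2⟩ | ⟨h1, h2⟩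
    · rw [← h2, ← Vx.vP.inj h1]; rfl
    · exact absurd h2 qv_ne_vP
  · cases he
  · cases he
  · rcases h with ⟨h1, h2⟩ | ⟨h1, h2⟩
    · exact absurd h1 base_ne_vP
    · simp [head] at h2
  · rcases h with ⟨h1, h2⟩ | ⟨h1, h2⟩
    · exact absurd h1 cp_ne_vP
    · simp [head] at h2
  · cases he

theorem Adj.of_vQ {k : Fin S.n} {w : S.Vx} (h : S.Adj true (vQ k) w) : w = vP k.succ := by
  obtain ⟨e, he, h⟩ := h
  rcases e with i | i | i | i | i | ⟨i, c⟩
  · cases he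
  · rcases h with ⟨h1, h2⟩ | ⟨h1, h2⟩
    · rw [← h2, ← Vx.vQ.inj h1]; rfl
    · simp [head] at h2
  · simp [tail, head] at h
  · cases he
  · cases he
  · simp [tail, head] at h

theorem Adj.of_vM {j : Fin (S.m + 1)} {w : S.Vx} (h : S.Adj true (vM j) w) :
    ∃ j' : Fin (S.m + 1), w = vM j' ∧ (j'.val = j + 1 ∨ j.val = j' + 1) := by
  obtain ⟨e, he, h⟩ := h
  rcases e with i | i | i | i | i | ⟨i, c⟩
  · cases he
  · simp [tail, head] at h
  · rcases h with ⟨h1, h2⟩ | ⟨h1, h2⟩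
    · exact ⟨_, h2.symm, .inl (by rw [← Vx.vM.inj h1]; simp)⟩
    · exact ⟨_, h1.symm, .inr (by rw [← Vx.vM.inj h2]; simp)⟩
  · cases he
  · cases he
  · simp [tail, head] at h

theorem Adj.of_vC {i : Fin S.g} {w : S.Vx} (h : S.Adj true (vC i false) w) : w = vC i true := by
  obtain ⟨e, he, h⟩ := h
  rcases e with k | k | k | k | k | ⟨k, c⟩
  · cases he
  · simp [tail, head] at h
  · simp [tail, head] at h
  · cases he
  · cases he
  · rcases h with ⟨h1, h2⟩ | ⟨h1, h2⟩
    · simp only [tail, Vx.vC.injEq, and_true] at h1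
      rw [← h2, ← h1]; rfl
    · simp [head] at h2

theorem qv_eq_vM {i : Fin (S.n + 1)} {j : Fin (S.m + 1)} (h : qv i = vM j) : j = S.j0 := by
  induction i using Fin.lastCases with
  | last => simpa using h.symm
  | cast i => simp at h

theorem Adj.of_vM_fork {j : S.Fk} (hj : j.1 ≠ S.sp) {w : S.Vx} (h : S.Adj false (vM j.1) w) :
    w = vF j := by
  have hj0 : j.1 ≠ S.j0 := by
    intro h
    have := j.2
    rw [h, S.fork_j0] at this
    exact absurd this (by decide)
  obtain ⟨e, he, h⟩ := h
  rcases e with k | k | k | k | k | ⟨k, c⟩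
  · rcases h with ⟨h1, h2⟩ | ⟨h1, h2⟩
    · simp [tail] at h1
    · exact absurd (qv_eq_vM h2) hj0
  · cases he
  · cases he
  · rcases h with ⟨h1, h2⟩ | ⟨h1, h2⟩
    · rw [← h2, Subtype.ext (base_eq_vM h1)]; rfl
    · simp [head] at h2
  · rcases h with ⟨h1, h2⟩ | ⟨h1, h2⟩
    · simp only [tail] at h1
      generalize k.castSucc = l at h1
      induction l using Fin.cases with
      | zero => exact absurd (Vx.vM.inj h1).symm hj
      | succ i => simp at h1
    · simp [head] at h2
  · cases he

theorem cp_injective : Function.Injective (cp : Fin (S.g + 1) → S.Vx) := by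
  intro i j h
  induction i using Fin.cases <;> induction j using Fin.cases <;> simp_all

theorem Adj.of_cp {k : Fin (S.g + 1)} {w : S.Vx} (h : S.Adj false (cp k) w) : w = nx k := by
  have hbase : ∀ j : S.Fk, base j = cp k → j = ⟨S.sp, S.fork_sp⟩ ∧ k = Fin.last S.g := by
    intro j hj
    have h1 : j.1 = S.sp := by
      induction k using Fin.cases with
      | zero => exact (base_eq_vM hj).symm
      | succ i => exact (base_eq_vC hj).1
    refine ⟨Subtype.ext h1, ?_⟩
    rw [base, if_pos h1] at hj
    exact (cp_injective hj).symm
  obtain ⟨e, he, h⟩ := h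
  rcases e with i | i | i | i | i | ⟨i, c⟩
  · rcases h with ⟨h1, h2⟩ | ⟨h1, h2⟩
    · exact absurd h1.symm cp_ne_vP
    · induction k using Fin.cases with
      | zero => exact absurd (qv_eq_vM h2) sp_ne_j0
      | succ k => induction i using Fin.lastCases <;> simp [head] at h2
  · cases he
  · cases he
  · rcases h with ⟨h1, h2⟩ | ⟨h1, h2⟩
    · obtain ⟨rfl, rfl⟩ := hbase i h1
      rw [← h2]
      simp [nx, head]
    · induction k using Fin.cases <;> simp [head] at h2
  · rcases h with ⟨h1, h2⟩ | ⟨h1, h2⟩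
    · rw [← h2, ← cp_injective h1]
      simp [nx, head]
    · induction k using Fin.cases <;> simp [head] at h2
  · cases he

theorem adj_cp_nx (k : Fin (S.g + 1)) : S.Adj false (cp k) (nx k) := by
  induction k using Fin.lastCases with
  | last =>
    refine ⟨eS ⟨S.sp, S.fork_sp⟩, rfl, .inl ⟨?_, ?_⟩⟩
    · simp [tail, base]
    · simp [nx, head]
  | cast i => exact ⟨eL i, rfl, .inl ⟨rfl, by simp [nx, head]⟩⟩

/-- An injective map of the vertices which preserves the parity of the edges, the direction of the
odd edges, and the first vertex of the chain of strings is the identity. -/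
theorem rigid (hM : S.MainOK) {φ : S.Vx → S.Vx} (hinj : Function.Injective φ)
    (hadj : ∀ c v w, S.Adj c v w → S.Adj c (φ v) (φ w))
    (hdir : ∀ e, isOdd e = true → ∃ e', isOdd e' = true ∧ S.lo b e' = φ (S.lo b e) ∧
      S.hi b e' = φ (S.hi b e))
    (h0 : φ (vP 0) = vP 0) (v : S.Vx) : φ v = v := by
  have hq : ∀ i, φ (vP i) = vP i → φ (qv i) = qv i := fun i h =>
    Adj.of_vP (by have := hadj _ _ _ (adj_tail_head (eC i)); rwa [show S.tail (eC i) = vP i from rfl,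
      h] at this)
  have hP : ∀ i, φ (vP i) = vP i := by
    intro i
    induction i using Fin.induction with
    | zero => exact h0
    | succ i ih =>
      have h1 := hq _ ih
      rw [qv_castSucc] at h1
      have h2 := hadj _ _ _ (adj_tail_head (eI i))
      rw [show S.tail (eI i) = vQ i from rfl, h1] at h2
      exact Adj.of_vQ h2
  have hj0 : φ (vM S.j0) = vM S.j0 := by
    have := hq _ (hP (Fin.last _))
    rwa [qv_last] at this
  -- The junction has up to two odd neighbours, which parity cannot tell apart. Since the flow is
  -- positive on both sides, one of them lies below and the other above the junction, and `hdir`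
  -- separates them.
  have v0 : 0 < S.val S.j0 := hM.val_pos _ (by omega)
  have v1 : 0 < S.val (S.j0 + 1) := hM.val_pos _ le_rfl
  have hup1 : ∀ j : Fin (S.m + 1), j.val = S.j0 + 1 → φ (vM j) = vM j := by
    intro j hj
    obtain ⟨i, rfl⟩ := Fin.exists_succ_eq.2 (show j ≠ 0 by rintro rfl; simp at hj)
    have hi0 : i.castSucc = S.j0 := by
      ext; simp at hj ⊢; exact hj
    have u : S.up b (eM i) = true := by
      have : i.val = S.j0 := by rw [← hi0]; rfl
      simpa [up, this] using v1
    obtain ⟨e', he', h1, h2⟩ := hdir (eM i) rfl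
    have l1 : S.lo b (eM i) = vM S.j0 := by simp [lo, u, tail, hi0]
    have l2 : S.hi b (eM i) = vM i.succ := by simp [hi, u, head]
    rw [l1, hj0] at h1
    rw [l2] at h2
    rw [← h2]
    rcases e' with k | k | k | k | k | ⟨k, c⟩
    · cases he'
    · unfold lo at h1; split_ifs at h1 <;> cases h1
    · by_cases hu : S.up b (eM k) = true
      · simp only [lo, hu, if_true, tail, Vx.vM.injEq, ← hi0, Fin.castSucc_inj] at h1
        rw [h1]; simp [hi, u, head]
      · simp only [lo, hu, head] at h1
        have h3 : k.val + 1 = S.j0 := by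
          have := Vx.vM.inj h1
          rw [← this]; rfl
        exact absurd (by simpa [up, h3] using v0) hu
    · cases he'
    · cases he'
    · unfold lo at h1; split_ifs at h1 <;> cases h1
  have hdn1 : ∀ j : Fin (S.m + 1), j.val + 1 = S.j0 → φ (vM j) = vM j := by
    intro j hj
    have hlt : j.val < S.m := by have := S.j0.2; omega
    obtain ⟨i, rfl⟩ : ∃ i : Fin S.m, i.castSucc = j := ⟨⟨j.val, hlt⟩, rfl⟩
    have hi0 : i.succ = S.j0 := by
      ext; simp at hj ⊢; exact hj
    have u : S.up b (eM i) = true := by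
      have : i.val + 1 = S.j0 := hj
      simpa [up, this] using v0
    obtain ⟨e', he', h1, h2⟩ := hdir (eM i) rfl
    have l1 : S.lo b (eM i) = vM i.castSucc := by simp [lo, u, tail]
    have l2 : S.hi b (eM i) = vM S.j0 := by simp [hi, u, head, hi0]
    rw [l1] at h1
    rw [l2, hj0] at h2
    rw [← h1]
    rcases e' with k | k | k | k | k | ⟨k, c⟩
    · cases he'
    · unfold hi at h2; split_ifs at h2 <;> cases h2
    · by_cases hu : S.up b (eM k) = true
      · simp only [hi, hu, if_true, head, Vx.vM.injEq, ← hi0, Fin.succ_inj] at h2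
        rw [h2]; simp [lo, u, tail]
      · simp only [hi, hu, tail] at h2
        have h3 : k.val = S.j0 := by
          have := Vx.vM.inj h2
          rw [← this]; rfl
        exact absurd (by simpa [up, h3] using v1) hu
    · cases he'
    · cases he'
    · unfold hi at h2; split_ifs at h2 <;> cases h2
  have adjM : ∀ i j : Fin (S.m + 1), j.val = i + 1 → S.Adj true (vM i) (vM j) ∧
      S.Adj true (vM j) (vM i) := by
    intro i j hij
    have hlt : i.val < S.m := by have := j.2; omega
    have h1 : (⟨i.val, hlt⟩ : Fin S.m).castSucc = i := rfl
    have h2 : (⟨i.val, hlt⟩ : Fin S.m).succ = j := by ext; simp [hij]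
    rw [← h1, ← h2]
    exact ⟨adj_tail_head (eM _), adj_head_tail (eM _)⟩
  -- Further along the main string a vertex has only two odd neighbours. One of them is fixed
  -- already, so by injectivity the next vertex cannot be mapped to it.
  have hup : ∀ d : ℕ, ∀ j : Fin (S.m + 1), j.val = S.j0 + d → φ (vM j) = vM j := by
    intro d
    induction d using Nat.strong_induction_on with
    | _ d ih =>
      intro j hj
      match d, hj with
      | 0, hj => rw [show j = S.j0 from Fin.ext hj]; exact hj0
      | 1, hj => exact hup1 j hj
      | d + 2, hj =>
        have e1 := ih (d + 1) (by omega) ⟨S.j0 + (d + 1), by omega⟩ rfl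
        have e2 := ih d (by omega) ⟨S.j0 + d, by omega⟩ rfl
        have h1 := hadj _ _ _ (adjM ⟨S.j0 + (d + 1), by omega⟩ j (by simp [hj]; omega)).1
        rw [e1] at h1
        obtain ⟨j', h2, h3⟩ := Adj.of_vM h1
        rw [h2]
        congr 1
        rcases h3 with h3 | h3
        · ext; simp at h3; omega
        · exfalso
          have h4 : j' = ⟨S.j0 + d, by omega⟩ := by ext; simp at h3 ⊢; omega
          rw [h4, ← e2] at h2
          have := Vx.vM.inj (hinj h2)
          rw [this] at hj
          simp at hj
  have hdn : ∀ d : ℕ, ∀ j : Fin (S.m + 1), j.val + d = S.j0 → φ (vM j) = vM j := by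
    intro d
    induction d using Nat.strong_induction_on with
    | _ d ih =>
      intro j hj
      match d, hj with
      | 0, hj => rw [show j = S.j0 from Fin.ext hj]; exact hj0
      | 1, hj => exact hdn1 j hj
      | d + 2, hj =>
        have hlt := S.j0.2
        have e1 := ih (d + 1) (by omega) ⟨j + 1, by omega⟩ (by simp; omega)
        have e2 := ih d (by omega) ⟨j + 2, by omega⟩ (by simp; omega)
        have h1 := hadj _ _ _ (adjM j ⟨j + 1, by omega⟩ rfl).2
        rw [e1] at h1
        obtain ⟨j', h2, h3⟩ := Adj.of_vM h1
        rw [h2]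
        congr 1
        rcases h3 with h3 | h3
        · exfalso
          have h4 : j' = ⟨j + 2, by omega⟩ := by ext; simp at h3 ⊢; omega
          rw [h4, ← e2] at h2
          have := congrArg Fin.val (Vx.vM.inj (hinj h2))
          simp at this
        · ext; simp at h3; omega
  have hMain : ∀ j, φ (vM j) = vM j := by
    intro j
    rcases le_total S.j0.val j.val with h | h
    · exact hup (j - S.j0) j (by omega)
    · exact hdn (S.j0 - j) j (by omega)
  -- Along the special tail unique even neighbours and unique odd neighbours alternate.
  have hnx : ∀ k, φ (cp k) = cp k → φ (nx k) = nx k := fun k h =>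
    Adj.of_cp (by have := hadj _ _ _ (adj_cp_nx k); rwa [h] at this)
  have hC : ∀ i : Fin S.g, φ (vC i false) = vC i false → φ (vC i true) = vC i true := fun i h =>
    Adj.of_vC (by have := hadj _ _ _ (adj_tail_head (eA i true)); rwa [show S.tail (eA i true)
      = vC i false from rfl, h] at this)
  have hcp : ∀ k, φ (cp k) = cp k := by
    intro k
    induction k using Fin.induction with
    | zero => exact hMain _
    | succ i ih =>
      have := hnx _ ih
      simp only [nx, Fin.lastCases_castSucc] at this
      exact hC i this
  rcases v with i | i | j | j | ⟨i, c⟩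
  · exact hP i
  · have := hq _ (hP i.castSucc)
    rwa [qv_castSucc] at this
  · exact hMain j
  · by_cases hj : j.1 = S.sp
    · have := hnx _ (hcp (Fin.last _))
      simp only [nx, Fin.lastCases_last] at this
      rwa [show j = ⟨S.sp, S.fork_sp⟩ from Subtype.ext hj]
    · have h1 := hadj _ _ _ (adj_tail_head (eS j))
      rw [show S.tail (eS j) = vM j.1 by simp [tail, base, hj], hMain] at h1
      exact Adj.of_vM_fork hj h1
  · cases c
    · have := hnx _ (hcp i.castSucc)
      simpa only [nx, Fin.lastCases_castSucc] using this
    · exact hcp i.succ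

/-- All other vertices of strings have at most one odd end, and the two ends of a fork lie over the
same side. This property is visible in the cover itself and gives rigidity its starting point. -/
theorem root_eq_vP_zero (hM : S.MainOK) {l l' : S.En}
    (h1 : S.root l = S.root l') (h2 : 0 < S.flowL A B l) (h3 : S.flowL A B l' < 0)
    (h4 : Odd (S.flowL A B l)) (h5 : Odd (S.flowL A B l')) : S.root l = vP 0 := by
  have hlast : (Fin.last S.m) ≠ 0 := fun h => m_ne_zero (congrArg Fin.val h)
  have hS2 : ∀ j : S.Sg, ¬ Odd (S.flowL A B (lS j)) := fun j =>
    Int.not_odd_iff_even.2 (hM.even j.1)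
  rcases l with _ | _ | i | i | j | ⟨j, c⟩
  · rcases l' with _ | _ | i' | i' | j' | ⟨j', c'⟩
    · exact absurd h2 h3.asymm
    · simp only [root, Vx.vM.injEq] at h1; exact absurd h1.symm hlast
    · induction i' using Fin.cases <;> simp [root] at h1
    · simp [root] at h1
    · exact absurd h5 (hS2 j')
    · simp [root] at h1
  · rcases l' with _ | _ | i' | i' | j' | ⟨j', c'⟩
    · simp only [root, Vx.vM.injEq] at h1; exact absurd h1 hlast
    · exact absurd h2 h3.asymm
    · induction i' using Fin.cases <;> simp [root] at h1
    · simp [root] at h1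
    · exact absurd h5 (hS2 j')
    · simp [root] at h1
  · induction i using Fin.cases with
    | zero => rfl
    | succ k =>
      rcases l' with _ | _ | i' | i' | j' | ⟨j', c'⟩
      · simp [root] at h1
      · simp [root] at h1
      · induction i' using Fin.cases with
        | zero => simp [root] at h1
        | succ k' =>
          simp only [root, rootA_succ, Vx.vQ.injEq] at h1
          rw [h1] at h2
          exact absurd h2 h3.asymm
      · simp [root] at h1
      · simp [root] at h1
      · simp [root] at h1
  · rcases l' with _ | _ | i' | i' | j' | ⟨j', c'⟩
    · simp [root] at h1
    · simp [root] at h1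
    · induction i' using Fin.cases with
      | zero => exact h1
      | succ k' => simp [root] at h1
    · simp only [root, Vx.vP.injEq] at h1
      rw [h1] at h2
      exact absurd h2 h3.asymm
    · simp [root] at h1
    · simp [root] at h1
  · exact absurd h4 (hS2 j)
  · rcases l' with _ | _ | i' | i' | j' | ⟨j', c'⟩
    · simp [root] at h1
    · simp [root] at h1
    · induction i' using Fin.cases <;> simp [root] at h1
    · simp [root] at h1
    · simp [root] at h1
    · simp only [root, Vx.vF.injEq] at h1
      rw [h1] at h2
      exact absurd h2 h3.asymm

theorem list_eq_of_idxOf_eq {α : Type} [DecidableEq α] {l l' : List α} (h1 : l.Nodup)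
    (h3 : l.length = l'.length) (hm : ∀ v, v ∈ l') (h : ∀ v, l.idxOf v = l'.idxOf v) : l = l' := by
  refine List.ext_getElem h3 fun i hi hi' => ?_
  have h5 := h l[i]
  rw [h1.idxOf_getElem i hi] at h5
  have := List.getElem_idxOf (List.idxOf_lt_length_of_mem (hm l[i]))
  simp only [← h5] at this
  exact this.symm

/-- By `rigid` the isomorphism is the identity on vertices. Then the flows `A`, `B` are read off at
the ends of the side strings, and the order is read off from the positions because `x` is strictly
increasing. -/
theorem cover_injective (hM : S.MainOK) (hS : S.SideOK b A B) (hS' : S.SideOK b A' B')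
    (ho : S.IsOrder b ord) (ho' : S.IsOrder b ord') (hr : ord.length = r) (hr' : ord'.length = r)
    (hx : StrictMono x)
    (f : TropicalCover.Iso (cover hM hS ho hr hx) (cover hM hS' ho' hr' hx)) :
    A = A' ∧ B = B' ∧ ord = ord' := by
  let φ : S.Vx ≃ S.Vx := f.onV
  let ψ : S.Ed ≃ S.Ed := f.onE
  let χ : S.En ≃ S.En := f.onL
  have hlo : ∀ e, S.lo b (ψ e) = φ (S.lo b e) := fun e =>
    (low_eq hM hS' _).symm.trans ((f.src_eq e).trans (congrArg f.onV (low_eq hM hS e)))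
  have hhi : ∀ e, S.hi b (ψ e) = φ (S.hi b e) := fun e =>
    (high_eq hM hS' _).symm.trans ((f.tgt_eq e).trans (congrArg f.onV (high_eq hM hS e)))
  have hodd : ∀ e, isOdd (ψ e) = isOdd e := by
    intro e
    have h1 : (S.flowE A' B' (ψ e)).natAbs = (S.flowE A B e).natAbs := f.wE_eq e
    rw [Bool.eq_iff_iff, ← odd_flowE hM hS', ← odd_flowE hM hS, ← Int.natAbs_odd, h1,
      Int.natAbs_odd]
  have hroot : ∀ l, S.root (χ l) = φ (S.root l) := f.root_eq
  have hflow : ∀ l, S.flowL A' B' (χ l) = S.flowL A B l := by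
    intro l
    have h1 : (S.flowL A' B' (χ l)).natAbs = (S.flowL A B l).natAbs := f.wL_eq l
    have h2 : decide (S.flowL A' B' (χ l) < 0) = decide (S.flowL A B l < 0) := f.side_eq l
    rw [decide_eq_decide] at h2
    omega
  have hadj : ∀ c v w, S.Adj c v w → S.Adj c (φ v) (φ w) := by
    rintro c v w ⟨e, rfl, h⟩
    refine ⟨ψ e, hodd e, ?_⟩
    have h1 := hlo e
    have h2 := hhi e
    unfold lo at h1
    unfold hi at h2
    split_ifs at h1 h2 <;> rcases h with ⟨rfl, rfl⟩ | ⟨rfl, rfl⟩ <;> simp [h1, h2]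
  have hsign : ∀ l, S.flowL A B l ≠ 0 := flowL_ne hM hS
  have hz : φ (vP 0) = vP 0 := by
    have r1 : S.root (χ (lA 0)) = φ (vP 0) := hroot _
    have r2 : S.root (χ (lB 0)) = φ (vP 0) := hroot _
    have o1 : Odd (S.flowL A' B' (χ (lA 0))) := by rw [hflow]; exact hS.A_odd 0
    have o2 : Odd (S.flowL A' B' (χ (lB 0))) := by rw [hflow]; exact (hS.B_odd 0).neg
    have s1 := hS.A_sign 0
    have s2 := hS.B_sign 0
    cases b
    · rw [← r2]
      refine root_eq_vP_zero hM (l' := χ (lA 0)) (r2.trans r1.symm) ?_ ?_ o2 o1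
      · rw [hflow]; simpa [flowL] using s2
      · rw [hflow]; simpa [flowL] using s1
    · rw [← r1]
      refine root_eq_vP_zero hM (l' := χ (lB 0)) (r1.trans r2.symm) ?_ ?_ o1 o2
      · rw [hflow]; simpa [flowL] using s1
      · rw [hflow]; simpa [flowL] using s2
  have hφ : ∀ v, φ v = v := rigid (b := b) hM φ.injective hadj
    (fun e he => ⟨ψ e, by rw [hodd, he], hlo e, hhi e⟩) hz
  -- The root alone does not single out the end: at the start of the chain `lA 0` and `lB 0` share
  -- their root and differ by the sign of the flow.
  have hlA : ∀ i l, S.root l = rootA i → 0 < S.flowL A' B' l * A i → l = lA i := by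
    intro i l hl hs
    rcases l with _ | _ | k | k | k | ⟨k, c⟩
    · induction i using Fin.cases <;> simp [root] at hl
    · induction i using Fin.cases <;> simp [root] at hl
    · congr 1
      induction i using Fin.cases <;> induction k using Fin.cases <;> simp_all [root]
    · induction i using Fin.cases with
      | zero =>
        simp only [root, rootA_zero, Vx.vP.injEq] at hl
        subst hl
        exfalso
        have s1 := hS.A_sign 0
        have s2 := hS'.B_sign 0
        simp only [flowL] at hs
        cases b <;> simp at s1 s2 <;> nlinarith
      | succ i => simp [root] at hl
    · induction i using Fin.cases <;> simp [root] at hl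
    · induction i using Fin.cases <;> simp [root] at hl
  have hlB : ∀ i l, S.root l = vP i → S.flowL A' B' l * B i < 0 → l = lB i := by
    intro i l hl hs
    rcases l with _ | _ | k | k | k | ⟨k, c⟩
    · simp [root] at hl
    · simp [root] at hl
    · exfalso
      have s1 := hS'.A_sign k
      have s2 := hS.B_sign i
      simp only [flowL] at hs
      cases b <;> simp at s1 s2 <;> nlinarith
    · rw [Vx.vP.inj hl]
    · simp [root] at hl
    · simp [root] at hl
  refine ⟨funext fun i => ?_, funext fun i => ?_, ?_⟩
  · have h1 := hflow (lA i)
    have h2 := hlA i (χ (lA i)) (by rw [hroot, hφ]; rfl) (by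
      rw [h1]; exact mul_self_pos.2 (hsign (lA i)))
    rw [h2] at h1
    exact h1.symm
  · have h1 := hflow (lB i)
    have h3 := hsign (lB i)
    simp only [flowL, ne_eq, neg_eq_zero] at h3
    have h2 := hlB i (χ (lB i)) (by rw [hroot, hφ]; rfl) (by
      rw [h1]; simp only [flowL]; have := mul_self_pos.2 h3; linarith)
    rw [h2] at h1
    simp only [flowL, neg_inj] at h1
    exact h1.symm
  · refine list_eq_of_idxOf_eq ho.nodup (hr.trans hr'.symm) ho'.mem fun v => ?_
    have h1 : posOf x ord' (φ v) = posOf x ord v := f.pos_eq v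
    rw [hφ, ho'.posOf_eq hr', ho.posOf_eq hr] at h1
    exact (congrArg Fin.val (hx.injective h1)).symm

end Shape

/-! ### Insertions into lists -/

section Insertions

variable {V : Type} [DecidableEq V]

/-- The lists obtained from `L` by inserting, for every `x ∈ L` with `fk x = some f`, the element `f`
somewhere after `x`. -/
def insertions (fk : V → Option V) : List V → Finset (List V)
  | [] => {[]}
  | x :: L =>
    match fk x with
    | none => (insertions fk L).image (fun L' => x :: L')
    | some f => ((insertions fk L) ×ˢ Finset.range (L.length + (L.filterMap fk).length + 1)).image
        (fun q => x :: q.1.insertIdx q.2 f)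

variable {fk : V → Option V}

theorem mem_insertions_cons_none {x : V} {L L' : List V} (h : fk x = none) :
    L' ∈ insertions fk (x :: L) ↔ ∃ M ∈ insertions fk L, L' = x :: M := by
  simp only [insertions, h, Finset.mem_image, eq_comm]

theorem mem_insertions_cons_some {x f : V} {L L' : List V} (h : fk x = some f) :
    L' ∈ insertions fk (x :: L) ↔ ∃ M ∈ insertions fk L,
      ∃ i < L.length + (L.filterMap fk).length + 1, L' = x :: M.insertIdx i f := by
  simp only [insertions, h, Finset.mem_image, Finset.mem_product, Finset.mem_range, Prod.exists,
    eq_comm]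
  constructor
  · rintro ⟨M, i, ⟨h1, h2⟩, h3⟩
    exact ⟨M, h1, i, h2, h3⟩
  · rintro ⟨M, h1, i, h2, h3⟩
    exact ⟨M, i, ⟨h1, h2⟩, h3⟩

theorem perm_of_mem_insertions {L L' : List V} (h : L' ∈ insertions fk L) :
    L'.Perm (L ++ L.filterMap fk) := by
  induction L generalizing L' with
  | nil => simp_all [insertions]
  | cons x L ih =>
    rcases hx : fk x with _ | f
    · obtain ⟨M, hM, rfl⟩ := (mem_insertions_cons_none hx).1 h
      rw [List.filterMap_cons_none hx]
      exact (ih hM).cons _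
    · obtain ⟨M, hM, i, hi, rfl⟩ := (mem_insertions_cons_some hx).1 h
      rw [List.filterMap_cons_some hx]
      have h1 := (ih hM).length_eq
      rw [List.length_append] at h1
      refine List.Perm.cons _ ((List.perm_insertIdx f M (by omega)).trans ?_)
      exact ((ih hM).cons f).trans List.perm_middle.symm

theorem sublist_of_mem_insertions {L L' : List V} (h : L' ∈ insertions fk L) : L.Sublist L' := by
  induction L generalizing L' with
  | nil => simp
  | cons x L ih =>
    rcases hx : fk x with _ | f
    · obtain ⟨M, hM, rfl⟩ := (mem_insertions_cons_none hx).1 h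
      exact (ih hM).cons_cons _
    · obtain ⟨M, hM, i, hi, rfl⟩ := (mem_insertions_cons_some hx).1 h
      exact ((ih hM).trans (List.sublist_insertIdx M i f)).cons_cons _

theorem pair_sublist_of_mem_insertions {L L' : List V} (h : L' ∈ insertions fk L) {x f : V}
    (hx : x ∈ L) (hf : fk x = some f) : [x, f].Sublist L' := by
  induction L generalizing L' with
  | nil => simp at hx
  | cons y L ih =>
    rcases hy : fk y with _ | f'
    · obtain ⟨M, hM, rfl⟩ := (mem_insertions_cons_none hy).1 h
      rcases List.mem_cons.1 hx with rfl | hx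
      · rw [hf] at hy; cases hy
      · exact (ih hM hx).cons _
    · obtain ⟨M, hM, i, hi, rfl⟩ := (mem_insertions_cons_some hy).1 h
      have h1 := (perm_of_mem_insertions hM).length_eq
      rw [List.length_append] at h1
      rcases List.mem_cons.1 hx with rfl | hx
      · obtain rfl : f = f' := by rw [hf] at hy; exact Option.some.inj hy
        refine List.Sublist.cons_cons _ (List.singleton_sublist.2 ?_)
        exact (List.perm_insertIdx f M (by omega)).mem_iff.2 (by simp)
      · exact ((ih hM hx).trans (List.sublist_insertIdx M i f')).cons _

/-- Elements are inserted only behind their partners, so an initial block without partners is left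
untouched. -/
theorem mem_insertions_append {X Y L' : List V} (hX : ∀ x ∈ X, fk x = none)
    (h : L' ∈ insertions fk (X ++ Y)) : ∃ Y' ∈ insertions fk Y, L' = X ++ Y' := by
  induction X generalizing L' with
  | nil => exact ⟨L', h, rfl⟩
  | cons x X ih =>
    obtain ⟨M, hM, rfl⟩ := (mem_insertions_cons_none (hX x (by simp))).1 h
    obtain ⟨Y', hY', rfl⟩ := ih (fun y hy => hX y (by simp [hy])) hM
    exact ⟨Y', hY', rfl⟩

theorem card_insertions_cons_none {x : V} {L : List V} (h : fk x = none) :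
    (insertions fk (x :: L)).card = (insertions fk L).card := by
  simp only [insertions, h]
  exact Finset.card_image_of_injective _ (fun a b hab => by simpa using hab)

/-- As `f` is new, both its position and the list without it can be recovered from the result. So
all places of `f`, of which there is one more than the length of the rest, count separately. -/
theorem card_insertions_cons_some {x f : V} {L : List V} (h : fk x = some f)
    (hf : f ∉ L ++ L.filterMap fk) :
    (insertions fk (x :: L)).card
      = (L.length + (L.filterMap fk).length + 1) * (insertions fk L).card := by
  simp only [insertions, h]
  rw [Finset.card_image_of_injOn, Finset.card_product, Finset.card_range, mul_comm]
  rintro ⟨M, i⟩ h1 ⟨M', i'⟩ h2 heq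
  simp only [Finset.coe_product, Set.mem_prod, Finset.mem_coe, Finset.mem_range] at h1 h2
  have e := List.tail_eq_of_cons_eq heq
  have hM := perm_of_mem_insertions h1.1
  have hM' := perm_of_mem_insertions h2.1
  have l1 := hM.length_eq
  have l2 := hM'.length_eq
  rw [List.length_append] at l1 l2
  have f1 : f ∉ M := fun h => hf (hM.mem_iff.1 h)
  have f2 : f ∉ M' := fun h => hf (hM'.mem_iff.1 h)
  simp only at e
  have i1 : i < (M.insertIdx i f).length := by
    rw [List.length_insertIdx]; split_ifs <;> omega
  have i2 : i' < (M'.insertIdx i' f).length := by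
    rw [List.length_insertIdx]; split_ifs <;> omega
  -- At the smaller of two insertion positions one list shows `f`, the other an element of `N'`,
  -- which is not `f`.
  have key : ∀ (N N' : List V) (k k' : ℕ), f ∉ N → f ∉ N' → k < k' → k' ≤ N'.length → 
      k ≤ N.length → N.insertIdx k f ≠ N'.insertIdx k' f := by
    intro N N' k k' hN hN' hk hk' hk2 hE
    have a1 : k < (N.insertIdx k f).length := by
      rw [List.length_insertIdx]; split_ifs; omega
    have a2 : k < (N'.insertIdx k' f).length := by rw [← hE]; exact a1
    have b1 : (N.insertIdx k f)[k] = f := List.getElem_insertIdx_self _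
    have b2 : (N'.insertIdx k' f)[k] = N'[k] := List.getElem_insertIdx_of_lt hk a2
    have b3 : (N.insertIdx k f)[k] = (N'.insertIdx k' f)[k] := by simp only [hE]
    rw [b1, b2] at b3
    exact hN' (b3 ▸ List.getElem_mem _)
  have hi : i = i' := by
    rcases lt_trichotomy i i' with h | h | h
    · exact absurd e (key M M' i i' f1 f2 h (by omega) (by omega))
    · exact h
    · exact absurd e.symm (key M' M i' i f2 f1 h (by omega) (by omega))
  subst hi
  simpa using List.insertIdx_injective i f e

/-- Elements are inserted from the back. When j partners from `L` have already been inserted, at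
least these j, the j elements they belong to and all of `L'` lie behind, which leaves `L'.length + 2
* j + 1` places. -/
theorem prod_mul_card_insertions_le (L L' : List V) (h : (L ++ L' ++ (L ++ L').filterMap fk).Nodup) :
    (∏ j ∈ Finset.range (L.filterMap fk).length, (L'.length + 2 * j + 1))
      * (insertions fk L').card ≤ (insertions fk (L ++ L')).card := by
  induction L with
  | nil => simp
  | cons x L ih =>
    rcases hx : fk x with _ | f
    · rw [List.filterMap_cons_none hx, List.cons_append, card_insertions_cons_none hx]
      refine ih ?_
      rw [List.cons_append, List.filterMap_cons_none hx] at h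
      exact (List.nodup_cons.1 h).2
    · rw [List.cons_append, List.filterMap_cons_some hx] at h
      have h' := List.Perm.nodup_iff (List.perm_middle (a := f) (l₁ := x :: (L ++ L'))
        (l₂ := (L ++ L').filterMap fk)) |>.1 h
      rw [List.cons_append, List.nodup_cons] at h'
      have hf : f ∉ (L ++ L') ++ (L ++ L').filterMap fk := fun hm => h'.1 (List.mem_cons_of_mem _ hm)
      rw [List.filterMap_cons_some hx, List.cons_append, card_insertions_cons_some hx hf,
        List.length_cons, Finset.prod_range_succ, mul_right_comm, mul_comm]
      refine Nat.mul_le_mul ?_ (ih (List.nodup_cons.1 h'.2).2)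
      have := List.length_filterMap_le fk L
      simp only [List.length_append, List.filterMap_append]
      omega

theorem card_insertions_pos (L : List V) : 0 < (insertions fk L).card := by
  rw [Finset.card_pos]
  induction L with
  | nil => exact ⟨[], by simp [insertions]⟩
  | cons x L ih =>
    obtain ⟨M, hM⟩ := ih
    rcases hx : fk x with _ | f
    · exact ⟨_, (mem_insertions_cons_none hx).2 ⟨M, hM, rfl⟩⟩
    · exact ⟨_, (mem_insertions_cons_some hx).2 ⟨M, hM, 0, by omega, rfl⟩⟩

/-- Deleting the inserted elements recovers the list, so different lists have disjoint sets of
insertions. -/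
theorem filter_eq_of_mem_insertions {L L' : List V} (h : L' ∈ insertions fk L) (p : V → Bool)
    (h1 : ∀ x ∈ L, p x = true) (h2 : ∀ x f, fk x = some f → p f = false) : L'.filter p = L := by
  have hs : L.Sublist (L'.filter p) := by
    have := (sublist_of_mem_insertions h).filter p
    rwa [List.filter_eq_self.2 h1] at this
  refine (hs.eq_of_length ?_).symm
  have hp := ((perm_of_mem_insertions h).filter p).length_eq
  have hnil : (L.filterMap fk).filter p = [] := List.filter_eq_nil_iff.2 fun f hf => by
    obtain ⟨x, -, hx⟩ := List.mem_filterMap.1 hf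
    simp [h2 x f hx]
  rw [List.filter_append, List.filter_eq_self.2 h1, hnil, List.append_nil] at hp
  exact hp.symm

end Insertions

/-! ### Relative positions in lists, expressed by sublists -/

theorem pair_sublist_append {α : Type} {A B : List α} {x y : α} (hx : x ∈ A) (hy : y ∈ B) :
    [x, y].Sublist (A ++ B) :=
  (List.singleton_sublist.2 hx).append (List.singleton_sublist.2 hy)

/-- Order relations are handled as sublists with two elements because these survive every later
insertion. -/
theorem idxOf_lt_of_pair_sublist {α : Type} [DecidableEq α] {L : List α} (h : L.Nodup) {x y : α}
    (hs : [x, y].Sublist L) : L.idxOf x < L.idxOf y := by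
  induction L with
  | nil => cases hs
  | cons z L ih =>
    rw [List.nodup_cons] at h
    rcases hs with _ | hs | hs
    · have h1 : z ≠ x := fun h' => h.1 (h' ▸ (List.Sublist.subset ‹_›) (by simp))
      have h2 : z ≠ y := fun h' => h.1 (h' ▸ (List.Sublist.subset ‹_›) (by simp))
      rw [List.idxOf_cons_ne _ h1, List.idxOf_cons_ne _ h2]
      exact Nat.succ_lt_succ (ih h.2 ‹_›)
    · have h2 : x ≠ y := fun h' => h.1 (h' ▸ (List.Sublist.subset ‹_›) (by simp))
      rw [List.idxOf_cons_self, List.idxOf_cons_ne _ h2]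
      exact Nat.succ_pos _

/-- An element moves back by at most the number of elements added. -/
theorem idxOf_le_of_sublist {α : Type} [DecidableEq α] {L L' : List α} (hs : L.Sublist L') {x : α}
    (hx : x ∈ L) : L'.idxOf x + L.length ≤ L.idxOf x + L'.length := by
  induction hs with
  | slnil => simp at hx
  | cons z hs ih =>
    have := ih hx
    by_cases h : z = x
    · subst h
      have := hs.length_le
      simp; omega
    · rw [List.idxOf_cons_ne _ h]
      simp; omega
  | cons_cons z hs ih =>
    by_cases h : z = x
    · subst h
      have := hs.length_le
      simp; omega
    · rw [List.idxOf_cons_ne _ h, List.idxOf_cons_ne _ h]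
      have := ih (by simpa [Ne.symm h] using hx)
      simp; omega

theorem pair_sublist_finRange {n : ℕ} {i j : Fin n} (h : i < j) :
    [i, j].Sublist (List.finRange n) := by
  refine List.sublist_of_subperm_of_pairwise (r := (· < ·)) ?_ ?_ ?_
  · refine List.subperm_of_subset ?_ fun k _ => List.mem_finRange k
    simpa using h.ne
  · simpa using h
  · exact List.pairwise_lt_finRange n

theorem pair_sublist_flatMap {n : ℕ} {α : Type} (f : Fin n → List α) {i j : Fin n} (h : i < j)
    {x y : α} (hx : x ∈ f i) (hy : y ∈ f j) : [x, y].Sublist ((List.finRange n).flatMap f) := by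
  have h1 := (pair_sublist_finRange h).flatMap f
  simp only [List.flatMap_cons, List.flatMap_nil, List.append_nil] at h1
  exact (pair_sublist_append hx hy).trans h1

theorem sublist_flatMap {n : ℕ} {α : Type} (f : Fin n → List α) (i : Fin n) :
    (f i).Sublist ((List.finRange n).flatMap f) := by
  have h1 := (List.singleton_sublist.2 (List.mem_finRange i)).flatMap f
  simpa using h1

namespace Shape

open Vx Ed En

variable {S : Shape} {b : Bool}

/-! ### Linear orders of the vertices -/

theorem base_injective : Function.Injective (base : S.Fk → S.Vx) := by
  intro i j h
  by_cases hj : j.1 = S.sp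
  · have h' := h
    rw [show base j = cp (Fin.last S.g) from if_pos hj] at h
    by_cases hi : i.1 = S.sp
    · exact Subtype.ext (hi.trans hj.symm)
    · rw [show base i = vM i.1 from if_neg hi] at h'
      have := base_eq_vM h'.symm
      exact Subtype.ext this
  · rw [show base j = vM j.1 from if_neg hj] at h
    exact Subtype.ext (base_eq_vM h).symm

theorem base_ne_vF {j k : S.Fk} : base j ≠ vF k := by
  rcases base_cases j with ⟨k', h⟩ | ⟨k', h⟩ <;> rw [h]
  · simp
  · induction k' using Fin.cases <;> simp

open Classical in
/-- The fork, if there is one satisfying `p`, whose stem emanates from `v`. -/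
noncomputable def forkAt (p : S.Fk → Prop) (v : S.Vx) : Option S.Vx :=
  if h : ∃ j, p j ∧ base j = v then some (vF h.choose) else none

variable {p : S.Fk → Prop}

theorem forkAt_base {j : S.Fk} (hj : p j) : forkAt p (base j) = some (vF j) := by
  have h : ∃ k, p k ∧ base k = base j := ⟨j, hj, rfl⟩
  rw [forkAt, dif_pos h, base_injective h.choose_spec.2]

theorem forkAt_eq_some {v f : S.Vx} (h : forkAt p v = some f) :
    ∃ j, p j ∧ base j = v ∧ f = vF j := by
  unfold forkAt at h
  split_ifs at h with h'
  exact ⟨h'.choose, h'.choose_spec.1, h'.choose_spec.2, (Option.some.inj h).symm⟩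

theorem forkAt_eq_none {v : S.Vx} (h : ∀ j, p j → base j ≠ v) : forkAt p v = none := by
  unfold forkAt
  rw [dif_neg]
  rintro ⟨j, h1, h2⟩
  exact h j h1 h2

theorem nodup_filterMap_forkAt {L : List S.Vx} (h : L.Nodup) : (L.filterMap (forkAt p)).Nodup := by
  refine h.filterMap ?_
  intro v v' f h1 h2
  obtain ⟨j, -, rfl, rfl⟩ := forkAt_eq_some h1
  obtain ⟨j', -, rfl, h3⟩ := forkAt_eq_some h2
  rw [Vx.vF.inj h3]

theorem mem_filterMap_forkAt {L : List S.Vx} {f : S.Vx} :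
    f ∈ L.filterMap (forkAt p) ↔ ∃ j, p j ∧ base j ∈ L ∧ f = vF j := by
  rw [List.mem_filterMap]
  constructor
  · rintro ⟨v, hv, h⟩
    obtain ⟨j, h1, rfl, h2⟩ := forkAt_eq_some h
    exact ⟨j, h1, hv, h2⟩
  · rintro ⟨j, h1, h2, rfl⟩
    exact ⟨_, h2, forkAt_base h1⟩

theorem length_filterMap_forkAt {L : List S.Vx} [DecidablePred fun j : S.Fk => p j ∧ base j ∈ L]
    (h : L.Nodup) :
    (L.filterMap (forkAt p)).length
      = (Finset.univ.filter (fun j : S.Fk => p j ∧ base j ∈ L)).card := by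
  rw [← List.toFinset_card_of_nodup (nodup_filterMap_forkAt h)]
  rw [← Finset.card_image_of_injective _ (fun i j h => Vx.vF.inj h : Function.Injective
    (vF : S.Fk → S.Vx))]
  congr 1
  ext f
  simp only [List.mem_toFinset, mem_filterMap_forkAt, Finset.mem_image, Finset.mem_filter,
    Finset.mem_univ, true_and]
  constructor
  · rintro ⟨j, h1, h2, rfl⟩; exact ⟨j, ⟨h1, h2⟩, rfl⟩
  · rintro ⟨j, ⟨h1, h2⟩, rfl⟩; exact ⟨j, h1, h2, rfl⟩

theorem nodup_append_filterMap_forkAt {L : List S.Vx} (h : L.Nodup)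
    (hL : ∀ j, p j → vF j ∉ L) : (L ++ L.filterMap (forkAt p)).Nodup := by
  refine List.nodup_append.2 ⟨h, nodup_filterMap_forkAt h, ?_⟩
  rintro v hv f hf rfl
  obtain ⟨j, h1, -, rfl⟩ := mem_filterMap_forkAt.1 hf
  exact hL j h1 hv

variable (S) in
/-- The indices of the main string which come before that of the connecting edge. -/
def preIdx : List (Fin (S.m + 1)) := (List.finRange _).filter (fun j => j < S.j0)

variable (S) in
/-- The indices of the main string which come after that of the connecting edge, and at which the
flows before and after the vertex are positive or negative as prescribed. -/
def postIdx (c d : Bool) : List (Fin (S.m + 1)) :=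
  (List.finRange _).filter fun j =>
    S.j0 < j ∧ decide (0 < S.val j) = c ∧ decide (0 < S.val (j + 1)) = d

variable (S) in
/-- The vertices of the side strings and the end of the last connecting edge, in the order of the
flow. -/
def chain : Bool → List S.Vx
  | true => (List.finRange (S.n + 1)).flatMap fun i => [vP i, qv i]
  | false => ((List.finRange (S.n + 1)).flatMap fun i => [vP i, qv i]).reverse

variable (S) in
/-- The vertices which come first. -/
def early (b : Bool) : List S.Vx := S.preIdx.map vM ++ S.chain b

variable (S) in
/-- The vertices of the cycles. -/
def cycles : List S.Vx := (List.finRange S.g).flatMap fun i => [vC i false, vC i true]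

variable (S) in
/-- The vertices which come late and are not those of forks. -/
def late (P Q : List (Fin (S.m + 1))) : List S.Vx :=
  (P ++ S.postIdx true true ++ (S.postIdx false false).reverse ++ Q).map vM ++ S.cycles

theorem mem_preIdx {j : Fin (S.m + 1)} : j ∈ S.preIdx ↔ j < S.j0 := by
  simp [preIdx]

theorem mem_postIdx {c d : Bool} {j : Fin (S.m + 1)} : j ∈ S.postIdx c d ↔
    S.j0 < j ∧ decide (0 < S.val j) = c ∧ decide (0 < S.val (j + 1)) = d := by
  simp [postIdx]

theorem nodup_preIdx : S.preIdx.Nodup := (List.nodup_finRange _).filter _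

theorem nodup_postIdx {c d : Bool} : (S.postIdx c d).Nodup := (List.nodup_finRange _).filter _

theorem vM_injective : Function.Injective (vM : Fin (S.m + 1) → S.Vx) := fun _ _ h => Vx.vM.inj h

theorem mem_flatMap_chain {v : S.Vx} :
    (v ∈ (List.finRange (S.n + 1)).flatMap fun i => [(vP i : S.Vx), qv i]) ↔
      (∃ i, v = vP i) ∨ ∃ i, v = qv i := by
  simp only [List.mem_flatMap, List.mem_finRange, true_and, List.mem_cons, List.not_mem_nil,
    or_false, exists_or]

theorem mem_chain {v : S.Vx} : v ∈ S.chain b ↔ (∃ i, v = vP i) ∨ ∃ i, v = qv i := by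
  cases b
  · rw [chain, List.mem_reverse, mem_flatMap_chain]
  · rw [chain, mem_flatMap_chain]

theorem qv_injective : Function.Injective (qv : Fin (S.n + 1) → S.Vx) := by
  intro i j h
  induction i using Fin.lastCases <;> induction j using Fin.lastCases <;> simp_all

theorem nodup_chain : (S.chain b).Nodup := by
  have h : ((List.finRange (S.n + 1)).flatMap fun i => [(vP i : S.Vx), qv i]).Nodup := by
    refine List.nodup_flatMap.2 ⟨fun i _ => ?_, ?_⟩
    · simpa using fun h : vP i = qv i => qv_ne_vP h.symm
    · refine (List.pairwise_lt_finRange _).imp fun {i j} hij => ?_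
      intro v hv hv'
      simp only [List.mem_cons, List.not_mem_nil, or_false] at hv hv'
      rcases hv with rfl | rfl <;> rcases hv' with h | h
      · exact hij.ne (Vx.vP.inj h)
      · exact qv_ne_vP h.symm
      · exact qv_ne_vP h
      · exact hij.ne (qv_injective h)
  cases b
  · exact List.nodup_reverse.2 h
  · exact h

theorem mem_cycles {v : S.Vx} : v ∈ S.cycles ↔ ∃ i c, v = vC i c := by
  simp only [cycles, List.mem_flatMap, List.mem_finRange, true_and, List.mem_cons,
    List.not_mem_nil, or_false, Bool.exists_bool]

theorem nodup_cycles : (S.cycles).Nodup := by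
  refine List.nodup_flatMap.2 ⟨fun i _ => by simp, ?_⟩
  refine (List.pairwise_lt_finRange _).imp fun {i j} hij => ?_
  intro v hv hv'
  simp only [List.mem_cons, List.not_mem_nil, or_false] at hv hv'
  have := hij.ne
  rcases hv with rfl | rfl <;> rcases hv' with h | h <;> simp_all

theorem mem_early {v : S.Vx} : v ∈ S.early b ↔
    (∃ j, j < S.j0 ∧ v = vM j) ∨ (∃ i, v = vP i) ∨ ∃ i, v = qv i := by
  simp only [early, List.mem_append, List.mem_map, mem_preIdx, mem_chain, eq_comm]

theorem nodup_early : (S.early b).Nodup := by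
  refine List.nodup_append.2 ⟨nodup_preIdx.map vM_injective, nodup_chain, ?_⟩
  rintro v hv w hw rfl
  obtain ⟨j, hj, rfl⟩ := List.mem_map.1 hv
  rcases mem_chain.1 hw with ⟨i, h⟩ | ⟨i, h⟩
  · cases h
  · exact (mem_preIdx.1 hj).ne (qv_eq_vM h.symm)

theorem length_early : (S.early b).length = S.j0 + 2 * (S.n + 1) := by
  have h1 : (S.chain b).length = 2 * (S.n + 1) := by
    cases b <;> simp [chain, List.length_flatMap] <;> ring
  have h2 : S.preIdx.length = S.j0 := by
    rw [← List.toFinset_card_of_nodup nodup_preIdx]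
    have : S.preIdx.toFinset = Finset.Iio S.j0 := by
      ext j; simp [mem_preIdx]
    rw [this, Fin.card_Iio]
  rw [early, List.length_append, List.length_map, h1, h2]

section Late

variable {P Q : List (Fin (S.m + 1))} (hP : P.Perm (S.postIdx false true))
  (hQ : Q.Perm (S.postIdx true false))

include hP hQ

theorem mem_late {v : S.Vx} : v ∈ S.late P Q ↔ (∃ j, S.j0 < j ∧ v = vM j) ∨ ∃ i c, v = vC i c := by
  simp only [late, List.mem_append, mem_cycles, List.mem_map, List.mem_reverse, hP.mem_iff,
    hQ.mem_iff, mem_postIdx]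
  refine or_congr_left ?_
  constructor
  · rintro ⟨j, h, rfl⟩
    exact ⟨j, by tauto, rfl⟩
  · rintro ⟨j, h, rfl⟩
    refine ⟨j, ?_, rfl⟩
    -- Minimum, maximum, upward and downward passage are the four possible sign patterns at a
    -- vertex.
    cases decide (0 < S.val j) <;> cases decide (0 < S.val (j + 1)) <;> simp [h]

theorem nodup_late : (S.late P Q).Nodup := by
  refine List.nodup_append.2 ⟨List.Nodup.map vM_injective ?_, nodup_cycles, ?_⟩
  · simp only [List.nodup_append, hP.nodup_iff, hQ.nodup_iff, List.nodup_reverse, nodup_postIdx,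
      true_and, List.mem_append, List.mem_reverse, hP.mem_iff, hQ.mem_iff, mem_postIdx]
    refine ⟨⟨?_, ?_⟩, ?_⟩ <;> rintro i h j h' rfl <;> simp_all
  · rintro v hv w hw rfl
    obtain ⟨i, c, rfl⟩ := mem_cycles.1 hw
    simp at hv

theorem nodup_early_append_late : (S.early b ++ S.late P Q).Nodup := by
  refine List.nodup_append.2 ⟨nodup_early, nodup_late hP hQ, ?_⟩
  rintro v hv w hw rfl
  rcases mem_early.1 hv with ⟨j, hj, rfl⟩ | ⟨i, rfl⟩ | ⟨i, rfl⟩ <;>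
    rcases (mem_late hP hQ).1 hw with ⟨j', hj', h⟩ | ⟨k, c, h⟩
  · rw [Vx.vM.inj h] at hj; exact hj.not_gt hj'
  · cases h
  · cases h
  · cases h
  · exact hj'.ne' (qv_eq_vM h)
  · induction i using Fin.lastCases <;> simp at h

end Late

end Shape

namespace Shape

open Vx Ed En

variable {S : Shape} {b : Bool} {P Q : List (Fin (S.m + 1))}

/-! ### Counting the orders -/

theorem j0_lt_sp (hM : S.MainOK) (hpre : ∀ j < S.j0, 0 < S.δ j) : S.j0 < S.sp := by
  rcases lt_trichotomy S.j0 S.sp with h | h | h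
  · exact h
  · exact absurd h.symm sp_ne_j0
  · exact absurd hM.δ_sp (hpre _ h).asymm

theorem base_eq_of_pos (hM : S.MainOK) {j : S.Fk} (hj : 0 < S.δ j.1) : base j = vM j.1 := by
  refine if_neg fun h => ?_
  rw [h] at hj
  exact hj.asymm hM.δ_sp

theorem δ_fork_ne (hM : S.MainOK) (j : S.Fk) : S.δ j.1 ≠ 0 := by
  intro h
  have := hM.fork_odd j
  rw [h] at this
  exact absurd this (by decide)

theorem fork_ne_j0 (j : S.Fk) : j.1 ≠ S.j0 := by
  intro h
  have := j.2
  rw [h, S.fork_j0] at this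
  exact absurd this (by decide)

/-- A fork over +∞ hangs behind the junction, since all δ before it are positive. Inserting these
forks therefore does not push the early vertices back. -/
theorem base_not_mem_early (hpre : ∀ j < S.j0, 0 < S.δ j) {j : S.Fk}
    (hj : S.δ j.1 < 0) : base j ∉ S.early b := by
  intro h
  rcases mem_early.1 h with ⟨k, hk, h⟩ | ⟨i, h⟩ | ⟨i, h⟩
  · rw [base_eq_vM h] at hk
    exact hj.asymm (hpre _ hk)
  · exact base_ne_vP h
  · rcases base_cases j with ⟨k, h1⟩ | ⟨k, h1⟩ <;> rw [h1] at h
    · have h2 := base_eq_vM h1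
      rw [qv_eq_vM h.symm] at h2
      exact fork_ne_j0 j h2.symm
    · induction k using Fin.cases with
      | zero => exact sp_ne_j0 (qv_eq_vM h.symm)
      | succ k => induction i using Fin.lastCases <;> simp at h

/-! ### Compatibility of the basic order with the edges -/

section Base

variable (hM : S.MainOK) (hpre : ∀ j < S.j0, 0 < S.δ j) (hP : P.Perm (S.postIdx false true))
  (hQ : Q.Perm (S.postIdx true false))

include hP hQ

theorem mem_early_append_late {v : S.Vx} (hv : ∀ j, v ≠ vF j) :
    v ∈ S.early b ++ S.late P Q := by
  rw [List.mem_append, mem_early, mem_late hP hQ]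
  rcases v with i | i | j | j | ⟨i, c⟩
  · exact .inl (.inr (.inl ⟨i, rfl⟩))
  · exact .inl (.inr (.inr ⟨i.castSucc, by simp⟩))
  · rcases lt_trichotomy j S.j0 with h | rfl | h
    · exact .inl (.inl ⟨j, h, rfl⟩)
    · exact .inl (.inr (.inr ⟨Fin.last _, by simp⟩))
    · exact .inr (.inl ⟨j, h, rfl⟩)
  · exact absurd rfl (hv j)
  · exact .inr (.inr ⟨i, c, rfl⟩)

theorem vF_not_mem_early_append_late (j : S.Fk) : vF j ∉ S.early b ++ S.late P Q := by
  rw [List.mem_append, mem_early, mem_late hP hQ]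
  rintro ((⟨k, -, h⟩ | ⟨i, h⟩ | ⟨i, h⟩) | ⟨k, -, h⟩ | ⟨i, c, h⟩)
  · cases h
  · cases h
  · induction i using Fin.lastCases <;> simp at h
  · cases h
  · cases h

include hM

/-- An upward edge leads from a minimum or upward passage to an upward passage or maximum, a
downward edge likewise in terms of downward passages. Both respect the order of the blocks. Inside a
block of passages the order is that of the string, reversed for the downward ones. -/
theorem pair_sublist_late {i : Fin S.m} (hi : S.j0 < i.castSucc) :
    [S.lo b (eM i), S.hi b (eM i)].Sublist (S.late P Q) := by
  set A := S.postIdx true true with hA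
  set D := S.postIdx false false with hD
  have hv := hM.val_odd (i + 1) (by omega)
  have hi' : S.j0 < i.succ := hi.trans (Fin.castSucc_lt_succ)
  have key : ∀ {x y : Fin (S.m + 1)}, [x, y].Sublist (P ++ A ++ D.reverse ++ Q) →
      [(vM x : S.Vx), vM y].Sublist (S.late P Q) := by
    intro x y h
    have := (h.map (vM : _ → S.Vx)).trans (List.sublist_append_left _ S.cycles)
    exact this
  rw [List.append_assoc] at key
  have hs : [i.castSucc, i.succ].Sublist (List.finRange (S.m + 1)) :=
    pair_sublist_finRange Fin.castSucc_lt_succ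
  by_cases h : 0 < S.val (i + 1)
  · rw [show S.lo b (eM i) = vM i.castSucc by simp [lo, up, h, tail],
      show S.hi b (eM i) = vM i.succ by simp [Shape.hi, up, h, head]]
    apply key
    have h1 : i.castSucc ∈ P ∨ i.castSucc ∈ A := by
      rw [hP.mem_iff, mem_postIdx, mem_postIdx]
      simp [hi, h, le_or_gt]
    have h2 : i.succ ∈ A ∨ i.succ ∈ Q := by
      rw [hQ.mem_iff, mem_postIdx, mem_postIdx]
      simp [hi', h, lt_or_ge]
    by_cases h3 : i.castSucc ∈ A ∧ i.succ ∈ A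
    · have h4 : [i.castSucc, i.succ].Sublist A := by
        have := hs.filter (fun j => S.j0 < j ∧ decide (0 < S.val j) = true ∧
          decide (0 < S.val (j + 1)) = true)
        rwa [List.filter_eq_self.2] at this
        have := mem_postIdx.1 h3.1
        have := mem_postIdx.1 h3.2
        intro a ha
        simp only [List.mem_cons, List.not_mem_nil, or_false] at ha
        rcases ha with rfl | rfl <;> simp_all
      exact (h4.trans (List.sublist_append_right P A)).trans (List.sublist_append_left _ _)
    · rcases h1 with h1 | h1 <;> rcases h2 with h2 | h2
      · exact (pair_sublist_append h1 h2).trans (List.sublist_append_left _ _)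
      · exact pair_sublist_append (List.mem_append_left _ h1) (List.mem_append_right _ h2)
      · exact absurd ⟨h1, h2⟩ h3
      · exact pair_sublist_append (List.mem_append_right _ h1) (List.mem_append_right _ h2)
  · rw [show S.lo b (eM i) = vM i.succ by simp [lo, up, h, head],
      show S.hi b (eM i) = vM i.castSucc by simp [Shape.hi, up, h, tail]]
    apply key
    have h1 : i.castSucc ∈ Q ∨ i.castSucc ∈ D := by
      rw [hQ.mem_iff, mem_postIdx, mem_postIdx]
      simp [hi, h, lt_or_ge]
    have h2 : i.succ ∈ D ∨ i.succ ∈ P := by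
      rw [hP.mem_iff, mem_postIdx, mem_postIdx]
      simp [hi', h, le_or_gt]
    by_cases h3 : i.castSucc ∈ D ∧ i.succ ∈ D
    · have h4 : [i.castSucc, i.succ].Sublist D := by
        have := hs.filter (fun j => S.j0 < j ∧ decide (0 < S.val j) = false ∧
          decide (0 < S.val (j + 1)) = false)
        rwa [List.filter_eq_self.2] at this
        have := mem_postIdx.1 h3.1
        have := mem_postIdx.1 h3.2
        intro a ha
        simp only [List.mem_cons, List.not_mem_nil, or_false] at ha
        rcases ha with rfl | rfl <;> simp_all
      have h5 : [i.succ, i.castSucc].Sublist D.reverse := List.Sublist.reverse h4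
      exact (h5.trans (List.sublist_append_left _ Q)).trans (List.sublist_append_right _ _)
    · rcases h1 with h1 | h1 <;> rcases h2 with h2 | h2
      · exact (pair_sublist_append (List.mem_reverse.2 h2) h1).trans
          (List.sublist_append_right _ _)
      · exact pair_sublist_append (List.mem_append_left _ h2) (List.mem_append_right _ h1)
      · exact absurd ⟨h1, h2⟩ h3
      · exact pair_sublist_append (List.mem_append_left _ h2)
          (List.mem_append_left _ (List.mem_reverse.2 h1))

include hpre

theorem pair_sublist_early_append_late (e : S.Ed) (he : ∀ j, e ≠ eS j) :
    [S.lo b e, S.hi b e].Sublist (S.early b ++ S.late P Q) := by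
  have left : ∀ {L : List S.Vx}, L.Sublist (S.chain b) → L.Sublist (S.early b ++ S.late P Q) := fun h =>
    (h.trans (List.sublist_append_right _ _)).trans (List.sublist_append_left _ _)
  have right : ∀ {L : List S.Vx}, L.Sublist S.cycles → L.Sublist (S.early b ++ S.late P Q) := fun h =>
    (h.trans (List.sublist_append_right _ _)).trans (List.sublist_append_right _ _)
  rcases e with i | i | i | j | i | ⟨i, c⟩
  · have h := sublist_flatMap (fun i : Fin (S.n + 1) => [(vP i : S.Vx), qv i]) i
    cases b
    · exact left (List.Sublist.reverse h)
    · exact left h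
  · have h := pair_sublist_flatMap (fun i : Fin (S.n + 1) => [(vP i : S.Vx), qv i])
      (i := i.castSucc) (j := i.succ) Fin.castSucc_lt_succ (x := vQ i) (y := vP i.succ)
      (by simp) (by simp)
    cases b
    · exact left (List.Sublist.reverse h)
    · exact left h
  · by_cases hi : S.j0 < i.castSucc
    · exact (pair_sublist_late hM hP hQ hi).trans (List.sublist_append_right _ _)
    · have h : 0 < S.val (i + 1) := hM.val_pos _ (by
        have : i.val ≤ S.j0 := not_lt.1 hi
        omega)
      rw [show S.lo b (eM i) = vM i.castSucc by simp [lo, up, h, tail],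
        show S.hi b (eM i) = vM i.succ by simp [Shape.hi, up, h, head]]
      rcases (not_lt.1 hi).lt_or_eq with hi | hi
      · have h1 : vM i.castSucc ∈ S.preIdx.map (vM : _ → S.Vx) :=
          List.mem_map_of_mem (mem_preIdx.2 hi)
        rcases (Fin.castSucc_lt_iff_succ_le.1 hi : i.succ ≤ S.j0).lt_or_eq with hi' | hi'
        · have h2 : [i.castSucc, i.succ].Sublist S.preIdx := by
            have := (pair_sublist_finRange (Fin.castSucc_lt_succ (i := i))).filter
              (fun j => j < S.j0)
            rwa [List.filter_eq_self.2] at this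
            intro a ha
            simp only [List.mem_cons, List.not_mem_nil, or_false] at ha
            rcases ha with rfl | rfl <;> simp_all
          exact ((h2.map vM).trans (List.sublist_append_left _ _)).trans
            (List.sublist_append_left _ _)
        · refine (pair_sublist_append h1 (mem_chain.2 (.inr ⟨Fin.last _, ?_⟩))).trans
            (List.sublist_append_left _ _)
          rw [hi', qv_last]
      · refine pair_sublist_append (mem_early.2 (.inr (.inr ⟨Fin.last _, ?_⟩)))
          ((mem_late hP hQ).2 (.inl ⟨i.succ, ?_, rfl⟩))
        · rw [hi, qv_last]
        · rw [← hi]; exact Fin.castSucc_lt_succ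
  · exact absurd rfl (he j)
  · change [cp i.castSucc, vC i false].Sublist _
    obtain ⟨k, hk⟩ : ∃ k, k = i.castSucc := ⟨_, rfl⟩
    rw [← hk]
    induction k using Fin.cases with
    | zero =>
      refine List.Sublist.trans ?_ (List.sublist_append_right _ _)
      refine pair_sublist_append ?_ (mem_cycles.2 ⟨_, _, rfl⟩)
      have : vM S.sp ∈ S.early b ++ S.late P Q :=
        mem_early_append_late hP hQ (fun j h => by cases h)
      have h2 := (mem_late hP hQ).2 (.inl ⟨S.sp, j0_lt_sp hM hpre, rfl⟩)
      rcases List.mem_append.1 h2 with h2 | h2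
      · exact h2
      · obtain ⟨_, _, h3⟩ := mem_cycles.1 h2
        cases h3
    | succ k =>
      refine right (pair_sublist_flatMap _ (i := k) (j := i) ?_ (by simp) (by simp))
      have := congrArg Fin.val hk
      simp at this
      exact Fin.lt_def.2 (by omega)
  · refine right (List.Sublist.trans ?_ (sublist_flatMap _ i))
    exact List.Sublist.refl _

end Base

/-- The orders of the vertices in which the minima and the maxima of the main string after `j0` are
ordered as in `P` and `Q`. -/
noncomputable def orders (b : Bool) (P Q : List (Fin (S.m + 1))) : Finset (List S.Vx) :=
  (insertions (forkAt fun j => S.δ j.1 < 0) (S.early b ++ S.late P Q)).biUnion fun L =>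
    (insertions (forkAt fun j => 0 < S.δ j.1) L.reverse).image List.reverse

theorem mem_orders {ord : List S.Vx} : ord ∈ orders b P Q ↔
    ∃ L ∈ insertions (forkAt fun j => S.δ j.1 < 0) (S.early b ++ S.late P Q),
      ord.reverse ∈ insertions (forkAt fun j => 0 < S.δ j.1) L.reverse := by
  simp only [orders, Finset.mem_biUnion, Finset.mem_image]
  refine exists_congr fun L => and_congr_right fun _ => ?_
  constructor
  · rintro ⟨a, ha, rfl⟩
    rwa [List.reverse_reverse]
  · intro h
    exact ⟨_, h, List.reverse_reverse _⟩

/-! ### Inserting the forks -/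

section Orders

variable (hM : S.MainOK) (hpre : ∀ j < S.j0, 0 < S.δ j) (hP : P.Perm (S.postIdx false true))
  (hQ : Q.Perm (S.postIdx true false)) {L : List S.Vx}
  (hL : L ∈ insertions (forkAt fun j => S.δ j.1 < 0) (S.early b ++ S.late P Q))

include hL

theorem exists_eq_early_append (hpre : ∀ j < S.j0, 0 < S.δ j) :
    ∃ Y ∈ insertions (forkAt fun j => S.δ j.1 < 0) (S.late P Q), L = S.early b ++ Y := by
  refine mem_insertions_append (fun v hv => forkAt_eq_none fun j hj h => ?_) hL
  rw [← h] at hv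
  exact base_not_mem_early hpre hj hv

include hP hQ

theorem vF_not_mem {j : S.Fk} (hj : 0 < S.δ j.1) : vF j ∉ L := by
  rw [(perm_of_mem_insertions hL).mem_iff, List.mem_append, mem_filterMap_forkAt]
  rintro (h | ⟨k, h1, -, h2⟩)
  · exact vF_not_mem_early_append_late hP hQ j h
  · rw [Vx.vF.inj h2] at hj
    exact hj.asymm h1

theorem nodup_of_mem_insertions : L.Nodup :=
  (perm_of_mem_insertions hL).nodup_iff.2 (nodup_append_filterMap_forkAt
    (nodup_early_append_late hP hQ) fun j _ => vF_not_mem_early_append_late hP hQ j)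

theorem nodup_reverse_append : (L.reverse ++ L.reverse.filterMap
    (forkAt fun j => 0 < S.δ j.1)).Nodup :=
  nodup_append_filterMap_forkAt (List.nodup_reverse.2 (nodup_of_mem_insertions hP hQ hL))
    fun j hj h => vF_not_mem hP hQ hL hj (List.mem_reverse.1 h)

include hM

/-- The early block has `S.j0 + 2 * (S.n + 1)` vertices and is delayed only by forks over -∞. Thus
`hroom` keeps all of it within the first half of the vertices. -/
theorem isOrder_of_mem_orders (hpre : ∀ j < S.j0, 0 < S.δ j) {ord : List S.Vx}
    (hord : ord.reverse ∈ insertions (forkAt fun j => 0 < S.δ j.1) L.reverse)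
    (hroom : S.j0 + 2 * (S.n + 1) + (Finset.univ.filter fun j : S.Fk => 0 < S.δ j.1).card
      ≤ (Fintype.card S.Vx + 1) / 2) : S.IsOrder b ord := by
  have hperm := perm_of_mem_insertions hord
  have hnodup : ord.Nodup :=
    List.nodup_reverse.1 (hperm.nodup_iff.2 (nodup_reverse_append hP hQ hL))
  have hsub : L.Sublist ord := by
    have := List.Sublist.reverse (sublist_of_mem_insertions hord)
    simpa using this
  have hsub0 := sublist_of_mem_insertions hL
  have hmem : ∀ v, v ∈ ord := by
    intro v
    by_cases hv : ∃ j, v = vF j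
    · obtain ⟨j, rfl⟩ := hv
      have hb : base j ∈ S.early b ++ S.late P Q :=
        mem_early_append_late hP hQ fun k => base_ne_vF
      rcases lt_or_gt_of_ne (δ_fork_ne hM j) with h | h
      · refine hsub.subset ((perm_of_mem_insertions hL).mem_iff.2 ?_)
        exact List.mem_append_right _ (mem_filterMap_forkAt.2 ⟨j, h, hb, rfl⟩)
      · refine List.mem_reverse.1 (hperm.mem_iff.2 ?_)
        exact List.mem_append_right _ (mem_filterMap_forkAt.2
          ⟨j, h, List.mem_reverse.2 (hsub0.subset hb), rfl⟩)
    · push Not at hv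
      exact hsub.subset (hsub0.subset (mem_early_append_late hP hQ hv))
  have hcard : ord.length = Fintype.card S.Vx := by
    rw [← List.toFinset_card_of_nodup hnodup, ← Finset.card_univ]
    congr 1
    ext v
    simp [hmem v]
  have hearly : ∀ v ∈ S.early b, ord.idxOf v + 1 ≤ (ord.length + 1) / 2 := by
    intro v hv
    obtain ⟨Y, -, rfl⟩ := exists_eq_early_append hL hpre
    have h1 := idxOf_le_of_sublist hsub (List.mem_append_left Y hv)
    rw [List.idxOf_append_of_mem hv] at h1
    have h2 := List.idxOf_lt_length_of_mem hv
    rw [length_early] at h2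
    have h3 := hperm.length_eq
    rw [List.length_reverse, List.length_append, List.length_reverse] at h3
    have h4 := length_filterMap_forkAt (p := fun j : S.Fk => 0 < S.δ j.1)
      (List.nodup_reverse.2 (nodup_of_mem_insertions hP hQ hL))
    have h5 : (Finset.univ.filter fun j : S.Fk => 0 < S.δ j.1 ∧
        base j ∈ (S.early b ++ Y).reverse).card
        ≤ (Finset.univ.filter fun j : S.Fk => 0 < S.δ j.1).card :=
      Finset.card_le_card (Finset.monotone_filter_right _ fun _ _ h => h.1)
    rw [← hcard] at hroom
    omega
  refine ⟨hnodup, hmem, fun e => idxOf_lt_of_pair_sublist hnodup ?_, fun i => ?_, fun i => ?_⟩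
  · by_cases he : ∃ j, e = eS j
    · obtain ⟨j, rfl⟩ := he
      have hb : base j ∈ S.early b ++ S.late P Q :=
        mem_early_append_late hP hQ fun k => base_ne_vF
      rcases lt_or_gt_of_ne (δ_fork_ne hM j) with h | h
      · have h1 := pair_sublist_of_mem_insertions hL hb (forkAt_base h)
        rw [show S.lo b (eS j) = base j by simp [lo, up, h, tail],
          show S.hi b (eS j) = vF j by simp [hi, up, h, head]]
        exact h1.trans hsub
      · have h1 := pair_sublist_of_mem_insertions hord
          (List.mem_reverse.2 (hsub0.subset hb)) (forkAt_base h)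
        rw [show S.lo b (eS j) = vF j by simp [lo, up, h.le, head],
          show S.hi b (eS j) = base j by simp [hi, up, h.le, tail]]
        have := List.Sublist.reverse h1
        simpa using this
    · push Not at he
      exact ((pair_sublist_early_append_late hM hpre hP hQ e he).trans hsub0).trans hsub
  · exact hearly _ (mem_early.2 (.inr (.inl ⟨i, rfl⟩)))
  · exact hearly _ (mem_early.2 (.inr (.inr ⟨i, rfl⟩)))

/-- Reversing the list turns insertion before the base into insertion after it. For a base behind
the junction the whole early block is then still to come, and its chain alone supplies `2 * (S.n +
1)` further places. -/
theorem prod_le_card_insertions (hpre : ∀ j < S.j0, 0 < S.δ j) :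
    (∏ i ∈ Finset.range (Finset.univ.filter fun j : S.Fk => 0 < S.δ j.1 ∧ S.j0 < j.1).card,
        (2 * (S.n + 1) + 2 * i + 1))
      * (∏ i ∈ Finset.range (Finset.univ.filter fun j : S.Fk => 0 < S.δ j.1 ∧ j.1 < S.j0).card,
        (2 * i + 1))
      ≤ (insertions (forkAt fun j => 0 < S.δ j.1) L.reverse).card := by
  have hnd := nodup_reverse_append hP hQ hL
  obtain ⟨Y, hY, rfl⟩ := exists_eq_early_append hL hpre
  have hndL := List.nodup_append.1 (nodup_of_mem_insertions hP hQ hL)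
  rw [List.reverse_append] at hnd ⊢
  have h1 := prod_mul_card_insertions_le _ _ hnd
  have hnd2 : ((S.early b).reverse ++ (S.early b).reverse.filterMap
      (forkAt fun j => 0 < S.δ j.1)).Nodup := by
    refine nodup_append_filterMap_forkAt (List.nodup_reverse.2 nodup_early) fun j _ h => ?_
    exact vF_not_mem_early_append_late (b := b) hP hQ j
      (List.mem_append_left _ (List.mem_reverse.1 h))
  have h2 := prod_mul_card_insertions_le (fk := forkAt fun j => 0 < S.δ j.1)
    (S.early b).reverse [] (by simpa using hnd2)
  simp only [List.append_nil] at h2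
  have c1 : (Finset.univ.filter fun j : S.Fk => 0 < S.δ j.1 ∧ S.j0 < j.1).card
      = (Y.reverse.filterMap (forkAt fun j : S.Fk => 0 < S.δ j.1)).length := by
    rw [length_filterMap_forkAt (List.nodup_reverse.2 hndL.2.1)]
    congr 1
    refine Finset.filter_congr fun j _ => and_congr_right fun hj => ?_
    rw [List.mem_reverse, (perm_of_mem_insertions hY).mem_iff, List.mem_append,
      mem_late hP hQ, base_eq_of_pos hM hj, mem_filterMap_forkAt]
    constructor
    · exact fun h => .inl (.inl ⟨_, h, rfl⟩)
    · rintro ((⟨k, hk, h⟩ | ⟨_, _, h⟩) | ⟨_, _, _, h⟩)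
      · rwa [Vx.vM.inj h]
      · cases h
      · cases h
  have c2 : (Finset.univ.filter fun j : S.Fk => 0 < S.δ j.1 ∧ j.1 < S.j0).card
      = ((S.early b).reverse.filterMap (forkAt fun j : S.Fk => 0 < S.δ j.1)).length := by
    rw [length_filterMap_forkAt (List.nodup_reverse.2 nodup_early)]
    congr 1
    refine Finset.filter_congr fun j _ => and_congr_right fun hj => ?_
    rw [List.mem_reverse, mem_early, base_eq_of_pos hM hj]
    constructor
    · exact fun h => .inl ⟨_, h, rfl⟩
    · rintro (⟨k, hk, h⟩ | ⟨_, h⟩ | ⟨i, h⟩)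
      · rwa [Vx.vM.inj h]
      · cases h
      · exact absurd (qv_eq_vM h.symm) (fork_ne_j0 j)
  rw [c1, c2]
  refine le_trans (Nat.mul_le_mul (Finset.prod_le_prod' fun i _ => ?_) ?_) h1
  · rw [List.length_reverse, length_early]
    omega
  · refine le_trans ?_ h2
    refine (Nat.le_mul_of_pos_right _ (card_insertions_pos [])).trans' ?_
    exact Finset.prod_le_prod' fun i _ => by simp

end Orders

/-! ### The number of orders -/

section Count

variable (hM : S.MainOK) (hpre : ∀ j < S.j0, 0 < S.δ j)

theorem filter_of_mem_orders (hP : P.Perm (S.postIdx false true))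
    (hQ : Q.Perm (S.postIdx true false)) {L ord : List S.Vx} (p : S.Vx → Bool)
    (hp : ∀ v, p v = true ↔ ∀ j : S.Fk, 0 < S.δ j.1 → v ≠ vF j)
    (hL : L ∈ insertions (forkAt fun j => S.δ j.1 < 0) (S.early b ++ S.late P Q))
    (hord : ord.reverse ∈ insertions (forkAt fun j => 0 < S.δ j.1) L.reverse) :
    ord.filter p = L := by
  have h := filter_eq_of_mem_insertions hord p
    (fun v hv => (hp v).2 fun j hj h =>
      vF_not_mem hP hQ hL hj (h ▸ List.mem_reverse.1 hv))
    (fun v f hf => by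
      obtain ⟨j, hj, -, rfl⟩ := forkAt_eq_some hf
      exact Bool.eq_false_iff.2 fun h => (hp _).1 h j hj rfl)
  rw [List.filter_reverse, List.reverse_inj] at h
  exact h

include hM hpre

/-- Forks over +∞ are inserted first and forks over -∞ afterwards. Forgetting the latter recovers
the intermediate list, so the contributions of different intermediate lists are disjoint. -/
theorem prod_le_card_orders (hP : P.Perm (S.postIdx false true))
    (hQ : Q.Perm (S.postIdx true false)) :
    (∏ i ∈ Finset.range (Finset.univ.filter fun j : S.Fk => S.δ j.1 < 0).card, (2 * i + 1))
      * ((∏ i ∈ Finset.range (Finset.univ.filter fun j : S.Fk => 0 < S.δ j.1 ∧ S.j0 < j.1).card,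
        (2 * (S.n + 1) + 2 * i + 1))
      * ∏ i ∈ Finset.range (Finset.univ.filter fun j : S.Fk => 0 < S.δ j.1 ∧ j.1 < S.j0).card,
        (2 * i + 1)) ≤ (orders b P Q).card := by
  classical
  rw [orders, Finset.card_biUnion]
  · have hnd : ((S.early b ++ S.late P Q) ++ (S.early b ++ S.late P Q).filterMap
        (forkAt fun j => S.δ j.1 < 0)).Nodup :=
      nodup_append_filterMap_forkAt (nodup_early_append_late hP hQ)
        fun j _ => vF_not_mem_early_append_late hP hQ j
    have h2 := prod_mul_card_insertions_le (fk := forkAt fun j => S.δ j.1 < 0)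
      (S.early b ++ S.late P Q) [] (by simpa using hnd)
    simp only [List.append_nil] at h2
    have c : (Finset.univ.filter fun j : S.Fk => S.δ j.1 < 0).card
        = ((S.early b ++ S.late P Q).filterMap (forkAt fun j : S.Fk => S.δ j.1 < 0)).length := by
      rw [length_filterMap_forkAt (nodup_early_append_late hP hQ)]
      congr 1
      refine Finset.filter_congr fun j _ => (and_iff_left ?_).symm
      exact mem_early_append_late hP hQ fun k => base_ne_vF
    calc _ ≤ (insertions (forkAt fun j : S.Fk => S.δ j.1 < 0) (S.early b ++ S.late P Q)).card
          * _ := by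
            refine Nat.mul_le_mul_right _ (le_trans ?_ h2)
            rw [c]
            refine (Nat.le_mul_of_pos_right _ (card_insertions_pos [])).trans' ?_
            exact Finset.prod_le_prod' fun i _ => by simp
      _ = ∑ L ∈ insertions (forkAt fun j : S.Fk => S.δ j.1 < 0) (S.early b ++ S.late P Q), _ := by
            rw [Finset.sum_const, smul_eq_mul]
      _ ≤ _ := by
            refine Finset.sum_le_sum fun L hL => ?_
            rw [Finset.card_image_of_injective _ List.reverse_injective]
            exact prod_le_card_insertions hM hP hQ hL hpre
  · intro L hL L' hL' hne
    refine Finset.disjoint_left.2 fun ord h h' => hne ?_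
    obtain ⟨l, hl, rfl⟩ := Finset.mem_image.1 h
    obtain ⟨l', hl', h3⟩ := Finset.mem_image.1 h'
    obtain rfl := List.reverse_injective h3
    have h1 := filter_of_mem_orders hP hQ (ord := l'.reverse)
      (fun v => decide (∀ j : S.Fk, 0 < S.δ j.1 → v ≠ vF j)) (fun v => by simp) hL
      (by rwa [List.reverse_reverse])
    have h2 := filter_of_mem_orders hP hQ (ord := l'.reverse)
      (fun v => decide (∀ j : S.Fk, 0 < S.δ j.1 → v ≠ vF j)) (fun v => by simp) hL'
      (by rwa [List.reverse_reverse])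
    exact h1.symm.trans h2

/-- Without the forks an order is the fixed early block followed by blocks of known lengths, so the
permutations of the minima and of the maxima can be read off from it. -/
theorem exists_orders (hroom : S.j0 + 2 * (S.n + 1)
      + (Finset.univ.filter fun j : S.Fk => 0 < S.δ j.1).card ≤ (Fintype.card S.Vx + 1) / 2)
    (b : Bool) : ∃ O : Finset (List S.Vx), (∀ ord ∈ O, S.IsOrder b ord) ∧
    (S.postIdx false true).length.factorial * (S.postIdx true false).length.factorial *
    ((∏ i ∈ Finset.range (Finset.univ.filter fun j : S.Fk => S.δ j.1 < 0).card, (2 * i + 1))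
      * ((∏ i ∈ Finset.range (Finset.univ.filter fun j : S.Fk => 0 < S.δ j.1 ∧ S.j0 < j.1).card,
        (2 * (S.n + 1) + 2 * i + 1))
      * ∏ i ∈ Finset.range (Finset.univ.filter fun j : S.Fk => 0 < S.δ j.1 ∧ j.1 < S.j0).card,
        (2 * i + 1))) ≤ O.card := by
  classical
  set T := (S.postIdx false true).permutations.toFinset ×ˢ
    (S.postIdx true false).permutations.toFinset with hT
  have hTmem : ∀ q ∈ T, q.1.Perm (S.postIdx false true) ∧ q.2.Perm (S.postIdx true false) := by
    intro q hq
    simpa [hT, Finset.mem_product] using hq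
  refine ⟨T.biUnion fun q => orders b q.1 q.2, ?_, ?_⟩
  · intro ord h
    obtain ⟨q, hq, h⟩ := Finset.mem_biUnion.1 h
    obtain ⟨L, hL, h⟩ := mem_orders.1 h
    exact isOrder_of_mem_orders hM (hTmem q hq).1 (hTmem q hq).2 hL hpre h hroom
  · rw [Finset.card_biUnion]
    · have hcard : T.card = (S.postIdx false true).length.factorial
          * (S.postIdx true false).length.factorial := by
        rw [hT, Finset.card_product, List.toFinset_card_of_nodup, List.toFinset_card_of_nodup,
          List.length_permutations, List.length_permutations]
        · exact List.nodup_permutations _ nodup_postIdx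
        · exact List.nodup_permutations _ nodup_postIdx
      rw [← hcard, ← smul_eq_mul T.card, ← Finset.sum_const]
      exact Finset.sum_le_sum fun q hq =>
        prod_le_card_orders hM hpre (hTmem q hq).1 (hTmem q hq).2
    · intro q hq q' hq' hne
      refine Finset.disjoint_left.2 fun ord h h' => hne ?_
      have hPQ := hTmem q hq
      have hPQ' := hTmem q' hq'
      obtain ⟨L, hL, h⟩ := mem_orders.1 h
      obtain ⟨L', hL', h'⟩ := mem_orders.1 h'
      have e1 := filter_of_mem_orders hPQ.1 hPQ.2
        (fun v => decide (∀ j : S.Fk, 0 < S.δ j.1 → v ≠ vF j)) (fun v => by simp) hL h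
      have e2 := filter_of_mem_orders hPQ'.1 hPQ'.2
        (fun v => decide (∀ j : S.Fk, 0 < S.δ j.1 → v ≠ vF j)) (fun v => by simp) hL' h'
      obtain rfl := e1.symm.trans e2
      have f1 := filter_eq_of_mem_insertions hL (fun v => decide (∀ j : S.Fk, v ≠ vF j))
        (fun v hv => by
          simp only [decide_eq_true_eq]
          rintro j rfl
          exact vF_not_mem_early_append_late hPQ.1 hPQ.2 j hv)
        (fun v f hf => by
          obtain ⟨j, hj, -, rfl⟩ := forkAt_eq_some hf
          simp)
      have f2 := filter_eq_of_mem_insertions hL' (fun v => decide (∀ j : S.Fk, v ≠ vF j))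
        (fun v hv => by
          simp only [decide_eq_true_eq]
          rintro j rfl
          exact vF_not_mem_early_append_late hPQ'.1 hPQ'.2 j hv)
        (fun v f hf => by
          obtain ⟨j, hj, -, rfl⟩ := forkAt_eq_some hf
          simp)
      have e3 := List.append_cancel_left (f1.symm.trans f2)
      have e4 := vM_injective.list_map (List.append_cancel_right e3)
      have l1 := hPQ.1.length_eq.trans hPQ'.1.length_eq.symm
      have l2 := hPQ.2.length_eq.trans hPQ'.2.length_eq.symm
      simp only [List.append_assoc] at e4
      have e5 := List.append_inj e4 l1
      have e6 := List.append_cancel_left (List.append_cancel_left e5.2)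
      exact Prod.ext e5.1 e6

end Count

end Shape

/-! ### The cycle lemma -/

theorem exists_last_min (P : ℕ → ℤ) (n : ℕ) :
    ∃ c ≤ n, (∀ j ≤ n, P c ≤ P j) ∧ ∀ j ≤ n, c < j → P c < P j := by
  induction n with
  | zero => exact ⟨0, le_rfl, fun j hj => by rw [Nat.le_zero.1 hj], fun j hj h => by omega⟩
  | succ n ih =>
    obtain ⟨c, hc, h1, h2⟩ := ih
    by_cases h : P c < P (n + 1)
    · refine ⟨c, by omega, fun j hj => ?_, fun j hj hcj => ?_⟩
      · rcases Nat.le_succ_iff.1 hj with hj | rfl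
        · exact h1 j hj
        · exact h.le
      · rcases Nat.le_succ_iff.1 hj with hj | rfl
        · exact h2 j hj hcj
        · exact h
    · refine ⟨n + 1, le_rfl, fun j hj => ?_, fun j hj hcj => by omega⟩
      rcases Nat.le_succ_iff.1 hj with hj | rfl
      · exact (not_lt.1 h).trans (h1 j hj)
      · exact le_rfl

theorem sum_filter_le_eq {n : ℕ} (f : ℕ → ℤ) (i : Fin n) :
    ∑ j ∈ Finset.univ.filter (fun j : Fin n => j ≤ i), f j = ∑ j ∈ Finset.range (i + 1), f j := by
  refine Finset.sum_bij (fun j _ => j.val) ?_ ?_ ?_ ?_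
  · intro j hj
    simp only [Finset.mem_filter, Finset.mem_univ, true_and] at hj
    simpa [Nat.lt_succ_iff] using hj
  · intro j _ k _ h
    exact Fin.ext h
  · intro j hj
    rw [Finset.mem_range] at hj
    refine ⟨⟨j, by omega⟩, ?_, rfl⟩
    simp only [Finset.mem_filter, Finset.mem_univ, true_and, Fin.le_def]
    omega
  · intro j _
    rfl

/-- Continue the sequence periodically and start at the last minimum of its prefix sums within a
period. Later prefix sums in this period are strictly larger by the choice of the minimum, those in
later periods because the total is positive. -/
theorem exists_rotation {n : ℕ} (d : Fin (n + 1) → ℤ) (hd : 0 < ∑ i, d i) :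
    ∃ c : Fin (n + 1), ∀ i, 0 < ∑ j ∈ Finset.univ.filter (fun j => j ≤ i), d (c + j) := by
  set e : ℕ → ℤ := fun j => d ⟨j % (n + 1), Nat.mod_lt _ (Nat.succ_pos n)⟩ with he
  set P : ℕ → ℤ := fun j => ∑ i ∈ Finset.range j, e i with hP
  have hP1 : ∀ i j, P (i + j) = P i + ∑ k ∈ Finset.range j, e (i + k) := fun i j =>
    Finset.sum_range_add _ _ _
  have hper : ∀ j, P (n + 1 + j) = ∑ i, d i + P j := by
    intro j
    have h1 : ∀ k, e (n + 1 + k) = e k := fun k => by simp only [he, Nat.add_mod_left]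
    have h2 : P (n + 1) = ∑ i, d i := by
      refine (Finset.sum_range e).trans ?_
      refine Finset.sum_congr rfl fun i _ => ?_
      simp only [he]
      congr 1
      ext
      exact Nat.mod_eq_of_lt i.2
    rw [hP1, h2]
    simp only [h1]
    rfl
  obtain ⟨c, hc, h1, h2⟩ := exists_last_min P n
  have h3 : ∀ j, c < j → P c < P j := by
    intro j
    induction j using Nat.strong_induction_on with
    | _ j ih =>
      intro hcj
      by_cases hj : j ≤ n
      · exact h2 j hj hcj
      · obtain ⟨k, rfl⟩ := Nat.exists_eq_add_of_le (show n + 1 ≤ j by omega)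
        rw [hper]
        by_cases hk : c < k
        · have := ih k (by omega) hk
          omega
        · have := h1 k (by omega)
          omega
  refine ⟨⟨c, by omega⟩, fun i => ?_⟩
  have h4 : ∀ j : Fin (n + 1), d (⟨c, by omega⟩ + j) = e (c + j) := by
    intro j
    simp only [he]
    congr 1
  simp only [h4]
  rw [sum_filter_le_eq (fun j => e (c + j))]
  have h5 := h3 (c + (i + 1)) (by omega)
  rw [hP1] at h5
  omega

open Classical in
/-- The permutations for which all partial sums are positive. -/
noncomputable def positivePerms {n : ℕ} (d : Fin (n + 1) → ℤ) :
    Finset (Equiv.Perm (Fin (n + 1))) :=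
  Finset.univ.filter fun σ => ∀ i, 0 < ∑ j ∈ Finset.univ.filter (fun j => j ≤ i), d (σ j)

/-- Every permutation is a positive one composed with one of the n + 1 cyclic shifts, so (n + 1)! is
at most n + 1 times the number of positive ones. -/
theorem factorial_le_card_positivePerms {n : ℕ} (d : Fin (n + 1) → ℤ) (hd : 0 < ∑ i, d i) :
    n.factorial ≤ (positivePerms d).card := by
  classical
  have h : (Finset.univ : Finset (Equiv.Perm (Fin (n + 1))))
      ⊆ (positivePerms d ×ˢ Finset.univ).image fun q => q.1 * Equiv.addLeft q.2 := by
    intro σ _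
    obtain ⟨c, hc⟩ := exists_rotation (fun i => d (σ i)) (by rwa [Equiv.sum_comp σ d])
    refine Finset.mem_image.2 ⟨(σ * Equiv.addLeft c, -c), ?_, ?_⟩
    · simp only [Finset.mem_product, Finset.mem_univ, and_true, positivePerms, Finset.mem_filter,
        true_and]
      exact hc
    · ext i
      simp
  have h1 := (Finset.card_le_card h).trans Finset.card_image_le
  rw [Finset.card_univ, Fintype.card_perm, Fintype.card_fin, Finset.card_product, Finset.card_univ,
    Fintype.card_fin, Nat.factorial_succ, mul_comm] at h1
  exact Nat.le_of_mul_le_mul_right h1 (Nat.succ_pos n)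

/-! ### Counting the covers of a given shape -/

namespace Shape

variable {S : Shape} {lam mu : Multiset ℕ}

/-- In a trivalent graph of genus g the number of vertices is the number of ends plus 2g - 2. Here
it is counted by the kinds of vertices and ends. Therefore each branch point is the image of exactly
one vertex. -/
theorem card_vx_eq_branchCount {A B : Fin (S.n + 1) → ℤ}
    (hends : Finset.univ.val.map (S.flowL A B)
      = lam.map (fun n : ℕ => (n : ℤ)) + mu.map (fun n : ℕ => -(n : ℤ))) :
    Fintype.card S.Vx = branchCount S.g lam mu := by
  have h1 := congrArg Multiset.card hends
  rw [Multiset.card_map, Multiset.card_add, Multiset.card_map, Multiset.card_map,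
    Finset.card_val, Finset.card_univ, ← Fintype.card_congr (enEquiv (S := S))] at h1
  rw [← Fintype.card_congr (vxEquiv (S := S)), branchCount, ← h1]
  simp only [Fintype.card_sum, Fintype.card_prod, Fintype.card_fin, Fintype.card_bool,
    Fintype.card_unit]
  -- Each of the m main vertices other than the junction carries exactly one tail.
  have h2 : Fintype.card S.Sg + Fintype.card S.Fk = S.m := by
    have e1 : Fintype.card S.Sg = (Finset.univ.filter fun j => j ≠ S.j0 ∧ S.fork j = false).card :=
      Fintype.card_subtype _
    have e2 : Fintype.card S.Fk
        = (Finset.univ.filter fun j : Fin (S.m + 1) => S.fork j = true).card :=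
      Fintype.card_subtype _
    have e3 : (Finset.univ.filter fun j => j ≠ S.j0 ∧ S.fork j = false)
        ∪ (Finset.univ.filter fun j : Fin (S.m + 1) => S.fork j = true)
        = Finset.univ.erase S.j0 := by
      ext j
      simp only [Finset.mem_union, Finset.mem_filter, Finset.mem_univ, true_and,
        Finset.mem_erase, and_true]
      constructor
      · rintro (h | h)
        · exact h.1
        · rintro rfl
          rw [S.fork_j0] at h
          cases h
      · intro h
        cases h' : S.fork j
        · exact .inl ⟨h, rfl⟩
        · exact .inr rfl
    rw [e1, e2, ← Finset.card_union_of_disjoint, e3, Finset.card_erase_of_mem (Finset.mem_univ _),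
      Finset.card_univ, Fintype.card_fin, Nat.add_sub_cancel]
    refine Finset.disjoint_left.2 fun j h h' => ?_
    simp only [Finset.mem_filter, Finset.mem_univ, true_and] at h h'
    rw [h'] at h
    exact absurd h.2 (by decide)
  omega

/-- Flows from `F` and orders from `O` combine freely, and `cover_injective` makes the resulting
isomorphism classes distinct. The factor two comes from the definition of Z'. -/
theorem boundsEffectiveNumber {b : Bool} (hM : S.MainOK)
    (F : Finset ((Fin (S.n + 1) → ℤ) × (Fin (S.n + 1) → ℤ))) (hF : ∀ q ∈ F, S.SideOK b q.1 q.2)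
    (hmu : ∀ n ∈ mu, 0 < n)
    (hends : ∀ q ∈ F, Finset.univ.val.map (S.flowL q.1 q.2)
      = lam.map (fun n : ℕ => (n : ℤ)) + mu.map (fun n : ℕ => -(n : ℤ)))
    (O : Finset (List S.Vx)) (hO : ∀ ord ∈ O, S.IsOrder b ord) :
    BoundsEffectiveNumber S.g lam mu (2 * (F.card * O.card)) := by
  classical
  intro x hx
  have hlen : ∀ q : F × O, q.2.1.length = branchCount S.g lam mu := by
    intro q
    have h := hO _ q.2.2
    rw [← card_vx_eq_branchCount (hends _ q.1.2), ← List.toFinset_card_of_nodup h.nodup,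
      ← Finset.card_univ]
    congr 1
    ext v
    simp [h.mem v]
  set c : F × O → Quotient TropicalCover.isoSetoid := fun q =>
    Quotient.mk _ (cover hM (hF _ q.1.2) (hO _ q.2.2) (hlen q) hx) with hc
  have hinj : Function.Injective c := by
    rintro ⟨q, o⟩ ⟨q', o'⟩ h
    obtain ⟨f⟩ := Quotient.exact h
    obtain ⟨h1, h2, h3⟩ := cover_injective hM (hF _ q.2) (hF _ q'.2) (hO _ o.2) (hO _ o'.2)
      (hlen (q, o)) (hlen (q', o')) hx f
    exact Prod.ext (Subtype.ext (Prod.ext h1 h2)) (Subtype.ext h3)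
  have hsub : Set.range c ⊆ Quotient.mk TropicalCover.isoSetoid ''
      {C | C.HasType S.g lam mu x ∧ C.IsEffectiveNonZigzag x} := by
    rintro _ ⟨q, rfl⟩
    exact ⟨_, ⟨cover_hasType hM _ _ _ _ hmu (hends _ q.1.2), cover_effective hM _ _ _ _⟩, rfl⟩
  have hcard : (Set.range c).encard = ((F.card * O.card : ℕ) : ℕ∞) := by
    rw [← Set.image_univ, hinj.encard_image, Set.encard_univ, ENat.card_eq_coe_fintype_card,
      Fintype.card_prod, Fintype.card_coe, Fintype.card_coe]
  have h := Set.encard_le_encard hsub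
  rw [hcard] at h
  unfold effectiveNonZigzagNumber
  calc ((2 * (F.card * O.card) : ℕ) : ℕ∞) = 2 * ((F.card * O.card : ℕ) : ℕ∞) := by push_cast; rfl
    _ ≤ _ := by gcongr

end Shape

/-! ### Sign changes and crossings -/

/-- The number of steps of the sequence of partial sums of `l`, starting from `k`, for which the
value before is positive iff `c` holds, and the value after is positive iff `d` holds. -/
def crossings (c d : Bool) : ℤ → List ℤ → ℕ
  | _, [] => 0
  | k, x :: l => (if decide (0 < k) = c ∧ decide (0 < k + x) = d then 1 else 0)
      + crossings c d (k + x) l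

theorem crossings_eq_sum (c d : Bool) (k : ℤ) (l : List ℤ) :
    crossings c d k l = ∑ i ∈ Finset.range l.length,
      if decide (0 < k + ∑ h ∈ Finset.range i, l.getD h 0) = c ∧
        decide (0 < k + ∑ h ∈ Finset.range (i + 1), l.getD h 0) = d then 1 else 0 := by
  induction l generalizing k with
  | nil => simp [crossings]
  | cons x l ih =>
    rw [crossings, ih, List.length_cons, Finset.sum_range_succ', add_comm]
    congr 1
    · refine Finset.sum_congr rfl fun i _ => ?_
      simp only [Finset.sum_range_succ' _ i, Finset.sum_range_succ' _ (i + 1),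
        List.getD_cons_succ, List.getD_cons_zero]
      simp only [add_assoc, add_comm, add_left_comm]
    · simp

theorem signChanges_scanl_cons (k x : ℤ) (l : List ℤ) :
    signChanges ((x :: l).scanl (· + ·) k)
      = (if k * (k + x) < 0 then 1 else 0) + signChanges (l.scanl (· + ·) (k + x)) := by
  cases l <;> simp [signChanges]

/-- Odd partial sums never vanish, so a sign change is a change of positivity. Upward and downward
crossings alternate, and the sign of `k` decides which kind comes first and is rounded up. -/
theorem crossings_eq {k : ℤ} (hk : Odd k) {l : List ℤ} (hl : ∀ x ∈ l, Even x) :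
    if 0 < k then
      crossings true false k l = (signChanges (l.scanl (· + ·) k) + 1) / 2 ∧
      crossings false true k l = signChanges (l.scanl (· + ·) k) / 2
    else
      crossings true false k l = signChanges (l.scanl (· + ·) k) / 2 ∧
      crossings false true k l = (signChanges (l.scanl (· + ·) k) + 1) / 2 := by
  induction l generalizing k with
  | nil => simp [crossings, signChanges]
  | cons x l ih =>
    have hkx : Odd (k + x) := hk.add_even (hl x (by simp))
    have h := ih hkx fun y hy => hl y (by simp [hy])
    rw [signChanges_scanl_cons]
    simp only [crossings]
    have hk0 : k ≠ 0 := by rintro rfl; exact absurd hk (by decide)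
    have hkx0 : k + x ≠ 0 := by intro h; rw [h] at hkx; exact absurd hkx (by decide)
    by_cases h1 : 0 < k <;> by_cases h2 : 0 < k + x
    · have h3 : ¬ k * (k + x) < 0 := by nlinarith
      simp only [h1, h2, h3, if_true, if_false] at h ⊢
      simpa using h
    · have h3 : k * (k + x) < 0 := mul_neg_of_pos_of_neg h1 (by omega)
      simp only [h1, h2, h3, if_true, if_false] at h ⊢
      simp only [decide_true, decide_false, true_and, if_true, Bool.true_eq_false,
        Bool.false_eq_true, false_and, if_false]
      omega
    · have h3 : k * (k + x) < 0 := mul_neg_of_neg_of_pos (by omega) h2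
      simp only [h1, h2, h3, if_true, if_false] at h ⊢
      simp only [decide_true, decide_false, true_and, if_true, Bool.true_eq_false,
        Bool.false_eq_true, false_and, if_false]
      omega
    · have h3 : ¬ k * (k + x) < 0 := by
        have := mul_pos_of_neg_of_neg (show k < 0 by omega) (show k + x < 0 by omega)
        omega
      simp only [h1, h2, h3, if_false] at h ⊢
      simpa using h

/-! ### Shapes from lists of tails -/

theorem sum_getD_eq {M α : Type} [AddCommMonoid M] (G : α → M) (l : List α) (d : α) :
    ∑ i ∈ Finset.range l.length, G (l.getD i d) = (l.map G).sum := by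
  induction l with
  | nil => simp
  | cons x l ih =>
    rw [List.length_cons, Finset.sum_range_succ', List.map_cons, List.sum_cons, ← ih, add_comm]
    simp

theorem sum_ite_eq_countP {α : Type} (p : α → Bool) (l : List α) :
    (l.map fun x => if p x = true then 1 else 0).sum = l.countP p := by
  induction l with
  | nil => simp
  | cons x l ih => rw [List.map_cons, List.sum_cons, ih, List.countP_cons, add_comm]

theorem ite_and_and_eq {p q r : Prop} [Decidable p] [Decidable q] [Decidable r] :
    (if p ∧ q ∧ r then 1 else 0) = if r then (if p ∧ q then 1 else 0) else 0 := by
  split_ifs <;> simp_all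

theorem sum_range_split {M : Type} [AddCommMonoid M] (G : ℕ → M) (a b : ℕ) :
    ∑ j : Fin (a + b + 1), G j = ∑ i ∈ Finset.range a, G i + G a
      + ∑ i ∈ Finset.range b, G (a + 1 + i) := by
  rw [← Finset.sum_range, show a + b + 1 = a + 1 + b by omega, Finset.sum_range_add,
    Finset.sum_range_succ]

/-- The flows of the ends of a list of tails, where `(w, c)` stands for a tail with flow `w`,
which ends in a fork if `c` holds. -/
def tailEnds (l : List (ℤ × Bool)) : Multiset ℤ :=
  (l.map fun s => if s.2 = true then ({s.1 / 2} + {s.1 / 2} : Multiset ℤ) else {s.1}).sum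

/-- The shape with the tails `pre` before and `post` after the vertex of the main string at which the
flow `t` arrives from the chain of side strings. -/
def ofTails (n g : ℕ) (pre post : List (ℤ × Bool)) (a0 t : ℤ)
    (sp : Fin (pre.length + post.length + 1))
    (hsp : ((pre ++ (t, false) :: post).getD sp (0, false)).2 = true) : Shape where
  n := n
  m := pre.length + post.length
  g := g
  δ j := ((pre ++ (t, false) :: post).getD j (0, false)).1
  fork j := ((pre ++ (t, false) :: post).getD j (0, false)).2
  j0 := ⟨pre.length, by omega⟩
  sp := sp
  fork_sp := hsp
  fork_j0 := by simp
  a0 := a0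

section OfTails

variable {n g : ℕ} {pre post : List (ℤ × Bool)} {a0 t : ℤ}

theorem getD_pre {i : ℕ} (hi : i < pre.length) :
    (pre ++ (t, false) :: post).getD i (0, false) = pre.getD i (0, false) :=
  List.getD_append _ _ _ _ hi

theorem getD_mid : (pre ++ (t, false) :: post).getD pre.length (0, false) = (t, false) := by
  simp

theorem getD_post (i : ℕ) :
    (pre ++ (t, false) :: post).getD (pre.length + 1 + i) (0, false) = post.getD i (0, false) := by
  rw [List.getD_append_right _ _ _ _ (by omega), show pre.length + 1 + i - pre.length = i + 1 by omega,
    List.getD_cons_succ]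

theorem sum_tails {M : Type} [AddCommMonoid M] (G : ℤ × Bool → M) :
    ∑ j : Fin (pre.length + post.length + 1), G ((pre ++ (t, false) :: post).getD j (0, false))
      = (pre.map G).sum + G (t, false) + (post.map G).sum := by
  rw [sum_range_split (fun j => G ((pre ++ (t, false) :: post).getD j (0, false))), getD_mid,
    ← sum_getD_eq G pre (0, false), ← sum_getD_eq G post (0, false)]
  simp only [getD_post]
  congr 2
  exact Finset.sum_congr rfl fun i hi => by rw [getD_pre (Finset.mem_range.1 hi)]

theorem sum_tails_pre {M : Type} [AddCommMonoid M] (G : ℤ × Bool → M) :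
    (∑ j : Fin (pre.length + post.length + 1), if j.1 < pre.length then
      G ((pre ++ (t, false) :: post).getD j (0, false)) else 0) = (pre.map G).sum := by
  rw [sum_range_split (fun j => if j < pre.length then
      G ((pre ++ (t, false) :: post).getD j (0, false)) else 0), ← sum_getD_eq G pre (0, false),
    if_neg (lt_irrefl _), Finset.sum_eq_zero (s := Finset.range post.length), add_zero, add_zero]
  · exact Finset.sum_congr rfl fun i hi => by
      rw [if_pos (Finset.mem_range.1 hi), getD_pre (Finset.mem_range.1 hi)]
  · intro i _
    rw [if_neg (by omega)]

theorem sum_tails_post {M : Type} [AddCommMonoid M] (G : ℕ → M) :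
    (∑ j : Fin (pre.length + post.length + 1), if pre.length < j.1 then G j else 0)
      = ∑ i ∈ Finset.range post.length, G (pre.length + 1 + i) := by
  rw [sum_range_split (fun j => if pre.length < j then G j else 0), if_neg (lt_irrefl _),
    Finset.sum_eq_zero (s := Finset.range pre.length), add_zero, zero_add]
  · exact Finset.sum_congr rfl fun i _ => if_pos (by omega)
  · intro i hi
    rw [if_neg (by simp at hi; omega)]

variable {sp : Fin (pre.length + post.length + 1)}
  {hsp : ((pre ++ (t, false) :: post).getD sp (0, false)).2 = true}

theorem val_pre {j : ℕ} (hj : j ≤ pre.length) : (ofTails n g pre post a0 t sp hsp).val j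
    = a0 + ∑ i ∈ Finset.range j, (pre.getD i (0, false)).1 := by
  unfold Shape.val ofTails
  congr 1
  refine Finset.sum_congr rfl fun i hi => ?_
  have := Finset.mem_range.1 hi
  exact congrArg Prod.fst (getD_pre (by omega))

theorem val_post (j : ℕ) : (ofTails n g pre post a0 t sp hsp).val (pre.length + 1 + j)
    = a0 + (pre.map Prod.fst).sum + t + ∑ i ∈ Finset.range j, (post.getD i (0, false)).1 := by
  unfold Shape.val ofTails
  simp only [add_assoc]
  congr 1
  rw [← add_assoc pre.length, Finset.sum_range_add, Finset.sum_range_succ, getD_mid]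
  simp only [getD_post]
  rw [add_assoc]
  congr 1
  rw [← sum_getD_eq Prod.fst pre (0, false)]
  exact Finset.sum_congr rfl fun i hi => by rw [getD_pre (Finset.mem_range.1 hi)]

/-- The sign pattern of the flow at a vertex behind the junction is that of one step of the sequence
of partial sums. In particular minima are upward crossings and maxima are downward crossings. -/
theorem length_postIdx (c d : Bool) : ((ofTails n g pre post a0 t sp hsp).postIdx c d).length
    = crossings c d (a0 + (pre.map Prod.fst).sum + t) (post.map Prod.fst) := by
  set S := ofTails n g pre post a0 t sp hsp with hS
  have h1 : (S.postIdx c d).length = (Finset.univ.filter fun j : Fin (S.m + 1) =>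
      S.j0 < j ∧ decide (0 < S.val j) = c ∧ decide (0 < S.val (j + 1)) = d).card := by
    rw [← List.toFinset_card_of_nodup Shape.nodup_postIdx]
    congr 1
    ext j
    simp [Shape.mem_postIdx]
  rw [h1, Finset.card_filter, crossings_eq_sum, List.length_map]
  simp only [ite_and (S.j0 < _)]
  refine (sum_tails_post (pre := pre) (post := post) fun j =>
    if decide (0 < S.val j) = c ∧ decide (0 < S.val (j + 1)) = d then 1 else 0).trans ?_
  refine Finset.sum_congr rfl fun i _ => ?_
  have h2 : ∀ h, (post.map Prod.fst).getD h 0 = (post.getD h (0, false)).1 := fun h => by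
    have := List.getD_map (l := post) (n := h) (d := (0, false)) Prod.fst
    exact this
  simp only [h2]
  rw [add_assoc (pre.length + 1), val_post, val_post]

theorem card_fork_filter (S : Shape) (p : Fin (S.m + 1) → Prop) [DecidablePred p] :
    (Finset.univ.filter fun j : S.Fk => p j.1).card
      = ∑ j : Fin (S.m + 1), if S.fork j = true ∧ p j then 1 else 0 := by
  rw [← Finset.card_filter, ← Finset.card_image_of_injective _ Subtype.val_injective]
  congr 1
  ext j
  simp only [Finset.mem_image, Finset.mem_filter, Finset.mem_univ, true_and]
  constructor
  · rintro ⟨k, hk, rfl⟩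
    exact ⟨k.2, hk⟩
  · rintro ⟨h1, h2⟩
    exact ⟨⟨j, h1⟩, h2, rfl⟩

theorem card_fork_filter_ofTails (p : ℤ → Bool) :
    (Finset.univ.filter fun j : (ofTails n g pre post a0 t sp hsp).Fk =>
      p ((ofTails n g pre post a0 t sp hsp).δ j.1) = true).card
    = pre.countP (fun s => s.2 && p s.1) + post.countP (fun s => s.2 && p s.1) := by
  rw [card_fork_filter (ofTails n g pre post a0 t sp hsp) 
    (fun j => p ((ofTails n g pre post a0 t sp hsp).δ j) = true),
    ← sum_ite_eq_countP, ← sum_ite_eq_countP]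
  simp only [Bool.and_eq_true]
  refine (sum_tails (t := t) fun s => if s.2 = true ∧ p s.1 = true then 1 else 0).trans ?_
  simp

theorem card_fork_filter_pre (p : ℤ → Bool) :
    (Finset.univ.filter fun j : (ofTails n g pre post a0 t sp hsp).Fk =>
      p ((ofTails n g pre post a0 t sp hsp).δ j.1) = true ∧
        j.1 < (ofTails n g pre post a0 t sp hsp).j0).card
    = pre.countP (fun s => s.2 && p s.1) := by
  rw [card_fork_filter (ofTails n g pre post a0 t sp hsp) 
    (fun j => p ((ofTails n g pre post a0 t sp hsp).δ j) = true ∧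
      j < (ofTails n g pre post a0 t sp hsp).j0),
    ← sum_ite_eq_countP]
  simp only [Bool.and_eq_true]
  rw [← sum_tails_pre (t := t) (post := post) fun s => if s.2 = true ∧ p s.1 = true then 1 else 0]
  refine Finset.sum_congr rfl fun j _ => ?_
  exact ite_and_and_eq

theorem card_fork_filter_post (p : ℤ → Bool) :
    (Finset.univ.filter fun j : (ofTails n g pre post a0 t sp hsp).Fk =>
      p ((ofTails n g pre post a0 t sp hsp).δ j.1) = true ∧
        (ofTails n g pre post a0 t sp hsp).j0 < j.1).card
    = post.countP (fun s => s.2 && p s.1) := by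
  rw [card_fork_filter (ofTails n g pre post a0 t sp hsp) 
    (fun j => p ((ofTails n g pre post a0 t sp hsp).δ j) = true ∧
      (ofTails n g pre post a0 t sp hsp).j0 < j),
    ← sum_ite_eq_countP, ← sum_getD_eq _ post (0, false)]
  simp only [Bool.and_eq_true]
  have := sum_tails_post (pre := pre) (post := post) fun j =>
    if ((pre ++ (t, false) :: post).getD j (0, false)).2 = true ∧
      p ((pre ++ (t, false) :: post).getD j (0, false)).1 = true then 1 else 0
  simp only [getD_post] at this
  rw [← this]
  refine Finset.sum_congr rfl fun j _ => ?_
  exact ite_and_and_eq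

theorem map_flowL (A B : Fin (n + 1) → ℤ) :
    Finset.univ.val.map ((ofTails n g pre post a0 t sp hsp).flowL A B)
      = {a0} + {-(a0 + (pre.map Prod.fst).sum + t + (post.map Prod.fst).sum)}
        + Finset.univ.val.map A + Finset.univ.val.map (fun i => -B i)
        + tailEnds pre + tailEnds post := by
  set S := ofTails n g pre post a0 t sp hsp with hS
  have hmap : ∀ {α : Type} [Fintype α] (f : α → ℤ),
      Finset.univ.val.map f = ∑ x, ({f x} : Multiset ℤ) := fun f => by
    have := Multiset.sum_map_singleton (Finset.univ.val.map f)
    rw [Multiset.map_map] at this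
    exact this.symm
  have hlast : S.val (S.m + 1)
      = a0 + (pre.map Prod.fst).sum + t + (post.map Prod.fst).sum := by
    have := val_post (n := n) (g := g) (a0 := a0) (hsp := hsp) post.length
    rw [sum_getD_eq Prod.fst post (0, false)] at this
    rw [← this]
    congr 1
    change pre.length + post.length + 1 = _
    omega
  rw [hmap, ← Equiv.sum_comp Shape.enEquiv]
  simp only [Fintype.sum_sum_type, Fintype.sum_prod_type, Fintype.sum_bool, Finset.univ_unique,
    Finset.sum_singleton, hmap]
  set G : ℤ × Bool → Multiset ℤ := fun s =>
    if s.2 = true then ({s.1 / 2} + {s.1 / 2} : Multiset ℤ) else {s.1} with hG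
  -- Single ends and forks divide the main vertices among themselves except for the junction, which
  -- carries no end; so both sums merge into one over all positions.
  have hT : (∑ j : S.Sg, ({S.δ j.1} : Multiset ℤ))
      + ∑ j : S.Fk, ({S.δ j.1 / 2} + {S.δ j.1 / 2} : Multiset ℤ) = tailEnds pre + tailEnds post := by
    have h1 := Finset.sum_subtype (Finset.univ.filter fun j => j ≠ S.j0 ∧ S.fork j = false)
      (p := fun j => j ≠ S.j0 ∧ S.fork j = false) (F := inferInstanceAs (Fintype S.Sg)) (by simp) fun j => ({S.δ j} : Multiset ℤ)
    have h2 := Finset.sum_subtype (Finset.univ.filter fun j : Fin (S.m + 1) => S.fork j = true)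
      (p := fun j : Fin (S.m + 1) => S.fork j = true) (F := inferInstanceAs (Fintype S.Fk)) (by simp)
      fun j => ({S.δ j / 2} + {S.δ j / 2} : Multiset ℤ)
    rw [← h1, ← h2, Finset.sum_filter, Finset.sum_filter, ← Finset.sum_add_distrib, tailEnds,
      tailEnds, ← sum_tails_pre (t := t) (post := post) G, ← sum_getD_eq G post (0, false)]
    have h3 := sum_tails_post (pre := pre) (post := post) fun j =>
      G ((pre ++ (t, false) :: post).getD j (0, false))
    simp only [getD_post] at h3
    rw [← h3, ← Finset.sum_add_distrib]
    refine Finset.sum_congr rfl fun j _ => ?_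
    have hj0 : S.j0.val = pre.length := rfl
    have hst : G ((pre ++ (t, false) :: post).getD j (0, false))
        = if S.fork j = true then ({S.δ j / 2} + {S.δ j / 2} : Multiset ℤ) else {S.δ j} := rfl
    rw [hst]
    rcases lt_trichotomy j.val pre.length with h | h | h
    · have hne : j ≠ S.j0 := fun h' => by rw [h'] at h; omega
      rw [if_pos h, if_neg h.asymm]
      cases hf : S.fork j <;> simp [hne]
    · have he : j = S.j0 := Fin.ext h
      have hf : S.fork j = false := he ▸ S.fork_j0
      rw [if_neg h.not_lt, if_neg h.symm.not_lt, hf]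
      simp [he]
    · have hne : j ≠ S.j0 := fun h' => by rw [h'] at h; omega
      rw [if_neg h.asymm, if_pos h]
      cases hf : S.fork j <;> simp [hne]
  rw [add_assoc _ (tailEnds pre), ← hT]
  simp only [add_assoc]
  congr 1
  change ({-S.val (S.m + 1)} : Multiset ℤ) + _ = _
  rw [hlast]
  simp only [add_assoc]
  rfl

end OfTails

/-! ### The main bound -/

theorem getD_mem_or {α : Type} (l : List α) (i : ℕ) (d : α) : l.getD i d ∈ l ∨ l.getD i d = d := by
  rcases lt_or_ge i l.length with h | h
  · rw [List.getD_eq_getElem _ _ h]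
    exact .inl (List.getElem_mem h)
  · exact .inr (List.getD_eq_default _ _ h)

/-- The conditions on the flows of the tails: those before the chain of side strings are positive,
all flows are even and nonzero, and half the flow of a tail with a fork is odd. -/
structure TailsOK (pre post : List (ℤ × Bool)) : Prop where
  pos : ∀ s ∈ pre, 0 < s.1
  even : ∀ s ∈ pre ++ post, Even s.1
  ne_zero : ∀ s ∈ pre ++ post, s.1 ≠ 0
  fork_odd : ∀ s ∈ pre ++ post, s.2 = true → Odd (s.1 / 2)
  exists_fork : ∃ s ∈ post, s.2 = true ∧ s.1 < 0

/-- The number of forks with positive flow. -/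
def leftForks (l : List (ℤ × Bool)) : ℕ := l.countP fun s => s.2 && decide (0 < s.1)

/-- The number of forks with negative flow. -/
def rightForks (l : List (ℤ × Bool)) : ℕ := l.countP fun s => s.2 && decide (s.1 < 0)

section

variable {n g : ℕ} {pre post : List (ℤ × Bool)} {a0 t : ℤ}

theorem sum_getD_pre_nonneg (hT : TailsOK pre post) (j : ℕ) :
    0 ≤ ∑ i ∈ Finset.range j, (pre.getD i (0, false)).1 := by
  refine Finset.sum_nonneg fun i _ => ?_
  rcases getD_mem_or pre i (0, false) with h | h
  · exact (hT.pos _ h).le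
  · rw [h]

variable {sp : Fin (pre.length + post.length + 1)}
  {hsp : ((pre ++ (t, false) :: post).getD sp (0, false)).2 = true}

theorem ofTails_mainOK (hT : TailsOK pre post) (ha0 : Odd a0) (ha : 0 < a0) (ht : Even t)
    (hk : 0 < a0 + (pre.map Prod.fst).sum + t)
    (hsp' : ((pre ++ (t, false) :: post).getD sp (0, false)).1 < 0) :
    (ofTails n g pre post a0 t sp hsp).MainOK where
  a0_odd := ha0
  val_pos j hj := by
    change j ≤ pre.length + 1 at hj
    rcases Nat.le_succ_iff.1 hj with hj | rfl
    · rw [val_pre hj]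
      have := sum_getD_pre_nonneg hT j
      omega
    · have := val_post (n := n) (g := g) (a0 := a0) (hsp := hsp) 0
      simp only [Finset.range_zero, Finset.sum_empty, add_zero] at this
      exact this ▸ hk
  δ_sp := hsp'
  even j := by
    change Even ((pre ++ (t, false) :: post).getD j (0, false)).1
    rcases getD_mem_or (pre ++ (t, false) :: post) j (0, false) with h | h
    · rw [List.mem_append, List.mem_cons] at h
      rcases h with h | h | h
      · exact hT.even _ (List.mem_append_left _ h)
      · rw [h]; exact ht
      · exact hT.even _ (List.mem_append_right _ h)
    · rw [h]; exact Even.zero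
  δ_ne := by
    rintro ⟨j, hj, -⟩
    change ((pre ++ (t, false) :: post).getD j (0, false)).1 ≠ 0
    change j ≠ ⟨pre.length, _⟩ at hj
    have hj' : j.val ≠ pre.length := fun h => hj (Fin.ext h)
    have hlt : j.val < pre.length + post.length + 1 := j.2
    apply hT.ne_zero
    rcases Nat.lt_or_gt_of_ne hj' with h | h
    · rw [getD_pre h, List.getD_eq_getElem _ _ h]
      exact List.mem_append_left _ (List.getElem_mem h)
    · obtain ⟨i, hi⟩ := Nat.exists_eq_add_of_le (show pre.length + 1 ≤ j.val from h)
      rw [hi, getD_post, List.getD_eq_getElem _ _ (by omega)]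
      exact List.mem_append_right _ (List.getElem_mem _)
  fork_odd := by
    rintro ⟨j, hj⟩
    change ((pre ++ (t, false) :: post).getD j (0, false)).2 = true at hj
    change Odd (((pre ++ (t, false) :: post).getD j (0, false)).1 / 2)
    rcases getD_mem_or (pre ++ (t, false) :: post) j (0, false) with h | h
    · rw [List.mem_append, List.mem_cons] at h
      rcases h with h | h | h
      · exact hT.fork_odd _ (List.mem_append_left _ h) hj
      · rw [h] at hj; cases hj
      · exact hT.fork_odd _ (List.mem_append_right _ h) hj
    · rw [h] at hj; cases hj

/-- The lower bound for a given choice of the flows of the strings and of the tails. -/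
theorem boundsEffectiveNumber_of_tails {lam mu : Multiset ℕ} {b : Bool} (A B : Fin (n + 1) → ℤ)
    (hinj : Function.Injective fun i => (A i, B i))
    (hA : ∀ i, Odd (A i)) (hB : ∀ i, Odd (B i)) (hA0 : ∀ i, if b then 0 < A i else A i < 0)
    (hB0 : ∀ i, if b then 0 < B i else B i < 0) (hAB : ∑ i, (A i - B i) = t)
    (ht : if b then 0 < t else t < 0) (hT : TailsOK pre post) (ha0 : Odd a0) (ha : 0 < a0)
    (hk : 0 < a0 + (pre.map Prod.fst).sum + t) (hmu : ∀ n ∈ mu, 0 < n)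
    (hends : {a0} + {-(a0 + (pre.map Prod.fst).sum + t + (post.map Prod.fst).sum)}
        + Finset.univ.val.map A + Finset.univ.val.map (fun i => -B i)
        + tailEnds pre + tailEnds post
      = lam.map (fun n : ℕ => (n : ℤ)) + mu.map (fun n : ℕ => -(n : ℤ)))
    (hroom : pre.length + 2 * (n + 1) + (leftForks pre + leftForks post)
      ≤ (branchCount g lam mu + 1) / 2) :
    BoundsEffectiveNumber g lam mu (2 * (n.factorial * (
      (signChanges ((post.map Prod.fst).scanl (· + ·) (a0 + (pre.map Prod.fst).sum + t)) / 2).factorial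
      * ((signChanges ((post.map Prod.fst).scanl (· + ·) (a0 + (pre.map Prod.fst).sum + t)) + 1)
        / 2).factorial
      * ((∏ i ∈ Finset.range (rightForks post), (2 * i + 1))
        * ((∏ i ∈ Finset.range (leftForks post), (2 * (n + 1) + 2 * i + 1))
          * ∏ i ∈ Finset.range (leftForks pre), (2 * i + 1)))))) := by
  -- One of the tails behind the junction that end in a fork over +∞ becomes the special tail with
  -- the g cycles.
  obtain ⟨s, hs, hs2, hs1⟩ := hT.exists_fork
  obtain ⟨i, hi, rfl⟩ := List.getElem_of_mem hs
  have hst : (pre ++ (t, false) :: post).getD (pre.length + 1 + i) (0, false) = post[i] := by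
    rw [getD_post, List.getD_eq_getElem _ _ hi]
  set sp : Fin (pre.length + post.length + 1) := ⟨pre.length + 1 + i, by omega⟩ with hsp_def
  have hsp : ((pre ++ (t, false) :: post).getD sp (0, false)).2 = true := by
    change ((pre ++ (t, false) :: post).getD (pre.length + 1 + i) (0, false)).2 = true
    rw [hst]; exact hs2
  have hsp' : ((pre ++ (t, false) :: post).getD sp (0, false)).1 < 0 := by
    change ((pre ++ (t, false) :: post).getD (pre.length + 1 + i) (0, false)).1 < 0
    rw [hst]; exact hs1
  have hteven : Even t := hAB ▸ Finset.even_sum _ fun i _ => (hA i).sub_odd (hB i)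
  set S := ofTails n g pre post a0 t sp hsp with hS
  have hM : S.MainOK := ofTails_mainOK hT ha0 ha hteven hk hsp'
  have hpre : ∀ j < S.j0, 0 < S.δ j := by
    intro j hj
    have hj' : j.val < pre.length := hj
    change 0 < ((pre ++ (t, false) :: post).getD j (0, false)).1
    rw [getD_pre hj', List.getD_eq_getElem _ _ hj']
    exact hT.pos _ (List.getElem_mem _)
  have kodd : Odd (a0 + (pre.map Prod.fst).sum + t) := by
    refine (ha0.add_even ?_).add_even hteven
    refine List.sum_induction Even (fun _ _ h h' => h.add h') Even.zero ?_
    intro x hx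
    obtain ⟨s, hs, rfl⟩ := List.mem_map.1 hx
    exact hT.even _ (List.mem_append_left _ hs)
  have hcross := crossings_eq kodd (l := post.map Prod.fst) (by
    intro x hx
    obtain ⟨s, hs, rfl⟩ := List.mem_map.1 hx
    exact hT.even _ (List.mem_append_right _ hs))
  rw [if_pos hk] at hcross
  -- The sign makes the total positive for either direction of the chain, as the cycle lemma
  -- requires.
  set d : Fin (n + 1) → ℤ := fun i => (if b then 1 else -1) * (A i - B i) with hd
  have hdpos : 0 < ∑ i, d i := by
    rw [hd, ← Finset.mul_sum, hAB]
    cases b <;> simp at ht ⊢ <;> exact ht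
  classical
  set F : Finset ((Fin (S.n + 1) → ℤ) × (Fin (S.n + 1) → ℤ)) :=
    (positivePerms d).image fun σ => (fun i => A (σ i), fun i => B (σ i)) with hF
  have hFcard : n.factorial ≤ F.card := by
    rw [hF, Finset.card_image_of_injective]
    · exact factorial_le_card_positivePerms d hdpos
    · intro σ τ h
      ext i
      have h1 := congrFun (congrArg Prod.fst h) i
      have h2 := congrFun (congrArg Prod.snd h) i
      exact congrArg Fin.val (hinj (Prod.ext h1 h2))
  have hFok : ∀ q ∈ F, S.SideOK b q.1 q.2 := by
    intro q hq
    obtain ⟨σ, hσ, rfl⟩ := Finset.mem_image.1 hq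
    refine ⟨fun i => hA _, fun i => hB _, fun i => hA0 _, fun i => hB0 _, fun i => ?_, ?_⟩
    · have h1 := (Finset.mem_filter.1 hσ).2 i
      rw [hd, ← Finset.mul_sum] at h1
      change if b = true then 0 < Shape.conFlow (S := S) _ _ i else Shape.conFlow (S := S) _ _ i < 0
      unfold Shape.conFlow
      cases b <;> simp at h1 ⊢ <;> exact h1
    · have h1 : S.δ S.j0 = t := congrArg Prod.fst getD_mid
      rw [h1, ← hAB, ← Equiv.sum_comp σ]
      unfold Shape.conFlow
      refine Finset.sum_congr ?_ fun _ _ => rfl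
      ext j
      exact iff_of_true (Finset.mem_filter.2 ⟨Finset.mem_univ _, Fin.le_last _⟩)
        (Finset.mem_univ _)
  have hFends : ∀ q ∈ F, Finset.univ.val.map (S.flowL q.1 q.2)
      = lam.map (fun n : ℕ => (n : ℤ)) + mu.map (fun n : ℕ => -(n : ℤ)) := by
    intro q hq
    obtain ⟨σ, hσ, rfl⟩ := Finset.mem_image.1 hq
    have hperm : ∀ f : Fin (n + 1) → ℤ, Finset.univ.val.map (fun i => f (σ i))
        = Finset.univ.val.map f := by
      intro f
      have : (Finset.univ : Finset (Fin (n + 1))).val.map σ = Finset.univ.val := by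
        simp
      conv_rhs => rw [← this, Multiset.map_map]
      rfl
    rw [← hends, ← hperm A, ← hperm fun i => -B i]
    exact map_flowL _ _
  have hcard : Fintype.card S.Vx = branchCount g lam mu := by
    obtain ⟨q, hq⟩ : F.Nonempty := Finset.card_pos.1 ((Nat.factorial_pos n).trans_le hFcard)
    exact Shape.card_vx_eq_branchCount (hFends q hq)
  have hc1 : (Finset.univ.filter fun j : S.Fk => 0 < S.δ j.1).card
      = leftForks pre + leftForks post := by
    have := card_fork_filter_ofTails (hsp := hsp) (n := n) (g := g) (a0 := a0)
      (fun x => decide (0 < x))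
    simp only [decide_eq_true_eq] at this
    exact this
  have hc2 : (Finset.univ.filter fun j : S.Fk => S.δ j.1 < 0).card = rightForks post := by
    have := card_fork_filter_ofTails (hsp := hsp) (n := n) (g := g) (a0 := a0)
      (fun x => decide (x < 0))
    simp only [decide_eq_true_eq] at this
    refine this.trans ?_
    rw [List.countP_eq_zero.2, zero_add]
    · rfl
    · intro s hs
      simp [(hT.pos s hs).le]
  have hc3 : (Finset.univ.filter fun j : S.Fk => 0 < S.δ j.1 ∧ S.j0 < j.1).card
      = leftForks post := by
    have := card_fork_filter_post (hsp := hsp) (n := n) (g := g) (a0 := a0)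
      (fun x => decide (0 < x))
    simp only [decide_eq_true_eq] at this
    exact this
  have hc4 : (Finset.univ.filter fun j : S.Fk => 0 < S.δ j.1 ∧ j.1 < S.j0).card
      = leftForks pre := by
    have := card_fork_filter_pre (hsp := hsp) (n := n) (g := g) (a0 := a0)
      (fun x => decide (0 < x))
    simp only [decide_eq_true_eq] at this
    exact this
  obtain ⟨O, hO, hOcard⟩ := Shape.exists_orders hM hpre (by
    rw [hc1, hcard]
    exact hroom) b
  rw [hc2, hc3, hc4, length_postIdx, length_postIdx, hcross.1, hcross.2] at hOcard
  have hfin := Shape.boundsEffectiveNumber hM F hFok hmu hFends O hO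
  intro x hx
  refine le_trans ?_ (hfin x hx)
  exact_mod_cast Nat.mul_le_mul_left 2 (Nat.mul_le_mul hFcard hOcard)

end

/-! ### The main bound for multisets of flows -/

theorem BoundsEffectiveNumber.mono {g : ℕ} {lam mu : Multiset ℕ} {M N : ℕ}
    (h : BoundsEffectiveNumber g lam mu N) (hMN : M ≤ N) : BoundsEffectiveNumber g lam mu M :=
  fun x hx => le_trans (by exact_mod_cast hMN) (h x hx)

/-- Lifts an optimal sequence of steps, in which fork and single end are indistinguishable, to an
order of the actual tails. -/
theorem exists_list_of_map_eq {α β : Type} (f : α → β) (M : Multiset α) (l : List β)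
    (h : M.map f = l) : ∃ L : List α, (L : Multiset α) = M ∧ L.map f = l := by
  induction l generalizing M with
  | nil =>
    rw [Multiset.coe_nil, Multiset.map_eq_zero] at h
    exact ⟨[], by simp [h], rfl⟩
  | cons x l ih =>
    have hx : x ∈ M.map f := by rw [h]; simp
    obtain ⟨s, hs, rfl⟩ := Multiset.mem_map.1 hx
    obtain ⟨M', rfl⟩ := Multiset.exists_cons_of_mem hs
    rw [Multiset.map_cons, ← Multiset.cons_coe, Multiset.cons_inj_right] at h
    obtain ⟨L, rfl, rfl⟩ := ih M' h
    exact ⟨s :: L, rfl, rfl⟩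

theorem exists_fun_of_card_eq {α : Type} (M : Multiset α) {n : ℕ} (h : M.card = n) :
    ∃ a : Fin n → α, Finset.univ.val.map a = M := by
  induction M using Quotient.inductionOn with
  | h l =>
    change l.length = n at h
    subst h
    refine ⟨l.get, ?_⟩
    rw [Fin.univ_val_map, List.ofFn_get]
    rfl

/-- The tails `w ∈ X` given by single ends of weight `2 w` and `w ∈ P` given by forks with two ends
of weight `w`, the flows being multiplied by the sign `s`. -/
def tailSteps (s : ℤ) (X P : Multiset ℕ) : Multiset (ℤ × Bool) :=
  X.map (fun w : ℕ => (s * (2 * w), false)) + P.map (fun w : ℕ => (s * (2 * w), true))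

theorem mem_tailSteps {s : ℤ} {X P : Multiset ℕ} {q : ℤ × Bool} : q ∈ tailSteps s X P ↔
    (∃ w ∈ X, q = (s * (2 * w), false)) ∨ ∃ w ∈ P, q = (s * (2 * w), true) := by
  simp only [tailSteps, Multiset.mem_add, Multiset.mem_map, eq_comm]

theorem map_fst_tailSteps (s : ℤ) (X P : Multiset ℕ) :
    (tailSteps s X P).map Prod.fst = (twice (X + P)).map fun n : ℕ => s * n := by
  simp [tailSteps, twice]

theorem sum_twice (X : Multiset ℕ) : (twice X).sum = 2 * X.sum := by
  rw [twice, Multiset.sum_map_mul_left, Multiset.map_id']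

theorem sum_tailSteps (s : ℤ) (X P : Multiset ℕ) :
    ((tailSteps s X P).map Prod.fst).sum = s * (2 * (X.sum + P.sum)) := by
  rw [map_fst_tailSteps, Multiset.sum_map_mul_left, ← Nat.cast_multiset_sum, sum_twice,
    Multiset.sum_add, Nat.cast_mul, Nat.cast_add, Nat.cast_ofNat]

theorem card_tailSteps (s : ℤ) (X P : Multiset ℕ) :
    (tailSteps s X P).card = X.card + P.card := by
  simp [tailSteps]

theorem countP_tailSteps (s : ℤ) (X P : Multiset ℕ) (p : ℤ → Bool) (c : Bool)
    (h : ∀ w ∈ P, p (s * (2 * w)) = c) :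
    (tailSteps s X P).countP (fun q => (q.2 && p q.1) = true) = if c = true then P.card else 0 := by
  rw [tailSteps, Multiset.countP_add, Multiset.countP_map, Multiset.countP_map]
  have h1 : X.filter (fun w : ℕ => (false && p (s * (2 * w))) = true) = 0 :=
    Multiset.filter_eq_nil.2 fun w _ => by simp
  have h2 : P.filter (fun w : ℕ => (true && p (s * (2 * w))) = true)
      = if c = true then P else 0 := by
    cases c
    · exact Multiset.filter_eq_nil.2 fun w hw => by simp [h w hw]
    · exact Multiset.filter_eq_self.2 fun w hw => by simp [h w hw]
  simp only [h1, h2]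
  split_ifs <;> simp

/-- The flows of the ends of a multiset of tails. -/
def endsOf (M : Multiset (ℤ × Bool)) : Multiset ℤ :=
  (M.map fun s => if s.2 = true then ({s.1 / 2} + {s.1 / 2} : Multiset ℤ) else {s.1}).sum

theorem tailEnds_eq (l : List (ℤ × Bool)) : tailEnds l = endsOf l := by
  simp [tailEnds, endsOf]

theorem endsOf_add (M M' : Multiset (ℤ × Bool)) : endsOf (M + M') = endsOf M + endsOf M' := by
  simp [endsOf]

theorem endsOf_tailSteps (s : ℤ) (X P : Multiset ℕ) :
    endsOf (tailSteps s X P) = (twice X + P + P).map fun n : ℕ => s * n := by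
  have h : ∀ w : ℕ, s * (2 * w) / 2 = s * w := fun w => by
    rw [mul_left_comm]; exact Int.mul_ediv_cancel_left _ two_ne_zero
  have hs : ∀ (M : Multiset ℕ) (f : ℕ → ℤ), (M.map fun w => ({f w} : Multiset ℤ)).sum = M.map f := by
    intro M f
    have := Multiset.sum_map_singleton (M.map f)
    rwa [Multiset.map_map] at this
  simp only [endsOf, tailSteps, Multiset.map_add, Multiset.map_map, Multiset.sum_add,
    Function.comp_def, Bool.false_eq_true, if_false, if_true, h, twice, Multiset.sum_map_add, hs,
    add_assoc]
  simp

theorem leftForks_eq (l : List (ℤ × Bool)) :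
    leftForks l = (l : Multiset (ℤ × Bool)).countP fun q => (q.2 && decide (0 < q.1)) = true :=
  by simp [leftForks]

theorem rightForks_eq (l : List (ℤ × Bool)) :
    rightForks l = (l : Multiset (ℤ × Bool)).countP fun q => (q.2 && decide (q.1 < 0)) = true :=
  by simp [rightForks]

theorem sum_cast_univ {n : ℕ} (a : Fin n → ℕ) :
    ∑ i, (a i : ℤ) = ((Finset.univ.val.map a).sum : ℕ) := by
  rw [← Finset.sum, Nat.cast_sum]

/-- The lower bound for a choice of the weights of the ends of the side strings (`Ma`, `Mb`), of the
main string (`a0`, `eL`, `eR`), and of the tails before and after the chain of the strings. -/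
theorem boundsEffectiveNumber_of_multisets {g : ℕ} {lam mu : Multiset ℕ} (hsum : lam.sum = mu.sum)
    (hlam0 : ∀ w ∈ lam, 0 < w) (hmu0 : ∀ w ∈ mu, 0 < w)
    {Ma Mb eL eR X₁ P₁ X₂ P₂ X₃ P₃ : Multiset ℕ} {a0 c : ℕ}
    (hlam : lam = {a0} + eL + Ma + twice (X₁ + X₂) + (P₁ + P₂) + (P₁ + P₂))
    (hmu : mu = eR + Mb + twice X₃ + P₃ + P₃)
    (he : (eL = {c} ∧ eR = 0) ∨ (eL = 0 ∧ eR = {c})) (hcard : Ma.card = Mb.card)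
    (hnd : Ma.Nodup ∨ Mb.Nodup) (ha0 : Odd a0) (hMa : ∀ w ∈ Ma, Odd w) (hMb : ∀ w ∈ Mb, Odd w)
    (hP₁ : ∀ w ∈ P₁, Odd w) (hP₂ : ∀ w ∈ P₂, Odd w) (hP₃ : ∀ w ∈ P₃, Odd w) (hP₃' : P₃ ≠ 0)
    (ht : (Ma.sum : ℤ) - Mb.sum ≠ 0) {k : ℤ}
    (hk : k = a0 + 2 * (X₁.sum + P₁.sum) + (Ma.sum - Mb.sum)) (hk0 : 0 < k)
    (hroom : X₁.card + P₁.card + 2 * Ma.card + (P₁.card + P₂.card)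
      ≤ (branchCount g lam mu + 1) / 2) :
    BoundsEffectiveNumber g lam mu (2 * ((Ma.card - 1).factorial * (
      (maxSignChanges k (twice (X₂ + P₂)) (twice (X₃ + P₃)) / 2).factorial
      * ((maxSignChanges k (twice (X₂ + P₂)) (twice (X₃ + P₃)) + 1) / 2).factorial
      * ((∏ i ∈ Finset.range P₃.card, (2 * i + 1))
        * ((∏ i ∈ Finset.range P₂.card, (2 * Ma.card + 2 * i + 1))
          * ∏ i ∈ Finset.range P₁.card, (2 * i + 1)))))) := by
  -- Without side strings the flow t would be zero.
  obtain ⟨n, hn⟩ : ∃ n, Ma.card = n + 1 := by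
    refine Nat.exists_eq_succ_of_ne_zero fun h => ht ?_
    rw [h, eq_comm, Multiset.card_eq_zero] at hcard
    rw [Multiset.card_eq_zero.1 h, hcard, sub_self]
  obtain ⟨a, ha⟩ := exists_fun_of_card_eq Ma hn
  obtain ⟨b, hb⟩ := exists_fun_of_card_eq Mb (hcard.symm.trans hn)
  have ha1 : ∀ i, a i ∈ Ma := fun i => ha ▸ Multiset.mem_map_of_mem _ (Finset.mem_univ_val i)
  have hb1 : ∀ i, b i ∈ Mb := fun i => hb ▸ Multiset.mem_map_of_mem _ (Finset.mem_univ_val i)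
  -- The pairs of weights are distinct as soon as one coordinate has no repetition; then different
  -- permutations give different flows.
  have hinj : Function.Injective fun i => (a i, b i) := by
    rcases hnd with h | h
    · rw [← ha, Multiset.nodup_map_iff_inj_on Finset.univ.nodup] at h
      intro i j hij
      exact h i (Finset.mem_univ_val i) j (Finset.mem_univ_val j) (congrArg Prod.fst hij)
    · rw [← hb, Multiset.nodup_map_iff_inj_on Finset.univ.nodup] at h
      intro i j hij
      exact h i (Finset.mem_univ_val i) j (Finset.mem_univ_val j) (congrArg Prod.snd hij)
  -- An order of the steps attaining the maximal number of sign changes.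
  obtain ⟨l, hl, hmax⟩ := Finset.exists_mem_eq_sup (Multiset.lists
    ((twice (X₂ + P₂)).map (fun n : ℕ => (n : ℤ)) + (twice (X₃ + P₃)).map
      (fun n : ℕ => -(n : ℤ)))).toFinset
    (by
      obtain ⟨l, hl⟩ := Quotient.exists_rep ((twice (X₂ + P₂)).map (fun n : ℕ => (n : ℤ))
        + (twice (X₃ + P₃)).map (fun n : ℕ => -(n : ℤ)))
      exact ⟨l, Multiset.mem_toFinset.2 (Multiset.mem_lists_iff _ _ |>.2 hl.symm)⟩)
    (fun steps => signChanges (steps.scanl (· + ·) k))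
  change maxSignChanges k _ _ = _ at hmax
  rw [Multiset.mem_toFinset, Multiset.mem_lists_iff] at hl
  obtain ⟨post, hpost, rfl⟩ := exists_list_of_map_eq Prod.fst
    (tailSteps 1 X₂ P₂ + tailSteps (-1) X₃ P₃) l (by
      rw [Multiset.map_add, map_fst_tailSteps, map_fst_tailSteps]
      simp only [one_mul, neg_mul]
      exact hl)
  obtain ⟨pre, hpre⟩ := Quotient.exists_rep (tailSteps 1 X₁ P₁)
  change (pre : Multiset (ℤ × Bool)) = _ at hpre
  have hpresum : (pre.map Prod.fst).sum = 2 * (X₁.sum + P₁.sum) := by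
    rw [← Multiset.sum_coe, ← Multiset.map_coe, hpre, sum_tailSteps, one_mul]
  have hpostsum : (post.map Prod.fst).sum
      = 2 * (X₂.sum + P₂.sum) - 2 * (X₃.sum + P₃.sum) := by
    rw [← Multiset.sum_coe, ← Multiset.map_coe, hpost, Multiset.map_add, Multiset.sum_add,
      sum_tailSteps, sum_tailSteps]
    ring
  have hX₁ : ∀ w ∈ X₁, 0 < w := fun w hw => by
    have := hlam0 (2 * w) (by
      rw [hlam]
      simp only [Multiset.mem_add, twice, Multiset.mem_map]
      exact .inl (.inl (.inr ⟨w, .inl hw, rfl⟩)))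
    omega
  have hX₂ : ∀ w ∈ X₂, 0 < w := fun w hw => by
    have := hlam0 (2 * w) (by
      rw [hlam]
      simp only [Multiset.mem_add, twice, Multiset.mem_map]
      exact .inl (.inl (.inr ⟨w, .inr hw, rfl⟩)))
    omega
  have hX₃ : ∀ w ∈ X₃, 0 < w := fun w hw => by
    have := hmu0 (2 * w) (by
      rw [hmu]
      simp only [Multiset.mem_add, twice, Multiset.mem_map]
      exact .inl (.inl (.inr ⟨w, hw, rfl⟩)))
    omega
  have hmempre : ∀ s ∈ pre, (∃ w : ℕ, 0 < w ∧ s = (2 * (w : ℤ), false)) ∨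
      ∃ w : ℕ, Odd w ∧ s = (2 * (w : ℤ), true) := by
    intro s hs
    rw [← Multiset.mem_coe, hpre, mem_tailSteps] at hs
    rcases hs with ⟨w, hw, rfl⟩ | ⟨w, hw, rfl⟩
    · exact .inl ⟨w, hX₁ w hw, by simp⟩
    · exact .inr ⟨w, hP₁ w hw, by simp⟩
  have hmempost : ∀ s ∈ post, (∃ w : ℕ, 0 < w ∧ (s.1 = 2 * (w : ℤ) ∨ s.1 = -(2 * (w : ℤ))) ∧
      s.2 = false) ∨ ∃ w : ℕ, Odd w ∧ (s.1 = 2 * (w : ℤ) ∨ s.1 = -(2 * (w : ℤ))) := by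
    intro s hs
    rw [← Multiset.mem_coe, hpost, Multiset.mem_add, mem_tailSteps, mem_tailSteps] at hs
    rcases hs with (⟨w, hw, rfl⟩ | ⟨w, hw, rfl⟩) | ⟨w, hw, rfl⟩ | ⟨w, hw, rfl⟩
    · exact .inl ⟨w, hX₂ w hw, .inl (by simp), rfl⟩
    · exact .inr ⟨w, hP₂ w hw, .inl (by simp)⟩
    · exact .inl ⟨w, hX₃ w hw, .inr (by simp), rfl⟩
    · exact .inr ⟨w, hP₃ w hw, .inr (by simp)⟩
  have hmem : ∀ s ∈ pre ++ post, (∃ w : ℕ, 0 < w ∧ (s.1 = 2 * (w : ℤ) ∨ s.1 = -(2 * (w : ℤ))) ∧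
      s.2 = false) ∨ ∃ w : ℕ, Odd w ∧ (s.1 = 2 * (w : ℤ) ∨ s.1 = -(2 * (w : ℤ))) := by
    intro s hs
    rcases List.mem_append.1 hs with hs | hs
    · rcases hmempre s hs with ⟨w, hw, rfl⟩ | ⟨w, hw, rfl⟩
      · exact .inl ⟨w, hw, .inl rfl, rfl⟩
      · exact .inr ⟨w, hw, .inl rfl⟩
    · exact hmempost s hs
  have hT : TailsOK pre post := by
    refine ⟨fun s hs => ?_, fun s hs => ?_, fun s hs => ?_, fun s hs h2 => ?_, ?_⟩
    · rcases hmempre s hs with ⟨w, hw, rfl⟩ | ⟨w, hw, rfl⟩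
      · simpa using hw
      · simpa using hw.pos
    · rcases hmem s hs with ⟨w, -, h | h, -⟩ | ⟨w, -, h | h⟩ <;> rw [h]
      · exact even_two_mul _
      · exact (even_two_mul _).neg
      · exact even_two_mul _
      · exact (even_two_mul _).neg
    · rcases hmem s hs with ⟨w, hw, h, -⟩ | ⟨w, hw, h⟩
      · omega
      · have := hw.pos; omega
    · rcases hmem s hs with ⟨w, -, -, h⟩ | ⟨w, hw, h⟩
      · rw [h2] at h; cases h
      · rcases h with h | h
        · rw [show s.1 / 2 = (w : ℤ) by omega]; exact_mod_cast hw
        · rw [show s.1 / 2 = -(w : ℤ) by omega]; exact (show Odd (w : ℤ) by exact_mod_cast hw).neg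
    · obtain ⟨w, hw⟩ := Multiset.exists_mem_of_ne_zero hP₃'
      refine ⟨(-1 * (2 * (w : ℤ)), true), ?_, rfl, ?_⟩
      · rw [← Multiset.mem_coe, hpost, Multiset.mem_add, mem_tailSteps, mem_tailSteps]
        exact .inr (.inr ⟨w, hw, rfl⟩)
      · have := (hP₃ w hw).pos
        simp only; omega
  have hlF : leftForks pre = P₁.card := by
    rw [leftForks_eq, hpre, countP_tailSteps 1 X₁ P₁ (fun x => decide (0 < x)) true]
    · rfl
    · intro w hw; simpa using (hP₁ w hw).pos
  have hlF' : leftForks post = P₂.card := by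
    rw [leftForks_eq, hpost, Multiset.countP_add,
      countP_tailSteps 1 X₂ P₂ (fun x => decide (0 < x)) true,
      countP_tailSteps (-1) X₃ P₃ (fun x => decide (0 < x)) false]
    · rfl
    · intro w hw; simp
    · intro w hw; simpa using (hP₂ w hw).pos
  have hrF : rightForks post = P₃.card := by
    rw [rightForks_eq, hpost, Multiset.countP_add,
      countP_tailSteps 1 X₂ P₂ (fun x => decide (x < 0)) false,
      countP_tailSteps (-1) X₃ P₃ (fun x => decide (x < 0)) true]
    · simp
    · intro w hw; simpa using (hP₃ w hw).pos
    · intro w hw; simp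
  have hlen : pre.length = X₁.card + P₁.card := by
    rw [← Multiset.coe_card, hpre, card_tailSteps]
  have hsumlam : (lam.sum : ℤ) = a0 + eL.sum + Ma.sum + 2 * (X₁.sum + X₂.sum) + 2 * (P₁.sum + P₂.sum) := by
    rw [hlam]
    simp only [Multiset.sum_add, Multiset.sum_singleton, sum_twice, Nat.cast_add, Nat.cast_mul,
      Nat.cast_ofNat]
    ring
  have hsummu : (mu.sum : ℤ) = eR.sum + Mb.sum + 2 * X₃.sum + 2 * P₃.sum := by
    rw [hmu]
    simp only [Multiset.sum_add, sum_twice, Nat.cast_add, Nat.cast_mul, Nat.cast_ofNat]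
    ring
  have hkpre : (a0 : ℤ) + (pre.map Prod.fst).sum + (Ma.sum - Mb.sum) = k := by rw [hpresum, hk]
  -- Equality of the degrees forces the weight of the last end of the main string to be `c`; over
  -- which side it lies is decided by `he`.
  have hlast : ({-(k + (post.map Prod.fst).sum)} : Multiset ℤ)
      = eL.map (fun n : ℕ => (n : ℤ)) + eR.map fun n : ℕ => -(n : ℤ) := by
    rw [hpostsum, hk]
    have h : (lam.sum : ℤ) = mu.sum := by exact_mod_cast hsum
    rcases he with ⟨rfl, rfl⟩ | ⟨rfl, rfl⟩
    · simp only [Multiset.map_singleton, Multiset.map_zero, add_zero, Multiset.singleton_inj]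
      simp only [Multiset.sum_singleton, Multiset.sum_zero, Nat.cast_zero] at hsumlam hsummu
      linarith
    · simp only [Multiset.map_singleton, Multiset.map_zero, zero_add, Multiset.singleton_inj]
      simp only [Multiset.sum_singleton, Multiset.sum_zero, Nat.cast_zero] at hsumlam hsummu
      linarith
  have hends : ∀ A B : Fin (n + 1) → ℤ, Finset.univ.val.map A + Finset.univ.val.map (fun i => -B i)
      = Ma.map (fun n : ℕ => (n : ℤ)) + Mb.map (fun n : ℕ => -(n : ℤ)) →
      {(a0 : ℤ)} + {-(a0 + (pre.map Prod.fst).sum + (Ma.sum - Mb.sum) + (post.map Prod.fst).sum)}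
        + Finset.univ.val.map A + Finset.univ.val.map (fun i => -B i) + tailEnds pre + tailEnds post
      = lam.map (fun n : ℕ => (n : ℤ)) + mu.map (fun n : ℕ => -(n : ℤ)) := by
    intro A B hAB
    rw [hkpre, hlast, tailEnds_eq, tailEnds_eq, hpre, hpost, endsOf_add, endsOf_tailSteps,
      endsOf_tailSteps, endsOf_tailSteps, hlam, hmu, add_assoc _ (Finset.univ.val.map A), hAB]
    simp only [Multiset.map_add, twice, one_mul, neg_mul, Multiset.map_singleton]
    abel
  have hroom' : pre.length + 2 * (n + 1) + (leftForks pre + leftForks post)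
      ≤ (branchCount g lam mu + 1) / 2 := by
    rw [hlF, hlF', hlen, ← hn]; exact hroom
  have hcasta : Finset.univ.val.map (fun i => (a i : ℤ)) = Ma.map fun n : ℕ => (n : ℤ) := by
    rw [← ha, Multiset.map_map]; rfl
  have hcastb : Finset.univ.val.map (fun i => -(b i : ℤ)) = Mb.map fun n : ℕ => -(n : ℤ) := by
    rw [← hb, Multiset.map_map]; rfl
  have hsumab : ∑ i, ((a i : ℤ) - b i) = Ma.sum - Mb.sum := by
    rw [Finset.sum_sub_distrib, sum_cast_univ, sum_cast_univ, ha, hb]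
  have hao : ∀ i, Odd (a i : ℤ) := fun i => by exact_mod_cast hMa _ (ha1 i)
  have hbo : ∀ i, Odd (b i : ℤ) := fun i => by exact_mod_cast hMb _ (hb1 i)
  have hap : ∀ i, 0 < (a i : ℤ) := fun i => by exact_mod_cast (hMa _ (ha1 i)).pos
  have hbp : ∀ i, 0 < (b i : ℤ) := fun i => by exact_mod_cast (hMb _ (hb1 i)).pos
  rw [hn, hmax, ← hrF, ← hlF, ← hlF', ← hkpre, Nat.add_sub_cancel]
  have ha0' : Odd (a0 : ℤ) := by exact_mod_cast ha0
  have ha0p : 0 < (a0 : ℤ) := by exact_mod_cast ha0.pos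
  rw [← hkpre] at hk0
  -- If the ends over +∞ are heavier, flow has to run from the main string into the chain. The chain
  -- is then described with negative flows, and `a` and `b` exchange their roles.
  rcases lt_or_gt_of_ne ht with ht | ht
  · refine boundsEffectiveNumber_of_tails (b := false) (fun i => -(b i : ℤ)) (fun i => -(a i : ℤ))
      ?_ (fun i => (hbo i).neg) (fun i => (hao i).neg) (fun i => ?_) (fun i => ?_) ?_ ht hT ha0'
      ha0p hk0 hmu0 (hends _ _ ?_) hroom'
    · intro i j hij
      simp only [Prod.mk.injEq, neg_inj, Nat.cast_inj] at hij
      exact hinj (Prod.ext hij.2 hij.1)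
    · simpa using hbp i
    · simpa using hap i
    · rw [← hsumab]
      exact Finset.sum_congr rfl fun i _ => by ring
    · simp only [neg_neg]
      rw [hcasta, hcastb, add_comm]
  · refine boundsEffectiveNumber_of_tails (b := true) (fun i => (a i : ℤ)) (fun i => (b i : ℤ))
      ?_ hao hbo hap hbp hsumab ht hT ha0' ha0p hk0 hmu0 (hends _ _ ?_) hroom'
    · intro i j hij
      simp only [Prod.mk.injEq, Nat.cast_inj] at hij
      exact hinj (Prod.ext hij.1 hij.2)
    · rw [hcasta, hcastb]

/-! ### The tail decomposition -/

namespace TailDec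

theorem count_oddPairs (p : Multiset ℕ) (n : ℕ) :
    (oddPairs p).count n = if Odd n then p.count n / 2 else 0 := by
  rw [oddPairs, Multiset.count_sum']
  simp only [Multiset.count_replicate]
  rw [Finset.sum_ite_eq']
  by_cases hn : Odd n
  · by_cases hp : n ∈ p
    · simp [hn, hp]
    · simp [hn, hp]
  · simp [hn]

theorem count_single (p : Multiset ℕ) (n : ℕ) :
    (single p).val.count n = if Odd n then p.count n % 2 else 0 := by
  have h : n ∈ (single p).val ↔ Odd n ∧ Odd (p.count n) := by
    rw [Finset.mem_val, single, Finset.mem_filter, Multiset.mem_toFinset]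
    refine and_iff_right_of_imp fun h => ?_
    rw [← Multiset.count_pos]
    exact h.2.pos
  rw [Multiset.count_eq_of_nodup (single p).nodup]
  simp only [h]
  by_cases hn : Odd n <;> by_cases hc : Odd (p.count n)
  · simp [hn, hc, Nat.odd_iff.1 hc]
  · simp [hn, hc, Nat.even_iff.1 (Nat.not_odd_iff_even.1 hc)]
  · simp [hn]
  · simp [hn]

theorem twice_evenHalves (p : Multiset ℕ) : twice (evenHalves p) = p.filter fun n => 4 ∣ n := by
  rw [twice, evenHalves, Multiset.map_map]
  refine (Multiset.map_congr rfl fun n hn => ?_).trans (Multiset.map_id _)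
  have := (Multiset.mem_filter.1 hn).2
  simp only [Function.comp_apply, id]
  omega

theorem twice_oddHalves (p : Multiset ℕ) : twice (oddHalves p) = p.filter fun n => n % 4 = 2 := by
  rw [twice, oddHalves, Multiset.map_map]
  refine (Multiset.map_congr rfl fun n hn => ?_).trans (Multiset.map_id _)
  have := (Multiset.mem_filter.1 hn).2
  simp only [Function.comp_apply, id]
  omega

/-- An odd part of multiplicity c occurs c % 2 times in λ₀ and c / 2 times in each of the two copies
of λ_{o,o}; even parts are twice their halves. -/
theorem eq_tailDecomposition (p : Multiset ℕ) :
    p = (single p).val + twice (evenHalves p + oddHalves p) + oddPairs p + oddPairs p := by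
  rw [show twice (evenHalves p + oddHalves p) = twice (evenHalves p) + twice (oddHalves p) from
    Multiset.map_add _ _ _, twice_evenHalves, twice_oddHalves]
  ext n
  simp only [Multiset.count_add, count_oddPairs, count_single, Multiset.count_filter]
  by_cases hn : Odd n
  · have := Nat.odd_iff.1 hn
    rw [if_neg (show ¬ 4 ∣ n by omega), if_neg (show ¬ n % 4 = 2 by omega)]
    simp only [hn, if_true]
    omega
  · have := Nat.even_iff.1 (Nat.not_odd_iff_even.1 hn)
    simp only [hn, if_false]
    by_cases h4 : 4 ∣ n
    · rw [if_pos h4, if_neg (show ¬ n % 4 = 2 by omega)]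
      omega
    · rw [if_neg h4, if_pos (show n % 4 = 2 by omega)]
      omega

theorem odd_of_mem_oddPairs {p : Multiset ℕ} {n : ℕ} (h : n ∈ oddPairs p) : Odd n := by
  by_contra hn
  rw [← Multiset.count_pos, count_oddPairs, if_neg hn] at h
  exact lt_irrefl _ h

theorem odd_of_mem_single {p : Multiset ℕ} {n : ℕ} (h : n ∈ single p) : Odd n :=
  (Finset.mem_filter.1 h).2.1

theorem card_eq (p : Multiset ℕ) : p.card = (single p).card + (evenHalves p).card
    + (oddHalves p).card + 2 * (oddPairs p).card := by
  conv_lhs => rw [eq_tailDecomposition p]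
  simp only [Multiset.card_add, twice, Multiset.card_map, Finset.card_val]
  ring

theorem total_eq (s : Finset ℕ) : total s = (s.val.sum : ℕ) := by
  rw [total, ← Nat.cast_sum, Finset.sum_val]
  rfl

theorem sum_eq (p : Multiset ℕ) : (p.sum : ℤ) = total (single p) + 2 * (evenHalves p).sum
    + 2 * (oddHalves p).sum + 2 * (oddPairs p).sum := by
  conv_lhs => rw [eq_tailDecomposition p]
  rw [total_eq]
  simp only [Multiset.sum_add, sum_twice, Nat.cast_add, Nat.cast_mul, Nat.cast_ofNat]
  ring

theorem total_erase {s : Finset ℕ} {a : ℕ} (h : a ∈ s) : total (s.erase a) = total s - a := by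
  rw [total, total, ← Finset.add_sum_erase _ _ h]
  ring

theorem even_total_sub_card {s : Finset ℕ} (h : ∀ n ∈ s, Odd n) : Even (total s - s.card) := by
  have : total s - s.card = ∑ n ∈ s, ((n : ℤ) - 1) := by
    rw [Finset.sum_sub_distrib, total]
    simp
  rw [this]
  refine Finset.even_sum _ fun n hn => ?_
  exact (show Odd (n : ℤ) by exact_mod_cast h n hn).sub_odd odd_one

theorem card_le_total {s : Finset ℕ} (h : ∀ n ∈ s, Odd n) : (s.card : ℤ) ≤ total s := by
  have := Finset.card_nsmul_le_sum s (fun n => (n : ℤ)) 1 (fun n hn => by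
    exact_mod_cast (h n hn).pos)
  simpa [total] using this

theorem pos_of_mem_evenHalves {p : Multiset ℕ} (hp : ∀ n ∈ p, 0 < n) {n : ℕ}
    (h : n ∈ evenHalves p) : 0 < n := by
  obtain ⟨m, hm, rfl⟩ := Multiset.mem_map.1 h
  rw [Multiset.mem_filter] at hm
  have := hp m hm.1
  omega

theorem pos_of_mem_oddHalves {p : Multiset ℕ} {n : ℕ}
    (h : n ∈ oddHalves p) : 0 < n := by
  obtain ⟨m, hm, rfl⟩ := Multiset.mem_map.1 h
  rw [Multiset.mem_filter] at hm
  omega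

end TailDec

theorem card_le_sum {M : Multiset ℕ} (h : ∀ n ∈ M, 0 < n) : M.card ≤ M.sum := by
  have := Multiset.card_nsmul_le_sum (s := M) (a := 1) (fun n hn => h n hn)
  simpa using this

/-! ### Minimal selections -/

/-- A triple for which no part can be removed without violating the inequality is small. -/
theorem two_mul_card_le_of_irredundant {A F H : Multiset ℕ} {l w : ℤ} (hl : 1 ≤ l) (hw : 0 ≤ w)
    (hA : ∀ n ∈ A, 0 < n) (hF : ∀ n ∈ F, 0 < n) (hH : ∀ n ∈ H, 0 < n)
    (irrA : ∀ n ∈ A, l + 2 * ((A.erase n).sum : ℤ) + 2 * (F.sum : ℤ) + 2 * (H.sum : ℤ) ≤ w)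
    (irrF : ∀ n ∈ F, l + 2 * (A.sum : ℤ) + 2 * ((F.erase n).sum : ℤ) + 2 * (H.sum : ℤ) ≤ w)
    (irrH : ∀ n ∈ H, l + 2 * (A.sum : ℤ) + 2 * (F.sum : ℤ) + 2 * ((H.erase n).sum : ℤ) ≤ w) :
    2 * ((A.card : ℤ) + F.card + H.card) ≤ w + 1 := by
  have cA := card_le_sum hA
  have cF := card_le_sum hF
  have cH := card_le_sum hH
  rcases Multiset.empty_or_exists_mem A with rfl | ⟨n, hn⟩
  · rcases Multiset.empty_or_exists_mem F with rfl | ⟨n, hn⟩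
    · rcases Multiset.empty_or_exists_mem H with rfl | ⟨n, hn⟩
      · simp; omega
      · have h1 := irrH n hn
        have h2 := card_le_sum (M := H.erase n) fun k hk => hH k (Multiset.mem_of_mem_erase hk)
        have h3 := Multiset.card_erase_add_one hn
        simp only [Multiset.sum_zero, Multiset.card_zero, Nat.cast_zero] at h1 ⊢
        omega
    · have h1 := irrF n hn
      have h2 := card_le_sum (M := F.erase n) fun k hk => hF k (Multiset.mem_of_mem_erase hk)
      have h3 := Multiset.card_erase_add_one hn
      simp only [Multiset.sum_zero, Multiset.card_zero, Nat.cast_zero] at h1 ⊢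
      omega
  · have h1 := irrA n hn
    have h2 := card_le_sum (M := A.erase n) fun k hk => hA k (Multiset.mem_of_mem_erase hk)
    have h3 := Multiset.card_erase_add_one hn
    omega

/-- Remove parts as long as the inequality survives. Since the parts may be taken from given `U`,
`V`, `W`, some of the ones can be set aside beforehand. -/
theorem exists_irredundant {l w : ℤ} (hl : 1 ≤ l) (hw : 0 ≤ w) (U V W : Multiset ℕ)
    (hU : ∀ n ∈ U, 0 < n) (hV : ∀ n ∈ V, 0 < n) (hW : ∀ n ∈ W, 0 < n)
    (h : w < l + 2 * (U.sum : ℤ) + 2 * (V.sum : ℤ) + 2 * (W.sum : ℤ)) :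
    ∃ A F H, A ≤ U ∧ F ≤ V ∧ H ≤ W ∧
      w < l + 2 * (A.sum : ℤ) + 2 * (F.sum : ℤ) + 2 * (H.sum : ℤ) ∧
      2 * ((A.card : ℤ) + F.card + H.card) ≤ w + 1 := by
  obtain ⟨s, hs⟩ : ∃ s, U.card + V.card + W.card = s := ⟨_, rfl⟩
  induction s using Nat.strong_induction_on generalizing U V W with
  | _ s ih =>
    have sub : ∀ {M : Multiset ℕ} {n : ℕ}, (∀ k ∈ M, 0 < k) → ∀ k ∈ M.erase n, 0 < k :=
      fun hM k hk => hM k (Multiset.mem_of_mem_erase hk)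
    by_cases hA : ∃ n ∈ U, w < l + 2 * ((U.erase n).sum : ℤ) + 2 * (V.sum : ℤ) + 2 * (W.sum : ℤ)
    · obtain ⟨n, hn, hlt⟩ := hA
      have h3 := Multiset.card_erase_add_one hn
      obtain ⟨A, F, H, h1, h2⟩ := ih _ (by omega) (U.erase n) V W (sub hU) hV hW hlt rfl
      exact ⟨A, F, H, h1.trans (Multiset.erase_le _ _), h2⟩
    by_cases hF : ∃ n ∈ V, w < l + 2 * (U.sum : ℤ) + 2 * ((V.erase n).sum : ℤ) + 2 * (W.sum : ℤ)
    · obtain ⟨n, hn, hlt⟩ := hF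
      have h3 := Multiset.card_erase_add_one hn
      obtain ⟨A, F, H, h1, h2, h4⟩ := ih _ (by omega) U (V.erase n) W hU (sub hV) hW hlt rfl
      exact ⟨A, F, H, h1, h2.trans (Multiset.erase_le _ _), h4⟩
    by_cases hH : ∃ n ∈ W, w < l + 2 * (U.sum : ℤ) + 2 * (V.sum : ℤ) + 2 * ((W.erase n).sum : ℤ)
    · obtain ⟨n, hn, hlt⟩ := hH
      have h3 := Multiset.card_erase_add_one hn
      obtain ⟨A, F, H, h1, h2, h4, h5⟩ := ih _ (by omega) U V (W.erase n) hU hV (sub hW) hlt rfl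
      exact ⟨A, F, H, h1, h2, h4.trans (Multiset.erase_le _ _), h5⟩
    push Not at hA hF hH
    exact ⟨U, V, W, le_rfl, le_rfl, le_rfl, h,
      two_mul_card_le_of_irredundant hl hw hU hV hW hA hF hH⟩

/-- Removing any part gives a triple that is smaller for the successive minimality conditions, hence
is not admissible. So a selection is irredundant. -/
theorem IsStarSelection.two_mul_card_le {lam A F H : Multiset ℕ} {l w : ℤ} (hl : 1 ≤ l)
    (hw : 0 ≤ w) (hlam : ∀ n ∈ lam, 0 < n) (h : IsStarSelection lam l w A F H) :
    2 * ((A.card : ℤ) + F.card + H.card) ≤ w + 1 := by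
  obtain ⟨⟨hA, hF, hH, -⟩, minH, minA, minF⟩ := h
  refine two_mul_card_le_of_irredundant hl hw
    (fun n hn => pos_of_mem_oddHalves (Multiset.mem_of_le hA hn))
    (fun n hn => pos_of_mem_evenHalves hlam (Multiset.mem_of_le hF hn))
    (fun n hn => (odd_of_mem_oddPairs (Multiset.mem_of_le hH hn)).pos)
    (fun n hn => ?_) (fun n hn => ?_) (fun n hn => ?_)
  · by_contra hlt
    have h1 := minA (A.erase n) F H ⟨(Multiset.erase_le _ _).trans hA, hF, hH, not_le.1 hlt⟩ rfl
    have h3 := Multiset.card_erase_add_one hn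
    omega
  · by_contra hlt
    have h1 := minF A (F.erase n) H ⟨hA, (Multiset.erase_le _ _).trans hF, hH, not_le.1 hlt⟩ rfl rfl
    have h3 := Multiset.card_erase_add_one hn
    omega
  · by_contra hlt
    have h1 := minH A F (H.erase n) ⟨hA, hF, (Multiset.erase_le _ _).trans hH, not_le.1 hlt⟩
    have h3 := Multiset.card_erase_add_one hn
    omega

/-! ### Inequalities between factorials and products -/

theorem factorial_le_prod (n a : ℕ) :
    n.factorial ≤ ∏ i ∈ Finset.range n, (a + 2 * i + 1) := by
  rw [← Finset.prod_range_add_one_eq_factorial]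
  exact Finset.prod_le_prod' fun i _ => by omega

/-- The factor n + u + 1 gained on the left is at most 2N + 2n + 1. This uses the additional places
in front of the chain for forks over -∞ based behind the junction. -/
theorem factorial_add_le_prod (n u : ℕ) (N : ℕ) (hN : u ≤ N) :
    (n + u).factorial ≤ u.factorial * ∏ i ∈ Finset.range n, (2 * N + 2 * i + 1) := by
  induction n with
  | zero => simp
  | succ n ih =>
    rw [Finset.prod_range_succ, show n + 1 + u = n + u + 1 by omega, Nat.factorial_succ, mul_comm,
      ← mul_assoc]
    exact Nat.mul_le_mul ih (by omega)

theorem le_prod_odd (u : ℕ) (hu : 1 ≤ u) : u ≤ ∏ i ∈ Finset.range u, (2 * i + 1) := by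
  induction u, hu using Nat.le_induction with
  | base => simp
  | succ u hu ih =>
    rw [Finset.prod_range_succ]
    nlinarith

/-- For n < u the left side is at most (2u - 1)!. From n = u on it gains the factor n + u + 1 ≤ 2n +
1 at each step, and the start (2u)! = 2u (2u - 1)! is covered by `le_prod_odd`. -/
theorem factorial_add_le (n u N : ℕ) (hu : 1 ≤ u) (hN : 2 * u ≤ N) :
    (n + u).factorial ≤ 2 * ((N - 1).factorial * ∏ i ∈ Finset.range n, (2 * i + 1)) := by
  have h1 : (2 * u - 1).factorial ≤ (N - 1).factorial := Nat.factorial_le (by omega)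
  have h0 : 0 < ∏ i ∈ Finset.range n, (2 * i + 1) := Finset.prod_pos fun i _ => by omega
  rcases lt_or_ge n u with hn | hn
  · have h2 : (n + u).factorial ≤ (N - 1).factorial := Nat.factorial_le (by omega)
    nlinarith [Nat.le_mul_of_pos_right ((N - 1).factorial) h0]
  · refine le_trans ?_ (Nat.mul_le_mul_left 2 (Nat.mul_le_mul_right _ h1))
    clear h0
    induction n, hn using Nat.le_induction with
    | base =>
      have h2 := le_prod_odd u hu
      have h3 : (u + u).factorial = 2 * u * (2 * u - 1).factorial := by
        rw [show u + u = 2 * u - 1 + 1 by omega, Nat.factorial_succ]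
        congr 1
        omega
      rw [h3]
      nlinarith [Nat.factorial_pos (2 * u - 1), Nat.mul_le_mul_left (2 * u - 1).factorial h2]
    | succ n hn ih =>
      rw [Finset.prod_range_succ, show n + 1 + u = n + u + 1 by omega, Nat.factorial_succ, mul_comm,
        ← mul_assoc, ← mul_assoc]
      rw [← mul_assoc] at ih
      exact Nat.mul_le_mul ih (by omega)

/-! ### The three cases -/

section Cases

variable {g : ℕ} {lam mu : Multiset ℕ}

theorem mul_le_two_mul {a b c x y M R Q T : ℕ} (h : b * c ≤ 2 * (M * (R * Q))) (h1 : a ≤ T) :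
    a * b * c * x * y ≤ 2 * (M * (x * y * (R * (Q * T)))) := by
  calc a * b * c * x * y = a * (b * c) * (x * y) := by ring
    _ ≤ T * (2 * (M * (R * Q))) * (x * y) := Nat.mul_le_mul_right _ (Nat.mul_le_mul h1 h)
    _ = _ := by ring

/-- Here u counts pairs of ones that end up on the N side strings instead of in forks: the (N - 1)!
orders of the chain and the factor two replace them. -/
theorem factorial_le_two_mul {n u N : ℕ} (hN : 2 * u ≤ N) :
    (n + u).factorial ≤ 2 * ((N - 1).factorial * ∏ i ∈ Finset.range n, (2 * i + 1)) := by
  rcases Nat.eq_zero_or_pos u with rfl | hu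
  · have h2 := factorial_le_prod n 0
    simp only [zero_add] at h2
    refine h2.trans ?_
    rw [← mul_assoc]
    exact Nat.le_mul_of_pos_left _ (by have := Nat.factorial_pos (N - 1); omega)
  · exact factorial_add_le n u N hu hN

theorem mul_factorial_le {x f M R Q : ℕ} (hx : x ≤ Q) (hf : f ≤ 2 * (M * R)) :
    x * f ≤ 2 * (M * (R * Q)) := by
  calc x * f ≤ Q * (2 * (M * R)) := Nat.mul_le_mul hx hf
    _ = _ := by ring

theorem singleton_add_erase {s : Finset ℕ} {a : ℕ} (h : a ∈ s) :
    ({a} : Multiset ℕ) + (s.erase a).val = s.val := by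
  rw [Finset.erase_val, Multiset.singleton_add, Multiset.cons_erase h]

theorem twice_add (X Y : Multiset ℕ) : twice (X + Y) = twice X + twice Y := Multiset.map_add _ _ _

theorem exists_complement {M N : Multiset ℕ} (h : M ≤ N) : ∃ M', N = M + M' :=
  Multiset.le_iff_exists_add.1 h

theorem tail_sub {lam A F H O' E' H' : Multiset ℕ} (hO : oddHalves lam = A + O')
    (hE : evenHalves lam = F + E') (hH : oddPairs lam = H + H') :
    tail lam - (A + F + H) = O' + E' + H' := by
  rw [tail, hO, hE, hH, show F + E' + (A + O') + (H + H') = A + F + H + (O' + E' + H') by abel,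
    add_tsub_cancel_left]

variable (hsum : lam.sum = mu.sum) (hlam : ∀ n ∈ lam, 0 < n) (hmu : ∀ n ∈ mu, 0 < n)
  {A F H : Multiset ℕ} (hA : A ≤ oddHalves lam) (hF : F ≤ evenHalves lam)

include hsum hlam hmu hA hF

/-- The main string runs from the part a of λ₀ over -∞ to the part b of μ₀ over +∞, and the side
strings pair the other parts of λ₀ and μ₀. The junction flow t is then `excessEq`. -/
theorem boundsEffectiveNumber_of_card_eq (hH : H ≤ oddPairs lam)
    (hcard : (single lam).card = (single mu).card) {a b : ℕ} (ha : a ∈ single lam)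
    (hb : b ∈ single mu) (ht : excessEq lam mu a b ≠ 0) (hoo : 1 ≤ (oddPairs mu).card)
    (hD : 3 * (single lam).card + 2 * (A.card + F.card + H.card) ≤ mu.card + 2 * g) {k : ℤ}
    (hk : k = total (single lam) + 2 * (A.sum : ℤ) + 2 * (F.sum : ℤ) + 2 * (H.sum : ℤ)
      - total ((single mu).erase b)) (hk0 : 0 < k) :
    BoundsEffectiveNumber g lam mu (factorialBound lam mu H.card
      (maxSignChanges k (twice (tail lam - (A + F + H))) (twice (tail mu)))) := by
  obtain ⟨O', hO'⟩ := exists_complement hA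
  obtain ⟨E', hE'⟩ := exists_complement hF
  obtain ⟨H', hH'⟩ := exists_complement hH
  have hcl := card_eq lam
  have hl1 := Finset.card_erase_add_one ha
  have hm1 := Finset.card_erase_add_one hb
  have hH1 : (oddPairs lam).card = H.card + H'.card := by rw [hH', Multiset.card_add]
  have h := boundsEffectiveNumber_of_multisets (g := g) (Ma := ((single lam).erase a).val)
    (Mb := ((single mu).erase b).val) (eL := 0) (eR := {b}) (X₁ := A + F) (P₁ := H)
    (X₂ := O' + E') (P₂ := H') (X₃ := evenHalves mu + oddHalves mu) (P₃ := oddPairs mu)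
    (a0 := a) (c := b) (k := k) hsum hlam hmu ?_ ?_ (.inr ⟨rfl, rfl⟩) ?_ (.inl (Finset.nodup _))
    (odd_of_mem_single ha) (fun w hw => odd_of_mem_single (Finset.mem_of_mem_erase hw))
    (fun w hw => odd_of_mem_single (Finset.mem_of_mem_erase hw))
    (fun w hw => odd_of_mem_oddPairs (Multiset.mem_of_le hH hw))
    (fun w hw => odd_of_mem_oddPairs (p := lam) (by rw [hH']; exact Multiset.mem_add.2 (.inr hw)))
    (fun w hw => odd_of_mem_oddPairs hw) (fun h => by rw [h] at hoo; simp at hoo) ?_ ?_ hk0 ?_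
  · rw [tail_sub hO' hE' hH']
    refine h.mono (mul_le_two_mul ?_ ?_)
    · rw [hH1, Nat.add_sub_cancel_left]
      exact mul_factorial_le (factorial_le_prod _ _) (factorial_le_two_mul (u := 0) (by omega))
    · simpa using factorial_le_prod H.card 0
  · calc lam = _ := eq_tailDecomposition lam
      _ = _ := by
        rw [hE', hO', hH', ← singleton_add_erase ha]
        simp only [twice_add]
        abel
  · calc mu = _ := eq_tailDecomposition mu
      _ = _ := by rw [← singleton_add_erase hb]
  · rw [Finset.card_val, Finset.card_val]
    omega
  · rwa [← total_eq, ← total_eq]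
  · rw [← total_eq, ← total_eq, total_erase ha, hk, Multiset.sum_add]
    push_cast
    ring
  -- Let l = l(λ₀) and let s be the number of selected tails. The room needed is s + 2(l - 1) +
  -- l(λ_{o,o}), while r contains l(λ) ≥ l + 2 l(λ_{o,o}). After doubling, 3l + 2s ≤ l(μ) + 2g is
  -- enough, which explains the coefficient three.
  · rw [hH1, hE', hO'] at hcl
    simp only [Multiset.card_add, Finset.card_val] at hcl ⊢
    unfold branchCount
    omega

/-- Both ends of the main string lie over -∞ and use up two parts of λ₀. The side strings then lack
2u = l(λ₀) - l(μ₀) - 2 ends over +∞, which are supplied by u pairs of ones from μ_{o,o}. By `hone` a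
further pair remains for the fork of the special tail. -/
theorem boundsEffectiveNumber_of_card_gt (hH : H ≤ oddPairs lam)
    (hcard : (single mu).card < (single lam).card)
    (hpar : Even ((single lam).card - (single mu).card))
    (hone : (single lam).card < 2 * (oddPairs mu).count 1 + (single mu).card)
    {a b : ℕ} (ha : a ∈ single lam) (hb : b ∈ single lam) (hab : a ≠ b)
    (ht : excessGt lam mu a b ≠ 0)
    (hD : 3 * (single lam).card + 2 * (A.card + F.card + H.card) ≤ mu.card + 2 * g) {k : ℤ}
    (hk : k = total ((single lam).erase b) + 2 * (A.sum : ℤ) + 2 * (F.sum : ℤ) + 2 * (H.sum : ℤ)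
      - total (single mu) - (single lam).card + (single mu).card + 2) (hk0 : 0 < k) :
    BoundsEffectiveNumber g lam mu (factorialBound lam mu H.card
      (maxSignChanges k (twice (tail lam - (A + F + H)))
        (twice (tail mu -
          Multiset.replicate (((single lam).card - (single mu).card - 2) / 2) 1)))) := by
  obtain ⟨O', hO'⟩ := exists_complement hA
  obtain ⟨E', hE'⟩ := exists_complement hF
  obtain ⟨H', hH'⟩ := exists_complement hH
  obtain ⟨u, hu⟩ : ∃ u, u = ((single lam).card - (single mu).card - 2) / 2 := ⟨_, rfl⟩
  obtain ⟨v, hv⟩ := hpar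
  have hu2 : (single lam).card = (single mu).card + 2 * u + 2 := by omega
  obtain ⟨P', hP'⟩ := exists_complement (Multiset.le_count_iff_replicate_le.1
    (show u ≤ (oddPairs mu).count 1 by omega))
  have hP0 : P' ≠ 0 := by
    rintro rfl
    rw [add_zero] at hP'
    rw [hP', Multiset.count_replicate_self] at hone
    omega
  have hba : b ∈ (single lam).erase a := Finset.mem_erase.2 ⟨hab.symm, hb⟩
  have hcl := card_eq lam
  have hl1 := Finset.card_erase_add_one ha
  have hl2 := Finset.card_erase_add_one hba
  have hH1 : (oddPairs lam).card = H.card + H'.card := by rw [hH', Multiset.card_add]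
  have hP1 : (oddPairs mu).card = P'.card + u := by
    rw [hP', Multiset.card_add, Multiset.card_replicate, add_comm]
  have hMa : (((single lam).erase a).erase b).val.card = (single mu).card + 2 * u := by
    rw [Finset.card_val]; omega
  have h := boundsEffectiveNumber_of_multisets (g := g)
    (Ma := (((single lam).erase a).erase b).val)
    (Mb := (single mu).val + Multiset.replicate (2 * u) 1) (eL := {b}) (eR := 0) (X₁ := A + F)
    (P₁ := H) (X₂ := O' + E') (P₂ := H') (X₃ := evenHalves mu + oddHalves mu) (P₃ := P')
    (a0 := a) (c := b) (k := k) hsum hlam hmu ?_ ?_ (.inl ⟨rfl, rfl⟩) ?_ (.inl (Finset.nodup _))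
    (odd_of_mem_single ha)
    (fun w hw => odd_of_mem_single (Finset.mem_of_mem_erase (Finset.mem_of_mem_erase hw)))
    (fun w hw => ?_)
    (fun w hw => odd_of_mem_oddPairs (Multiset.mem_of_le hH hw))
    (fun w hw => odd_of_mem_oddPairs (p := lam) (by rw [hH']; exact Multiset.mem_add.2 (.inr hw)))
    (fun w hw => odd_of_mem_oddPairs (p := mu) (by rw [hP']; exact Multiset.mem_add.2 (.inr hw)))
    hP0 ?_ ?_ hk0 ?_
  · have htail : tail mu - Multiset.replicate u 1 = evenHalves mu + oddHalves mu + P' := by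
      rw [tail, hP', add_left_comm, add_tsub_cancel_left]
    rw [tail_sub hO' hE' hH', ← hu, htail]
    refine h.mono (mul_le_two_mul ?_ ?_)
    · rw [hH1, Nat.add_sub_cancel_left, hP1]
      exact mul_factorial_le (factorial_le_prod _ _) (factorial_le_two_mul (by omega))
    · simpa using factorial_le_prod H.card 0
  · calc lam = _ := eq_tailDecomposition lam
      _ = _ := by
        rw [hE', hO', hH', ← singleton_add_erase ha, ← singleton_add_erase hba]
        simp only [twice_add]
        abel
  · calc mu = _ := eq_tailDecomposition mu
      _ = _ := by
        rw [hP', two_mul, Multiset.replicate_add]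
        abel
  · rw [hMa, Multiset.card_add, Multiset.card_replicate, Finset.card_val]
  · rcases Multiset.mem_add.1 hw with hw | hw
    · exact odd_of_mem_single hw
    · rw [Multiset.eq_of_mem_replicate hw]; exact odd_one
  · rw [Multiset.sum_add, Multiset.sum_replicate, ← total_eq, Nat.cast_add, ← total_eq]
    intro h0
    apply ht
    rw [excessGt, hu2, ← h0]
    push_cast
    simp only [smul_eq_mul]
    push_cast
    ring
  · rw [Multiset.sum_add, Multiset.sum_add, Multiset.sum_replicate, ← total_eq, Nat.cast_add,
      Nat.cast_add, ← total_eq, total_erase hba, total_erase ha, hk, total_erase hb, hu2]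
    simp only [smul_eq_mul]
    push_cast
    ring
  · rw [hH1, hE', hO'] at hcl
    rw [hMa]
    simp only [Multiset.card_add] at hcl ⊢
    unfold branchCount
    omega

/-- There are too few parts in λ₀, so v + 1 pairs of ones from λ_{o,o} are broken up: one of the
ones starts the main string, the other 2v + 1 start side strings. The forks lost are made up for by
the additional places before the chain and by the orders of the side strings. -/
theorem boundsEffectiveNumber_of_card_lt
    (hcard : (single lam).card < (single mu).card)
    (hpar : Even ((single mu).card - (single lam).card))
    (hH : H + Multiset.replicate (((single mu).card - (single lam).card) / 2) 1 ≤ oddPairs lam)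
    {b : ℕ} (hb : b ∈ single mu) (ht : excessLt lam mu b ≠ 0) (hoo : 1 ≤ (oddPairs mu).card)
    (hD : 3 * (single mu).card + 2 * (A.card + F.card + H.card) ≤ mu.card + 2 * g) {k : ℤ}
    (hk : k = total (single lam) + 2 * (A.sum : ℤ) + 2 * (F.sum : ℤ) + 2 * (H.sum : ℤ)
      - total ((single mu).erase b) - (single lam).card + (single mu).card) (hk0 : 0 < k) :
    BoundsEffectiveNumber g lam mu (factorialBound lam mu H.card
      (maxSignChanges k (twice (tail lam - (A + F + H +
        Multiset.replicate (((single mu).card - (single lam).card) / 2) 1)))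
        (twice (tail mu)))) := by
  obtain ⟨O', hO'⟩ := exists_complement hA
  obtain ⟨E', hE'⟩ := exists_complement hF
  obtain ⟨H', hH'⟩ := exists_complement hH
  obtain ⟨v, hv⟩ : ∃ v, v + 1 = ((single mu).card - (single lam).card) / 2 := by
    obtain ⟨w, hw⟩ := hpar
    exact ⟨w - 1, by omega⟩
  rw [← hv] at hH hH' ⊢
  have hu2 : (single mu).card = (single lam).card + 2 * v + 2 := by
    obtain ⟨w, hw⟩ := hpar
    omega
  have hle : H ≤ oddPairs lam := (Multiset.le_add_right _ _).trans hH
  have hcl := card_eq lam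
  have hm1 := Finset.card_erase_add_one hb
  have hH1 : (oddPairs lam).card = H.card + (H'.card + (v + 1)) := by
    rw [hH', Multiset.card_add, Multiset.card_add, Multiset.card_replicate]
    ring
  have hMa : ((single lam).val + Multiset.replicate (2 * v + 1) 1).card
      = (single lam).card + (2 * v + 1) := by
    rw [Multiset.card_add, Multiset.card_replicate, Finset.card_val]
  have h := boundsEffectiveNumber_of_multisets (g := g)
    (Ma := (single lam).val + Multiset.replicate (2 * v + 1) 1)
    (Mb := ((single mu).erase b).val) (eL := 0) (eR := {b}) (X₁ := A + F)
    (P₁ := H) (X₂ := O' + E') (P₂ := H') (X₃ := evenHalves mu + oddHalves mu) (P₃ := oddPairs mu)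
    (a0 := 1) (c := b) (k := k) hsum hlam hmu ?_ ?_ (.inr ⟨rfl, rfl⟩) ?_ (.inr (Finset.nodup _))
    odd_one (fun w hw => ?_)
    (fun w hw => odd_of_mem_single (Finset.mem_of_mem_erase hw))
    (fun w hw => odd_of_mem_oddPairs (Multiset.mem_of_le hle hw))
    (fun w hw => odd_of_mem_oddPairs (p := lam) (by rw [hH']; exact Multiset.mem_add.2 (.inr hw)))
    (fun w hw => odd_of_mem_oddPairs hw) (fun h => by rw [h] at hoo; simp at hoo) ?_ ?_ hk0 ?_
  · have htail : tail lam - (A + F + H + Multiset.replicate (v + 1) 1) = O' + E' + H' := by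
      rw [tail, hO', hE', hH', show F + E' + (A + O') + (H + Multiset.replicate (v + 1) 1 + H')
        = A + F + H + Multiset.replicate (v + 1) 1 + (O' + E' + H') by abel, add_tsub_cancel_left]
    rw [htail]
    refine h.mono (mul_le_two_mul ?_ ?_)
    · rw [hH1, Nat.add_sub_cancel_left, hMa, mul_comm, mul_comm (∏ i ∈ _, _)]
      refine mul_factorial_le (by simpa using factorial_le_prod (oddPairs mu).card 0) ?_
      refine (factorial_add_le_prod H'.card (v + 1) ((single lam).card + (2 * v + 1))
        (by omega)).trans ?_
      rw [← mul_assoc]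
      refine Nat.mul_le_mul_right _ ?_
      rcases Nat.eq_zero_or_pos v with rfl | hv0
      · have := Nat.factorial_pos ((single lam).card + (2 * 0 + 1) - 1)
        simp only [zero_add, Nat.factorial_one]
        omega
      · have := Nat.factorial_le (show v + 1 ≤ (single lam).card + (2 * v + 1) - 1 by omega)
        omega
    · simpa using factorial_le_prod H.card 0
  · calc lam = _ := eq_tailDecomposition lam
      _ = _ := by
        rw [hE', hO', hH']
        have : Multiset.replicate (v + 1) 1 + Multiset.replicate (v + 1) 1
            = {1} + Multiset.replicate (2 * v + 1) 1 := by
          rw [← Multiset.replicate_add, ← Multiset.replicate_one, ← Multiset.replicate_add]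
          congr 1
          ring
        simp only [twice_add]
        calc _ = (single lam).val + (twice F + twice E' + (twice A + twice O')) + (H + H' + H + H')
              + (Multiset.replicate (v + 1) 1 + Multiset.replicate (v + 1) 1) := by abel
          _ = _ := by
            rw [this]
            abel
  · calc mu = _ := eq_tailDecomposition mu
      _ = _ := by rw [← singleton_add_erase hb]
  · rw [hMa, Finset.card_val]
    omega
  · rcases Multiset.mem_add.1 hw with hw | hw
    · exact odd_of_mem_single hw
    · rw [Multiset.eq_of_mem_replicate hw]; exact odd_one
  · rw [Multiset.sum_add, Multiset.sum_replicate, ← total_eq, Nat.cast_add, ← total_eq]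
    intro h0
    apply ht
    rw [excessLt, hu2, ← h0]
    simp only [smul_eq_mul]
    push_cast
    ring
  · rw [Multiset.sum_add, Multiset.sum_add, Multiset.sum_replicate, ← total_eq, Nat.cast_add,
      Nat.cast_add, ← total_eq, hk, hu2]
    simp only [smul_eq_mul]
    push_cast
    ring
  · rw [hH1, hE', hO'] at hcl
    rw [hMa]
    simp only [Multiset.card_add] at hcl ⊢
    unfold branchCount
    omega

omit hA hF in
/-- The bound which uses all tails over `-∞` before the chain of the side strings. -/
theorem boundsEffectiveNumber_of_all_tails
    (hcard : (single mu).card < (single lam).card) (hm : 1 ≤ (single mu).card)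
    (hpar : Even ((single lam).card - (single mu).card))
    (hone : (single lam).card < 2 * (oddPairs mu).count 1 + (single mu).card)
    (hD : 3 * (single lam).card + 2 * (tail lam).card ≤ mu.card + 2 * g) :
    BoundsEffectiveNumber g lam mu (factorialBound lam mu (oddPairs lam).card 0) := by
  obtain ⟨v, hv⟩ : ∃ v, (single lam).card = (single mu).card + 2 * v + 2 := by
    obtain ⟨w, hw⟩ := hpar
    exact ⟨w - 1, by omega⟩
  obtain ⟨P', hP'⟩ := exists_complement (Multiset.le_count_iff_replicate_le.1
    (show v + 1 ≤ (oddPairs mu).count 1 by omega))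
  have hP0 : P' ≠ 0 := by
    rintro rfl
    rw [add_zero] at hP'
    rw [hP', Multiset.count_replicate_self] at hone
    omega
  have hP1 : (oddPairs mu).card = P'.card + (v + 1) := by
    rw [hP', Multiset.card_add, Multiset.card_replicate, add_comm]
  -- The junction flow depends injectively on a, so of two parts of λ₀ at least one makes it
  -- nonzero.
  obtain ⟨a, ha, ht⟩ : ∃ a ∈ single lam, total ((single lam).erase a) - total (single mu)
      - (2 * v + 1) ≠ 0 := by
    obtain ⟨a, ha, a', ha', hne⟩ := Finset.one_lt_card.1 (show 1 < (single lam).card by omega)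
    by_contra! h
    have h1 := h a ha
    have h2 := h a' ha'
    rw [total_erase ha] at h1
    rw [total_erase ha'] at h2
    exact hne (by omega)
  have hcl := card_eq lam
  have hl1 := Finset.card_erase_add_one ha
  have hs : (lam.sum : ℤ) = mu.sum := by exact_mod_cast hsum
  have hMa : ((single lam).erase a).val.card = (single mu).card + 2 * v + 1 := by
    rw [Finset.card_val]
    omega
  have hP'sum : ((oddPairs mu).sum : ℤ) = v + 1 + P'.sum := by
    rw [hP', Multiset.sum_add, Multiset.sum_replicate]
    simp only [smul_eq_mul]
    push_cast
    ring
  have hP'pos : 0 < P'.sum := (Multiset.card_pos.2 hP0).trans_le (card_le_sum fun w hw =>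
    (odd_of_mem_oddPairs (p := mu) (by rw [hP']; exact Multiset.mem_add.2 (.inr hw))).pos)
  have h := boundsEffectiveNumber_of_multisets (g := g) (Ma := ((single lam).erase a).val)
    (Mb := (single mu).val + Multiset.replicate (2 * v + 1) 1) (eL := 0) (eR := {1})
    (X₁ := evenHalves lam + oddHalves lam)
    (P₁ := oddPairs lam) (X₂ := 0) (P₂ := 0) (X₃ := evenHalves mu + oddHalves mu) (P₃ := P')
    (a0 := a) (c := 1) hsum hlam hmu ?_ ?_ (.inr ⟨rfl, rfl⟩) ?_
    (.inl (Finset.nodup _))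
    (odd_of_mem_single ha) (fun w hw => odd_of_mem_single (Finset.mem_of_mem_erase hw))
    (fun w hw => ?_)
    (fun w hw => odd_of_mem_oddPairs hw) (fun w hw => by simp at hw)
    (fun w hw => odd_of_mem_oddPairs (p := mu) (by rw [hP']; exact Multiset.mem_add.2 (.inr hw)))
    hP0 ?_ rfl ?_ ?_
  -- Only B = 0 is claimed; the factorials belonging to the actual number of sign changes are at
  -- least one.
  · refine h.mono (mul_le_two_mul ?_ ?_ |>.trans (Nat.mul_le_mul_left 2 (Nat.mul_le_mul_left _
      (Nat.mul_le_mul_right _ (Nat.mul_le_mul (Nat.succ_le_of_lt (Nat.factorial_pos _))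
        (Nat.succ_le_of_lt (Nat.factorial_pos _)))))))
    · rw [Nat.sub_self, hP1]
      exact mul_factorial_le (by simp) (factorial_le_two_mul (by omega))
    · simpa using factorial_le_prod (oddPairs lam).card 0
  · calc lam = _ := eq_tailDecomposition lam
      _ = _ := by
        rw [← singleton_add_erase ha]
        simp only [add_zero]
  · calc mu = _ := eq_tailDecomposition mu
      _ = _ := by
        rw [hP']
        have : Multiset.replicate (v + 1) 1 + Multiset.replicate (v + 1) 1
            = {1} + Multiset.replicate (2 * v + 1) 1 := by
          rw [← Multiset.replicate_add, ← Multiset.replicate_one, ← Multiset.replicate_add]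
          congr 1
          ring
        calc _ = (single mu).val + twice (evenHalves mu + oddHalves mu) + P' + P'
              + (Multiset.replicate (v + 1) 1 + Multiset.replicate (v + 1) 1) := by abel
          _ = _ := by
            rw [this]
            abel
  · rw [hMa, Multiset.card_add, Multiset.card_replicate, Finset.card_val]
    ring
  · rcases Multiset.mem_add.1 hw with hw | hw
    · exact odd_of_mem_single hw
    · rw [Multiset.eq_of_mem_replicate hw]; exact odd_one
  · rw [Multiset.sum_add, Multiset.sum_replicate, ← total_eq, Nat.cast_add, ← total_eq]
    intro h0
    apply ht
    rw [← h0]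
    simp only [smul_eq_mul]
    push_cast
    ring
  -- With all of λ used up, the flow behind the junction is the sum of what still leaves: the last
  -- end, of weight one, and the remaining tails of μ, counted twice.
  · rw [sum_eq lam, sum_eq mu, hP'sum] at hs
    rw [Multiset.sum_add, Multiset.sum_add, Multiset.sum_replicate, ← total_eq, Nat.cast_add,
      Nat.cast_add, ← total_eq, total_erase ha]
    simp only [smul_eq_mul]
    have h0 : (0 : ℤ) < P'.sum := by exact_mod_cast hP'pos
    have h1 : (0 : ℤ) ≤ ((evenHalves mu).sum : ℕ) := Nat.cast_nonneg _
    have h2 : (0 : ℤ) ≤ ((oddHalves mu).sum : ℕ) := Nat.cast_nonneg _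
    rw [Nat.cast_mul, Nat.cast_add, Nat.cast_mul]
    push_cast at hs h0 h1 h2 ⊢
    linarith
  · rw [hMa]
    simp only [tail, Multiset.card_add, Multiset.card_zero] at hD ⊢
    unfold branchCount
    omega

end Cases

/-! ### The main theorem -/

theorem Exceeds.pos {D : ℤ} {A : Set ℤ} (h : Exceeds D A) {t : ℤ} (ht : t ∈ A) (h0 : 0 < t) :
    0 < D :=
  h.elim (fun h => h.2) fun h => absurd (h.1 t ht) (not_le.2 h0)

theorem Exceeds.abs_lt {D : ℤ} {A : Set ℤ} (h : Exceeds D A) (hA : ∀ t ∈ A, t ≤ 0) {t : ℤ}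
    (ht : IsMaxNegative A t) : |t| < D := by
  rcases h with ⟨⟨s, hs, h0⟩, -⟩ | ⟨-, s, hs, h⟩
  · exact absurd (hA s hs) (not_le.2 h0)
  · rwa [ht.unique hs]

namespace TailDec

theorem oddPairs_le_tail (p : Multiset ℕ) : oddPairs p ≤ tail p := Multiset.le_add_left _ _

theorem add_le_tail {p A F H : Multiset ℕ} (hA : A ≤ oddHalves p) (hF : F ≤ evenHalves p)
    (hH : H ≤ oddPairs p) : A + F + H ≤ tail p := by
  rw [tail, add_comm A F]
  exact add_le_add (add_le_add hF hA) hH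

end TailDec

/-! ### From the numerical conditions to the bounds -/

section Conditions

variable {g : ℕ} {lam mu : Multiset ℕ}

/-- Modulo two the degree is the number of parts of λ₀, and likewise for μ₀. -/
theorem even_card_sub_card (hsum : lam.sum = mu.sum) :
    Even (((single lam).card : ℤ) - (single mu).card) := by
  obtain ⟨c, hc⟩ := even_total_sub_card (s := single lam) fun _ h => odd_of_mem_single h
  obtain ⟨e, he⟩ := even_total_sub_card (s := single mu) fun _ h => odd_of_mem_single h
  have hs : (lam.sum : ℤ) = mu.sum := by exact_mod_cast hsum
  rw [sum_eq lam, sum_eq mu] at hs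
  rw [Int.even_iff]
  omega

theorem even_card_tsub_card (hsum : lam.sum = mu.sum) :
    Even ((single lam).card - (single mu).card) := by
  have h := even_card_sub_card hsum
  rw [Int.even_iff] at h
  rw [Nat.even_iff]
  omega

theorem ExistenceCondition.of_card_eq (h : ExistenceCondition g lam mu)
    (hcard : (single lam).card = (single mu).card) :
    1 ≤ (oddPairs mu).card ∧
      Exceeds ((mu.card : ℤ) + 2 * g - 3 * (single lam).card) (excessEqSet lam mu) := by
  rcases h with ⟨-, -, h⟩ | h | h
  · exact h
  · exact absurd h.1 (by omega)
  · exact absurd h.1 (by omega)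

theorem ExistenceCondition.of_card_gt (h : ExistenceCondition g lam mu)
    (hcard : (single mu).card < (single lam).card) :
    (single lam).card < 2 * (oddPairs mu).count 1 + (single mu).card ∧
      Exceeds ((mu.card : ℤ) + 2 * g - 3 * (single lam).card) (excessGtSet lam mu) := by
  rcases h with h | ⟨-, h⟩ | h
  · exact absurd h.1 (by omega)
  · exact h
  · exact absurd h.1 (by omega)

theorem ExistenceCondition.of_card_lt (h : ExistenceCondition g lam mu)
    (hcard : (single lam).card < (single mu).card) :
    1 ≤ (oddPairs mu).card ∧
      (single mu).card < 2 * (oddPairs lam).count 1 + (single lam).card ∧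
      Exceeds ((mu.card : ℤ) + 2 * g - 3 * (single mu).card) (excessLtSet lam mu) := by
  rcases h with h | h | ⟨-, h⟩
  · exact absurd h.1 (by omega)
  · exact absurd h.1 (by omega)
  · exact h

variable (hsum : lam.sum = mu.sum) (hlam : ∀ n ∈ lam, 0 < n) (hmu : ∀ n ∈ mu, 0 < n)

include hsum hlam hmu

theorem boundsEffectiveNumber_of_card_eq_of_pos
    (hcard : (single lam).card = (single mu).card) {a b : ℕ} (ha : a ∈ single lam)
    (hb : b ∈ single mu) (ht : 0 < excessEq lam mu a b) (hoo : 1 ≤ (oddPairs mu).card)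
    (hD : 0 < (mu.card : ℤ) + 2 * g - 3 * (single lam).card) :
    0 < total (single lam) - total ((single mu).erase b) ∧
    BoundsEffectiveNumber g lam mu (factorialBound lam mu 0
      (maxSignChanges (total (single lam) - total ((single mu).erase b))
        (twice (tail lam)) (twice (tail mu)))) := by
  have hk : 0 < total (single lam) - total ((single mu).erase b) := by
    rw [excessEq, total_erase ha] at ht
    omega
  refine ⟨hk, ?_⟩
  have h := boundsEffectiveNumber_of_card_eq (g := g) (A := 0) (F := 0) (H := 0) hsum hlam hmu
    (Multiset.zero_le _) (Multiset.zero_le _) (Multiset.zero_le _) hcard ha hb ht.ne' hoo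
    (by simp only [Multiset.card_zero]; omega) (by simp) hk
  simpa using h

/-- Here k = a + 2|λ*| - |t|, so admissibility says precisely that k is positive. Moreover 2 l(λ*) ≤
|t| + 1 is at most the number by which the condition exceeds, which provides the room for the chain.
The negative cases below work in the same way. -/
theorem boundsEffectiveNumber_of_card_eq_of_neg
    (hcard : (single lam).card = (single mu).card) {a b : ℕ} (ha : a ∈ single lam)
    (hb : b ∈ single mu) (ht : excessEq lam mu a b < 0) (hoo : 1 ≤ (oddPairs mu).card)
    (hD : |excessEq lam mu a b| < (mu.card : ℤ) + 2 * g - 3 * (single lam).card)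
    {A F H : Multiset ℕ} (hadm : IsAdmissible lam a |excessEq lam mu a b| A F H)
    (hs : 2 * ((A.card : ℤ) + F.card + H.card) ≤ |excessEq lam mu a b| + 1) :
    0 < total (single lam) + 2 * (A.sum : ℤ) + 2 * (F.sum : ℤ) + 2 * (H.sum : ℤ)
        - total ((single mu).erase b) ∧
    BoundsEffectiveNumber g lam mu (factorialBound lam mu H.card
      (maxSignChanges
        (total (single lam) + 2 * (A.sum : ℤ) + 2 * (F.sum : ℤ) + 2 * (H.sum : ℤ)
          - total ((single mu).erase b))
        (twice (tail lam - (A + F + H))) (twice (tail mu)))) := by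
  obtain ⟨hA, hF, hH, hw⟩ := hadm
  have hk : 0 < total (single lam) + 2 * (A.sum : ℤ) + 2 * (F.sum : ℤ) + 2 * (H.sum : ℤ)
        - total ((single mu).erase b) := by
    rw [abs_of_neg ht, excessEq, total_erase ha] at hw
    omega
  exact ⟨hk, boundsEffectiveNumber_of_card_eq hsum hlam hmu hA hF hH hcard ha hb ht.ne hoo
    (by omega) rfl hk⟩

theorem boundsEffectiveNumber_of_card_gt_of_pos
    (hcard : (single mu).card < (single lam).card)
    (hone : (single lam).card < 2 * (oddPairs mu).count 1 + (single mu).card)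
    {a b : ℕ} (ha : a ∈ single lam) (hb : b ∈ single lam) (hab : a ≠ b)
    (ht : 0 < excessGt lam mu a b)
    (hD : 0 < (mu.card : ℤ) + 2 * g - 3 * (single lam).card) :
    0 < total ((single lam).erase b) - total (single mu)
        - (single lam).card + (single mu).card + 2 ∧
    BoundsEffectiveNumber g lam mu (factorialBound lam mu 0
      (maxSignChanges
        (total ((single lam).erase b) - total (single mu)
          - (single lam).card + (single mu).card + 2)
        (twice (tail lam))
        (twice (tail mu -
          Multiset.replicate (((single lam).card - (single mu).card - 2) / 2) 1)))) := by
  have hk : 0 < total ((single lam).erase b) - total (single mu)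
        - (single lam).card + (single mu).card + 2 := by
    rw [excessGt, Finset.erase_right_comm, total_erase (Finset.mem_erase.2 ⟨hab, ha⟩)] at ht
    omega
  refine ⟨hk, ?_⟩
  have h := boundsEffectiveNumber_of_card_gt (g := g) (A := 0) (F := 0) (H := 0) hsum hlam hmu
    (Multiset.zero_le _) (Multiset.zero_le _) (Multiset.zero_le _) hcard
    (even_card_tsub_card hsum) hone ha hb hab ht.ne'
    (by simp only [Multiset.card_zero]; omega) (by simp) hk
  simpa using h

theorem boundsEffectiveNumber_of_card_gt_of_neg
    (hcard : (single mu).card < (single lam).card)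
    (hone : (single lam).card < 2 * (oddPairs mu).count 1 + (single mu).card)
    {a b : ℕ} (ha : a ∈ single lam) (hb : b ∈ single lam) (hab : a ≠ b)
    (ht : excessGt lam mu a b < 0)
    (hD : |excessGt lam mu a b| < (mu.card : ℤ) + 2 * g - 3 * (single lam).card)
    {A F H : Multiset ℕ} (hadm : IsAdmissible lam a |excessGt lam mu a b| A F H)
    (hs : 2 * ((A.card : ℤ) + F.card + H.card) ≤ |excessGt lam mu a b| + 1) :
    0 < total ((single lam).erase b) + 2 * (A.sum : ℤ) + 2 * (F.sum : ℤ) + 2 * (H.sum : ℤ)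
        - total (single mu) - (single lam).card + (single mu).card + 2 ∧
    BoundsEffectiveNumber g lam mu (factorialBound lam mu H.card
      (maxSignChanges
        (total ((single lam).erase b) + 2 * (A.sum : ℤ) + 2 * (F.sum : ℤ) + 2 * (H.sum : ℤ)
          - total (single mu) - (single lam).card + (single mu).card + 2)
        (twice (tail lam - (A + F + H)))
        (twice (tail mu -
          Multiset.replicate (((single lam).card - (single mu).card - 2) / 2) 1)))) := by
  obtain ⟨hA, hF, hH, hw⟩ := hadm
  have hk : 0 < total ((single lam).erase b) + 2 * (A.sum : ℤ) + 2 * (F.sum : ℤ)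
      + 2 * (H.sum : ℤ) - total (single mu) - (single lam).card + (single mu).card + 2 := by
    rw [abs_of_neg ht, excessGt, Finset.erase_right_comm,
      total_erase (Finset.mem_erase.2 ⟨hab, ha⟩)] at hw
    omega
  exact ⟨hk, boundsEffectiveNumber_of_card_gt hsum hlam hmu hA hF hH hcard
    (even_card_tsub_card hsum) hone ha hb hab ht.ne (by omega) rfl hk⟩

theorem boundsEffectiveNumber_of_card_lt_of_pos
    (hcard : (single lam).card < (single mu).card)
    (hone : Multiset.replicate (((single mu).card - (single lam).card) / 2) 1 ≤ oddPairs lam)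
    {b : ℕ} (hb : b ∈ single mu) (ht : 0 < excessLt lam mu b) (hoo : 1 ≤ (oddPairs mu).card)
    (hD : 0 < (mu.card : ℤ) + 2 * g - 3 * (single mu).card) :
    0 < total (single lam) - total ((single mu).erase b)
        - (single lam).card + (single mu).card ∧
    BoundsEffectiveNumber g lam mu (factorialBound lam mu 0
      (maxSignChanges
        (total (single lam) - total ((single mu).erase b)
          - (single lam).card + (single mu).card)
        (twice (tail lam -
          Multiset.replicate (((single mu).card - (single lam).card) / 2) 1))
        (twice (tail mu)))) := by
  have hk : 0 < total (single lam) - total ((single mu).erase b)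
        - (single lam).card + (single mu).card := by
    rw [excessLt] at ht
    omega
  refine ⟨hk, ?_⟩
  have h := boundsEffectiveNumber_of_card_lt (g := g) (A := 0) (F := 0) (H := 0) hsum hlam hmu
    (Multiset.zero_le _) (Multiset.zero_le _) hcard
    (even_card_tsub_card hsum.symm) (by rwa [zero_add]) hb ht.ne' hoo
    (by simp only [Multiset.card_zero]; omega) (by simp) hk
  simpa using h

theorem boundsEffectiveNumber_of_card_lt_of_neg
    (hcard : (single lam).card < (single mu).card)
    {b : ℕ} (hb : b ∈ single mu) (ht : excessLt lam mu b < 0) (hoo : 1 ≤ (oddPairs mu).card)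
    (hD : |excessLt lam mu b| < (mu.card : ℤ) + 2 * g - 3 * (single mu).card)
    {A F H : Multiset ℕ} (hadm : IsAdmissible lam 1 |excessLt lam mu b| A F H)
    (hone : H + Multiset.replicate (((single mu).card - (single lam).card) / 2) 1 ≤ oddPairs lam)
    (hs : 2 * ((A.card : ℤ) + F.card + H.card) ≤ |excessLt lam mu b| + 1) :
    0 < total (single lam) + 2 * (A.sum : ℤ) + 2 * (F.sum : ℤ) + 2 * (H.sum : ℤ)
        - total ((single mu).erase b) - (single lam).card + (single mu).card ∧
    BoundsEffectiveNumber g lam mu (factorialBound lam mu H.card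
      (maxSignChanges
        (total (single lam) + 2 * (A.sum : ℤ) + 2 * (F.sum : ℤ) + 2 * (H.sum : ℤ)
          - total ((single mu).erase b) - (single lam).card + (single mu).card)
        (twice (tail lam - (A + F + H +
          Multiset.replicate (((single mu).card - (single lam).card) / 2) 1)))
        (twice (tail mu)))) := by
  obtain ⟨hA, hF, -, hw⟩ := hadm
  have hk : 0 < total (single lam) + 2 * (A.sum : ℤ) + 2 * (F.sum : ℤ) + 2 * (H.sum : ℤ)
        - total ((single mu).erase b) - (single lam).card + (single mu).card := by
    rw [abs_of_neg ht, excessLt] at hw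
    omega
  exact ⟨hk, boundsEffectiveNumber_of_card_lt hsum hlam hmu hA hF hcard
    (even_card_tsub_card hsum.symm) hone hb ht.ne hoo (by omega) rfl hk⟩

end Conditions

/-- There are data for which the factorial bound holds. -/
theorem exists_boundsEffectiveNumber {g : ℕ} {lam mu : Multiset ℕ} (hsum : lam.sum = mu.sum)
    (hlam : ∀ n ∈ lam, 0 < n) (hmu : ∀ n ∈ mu, 0 < n) (hcond : ExistenceCondition g lam mu) :
    ∃ (n₁ : ℕ) (k : ℤ) (lam' mu' : Multiset ℕ),
      n₁ ≤ (oddPairs lam).card ∧ 0 < k ∧ lam' ≤ tail lam ∧ mu' ≤ tail mu ∧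
      BoundsEffectiveNumber g lam mu (factorialBound lam mu n₁
        (maxSignChanges k (twice (tail lam - lam')) (twice (tail mu - mu')))) := by
  have hs : (lam.sum : ℤ) = mu.sum := by exact_mod_cast hsum
  rw [sum_eq lam, sum_eq mu] at hs
  have posO : ∀ n ∈ oddHalves lam, 0 < n := fun n hn => pos_of_mem_oddHalves hn
  have posE : ∀ n ∈ evenHalves lam, 0 < n := fun n hn => pos_of_mem_evenHalves hlam hn
  have posP : ∀ n ∈ oddPairs lam, 0 < n := fun n hn => (odd_of_mem_oddPairs hn).pos
  rcases lt_trichotomy (single lam).card (single mu).card with hcard | hcard | hcard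
  · obtain ⟨hoo, hone, hD⟩ := hcond.of_card_lt hcard
    have hpar := even_card_sub_card hsum
    rw [Int.even_iff] at hpar
    obtain ⟨c, hc⟩ : ∃ c, c = ((single mu).card - (single lam).card) / 2 := ⟨_, rfl⟩
    have hrep : Multiset.replicate c 1 ≤ oddPairs lam :=
      Multiset.le_count_iff_replicate_le.1 (by omega)
    rcases hD with ⟨⟨t, ⟨b, hb, rfl⟩, ht⟩, hD⟩ | ⟨-, t, ⟨⟨⟨b, hb, rfl⟩, ht⟩, -⟩, hD⟩
    · obtain ⟨hk, h⟩ := boundsEffectiveNumber_of_card_lt_of_pos (g := g) hsum hlam hmu hcard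
        (hc ▸ hrep) hb ht hoo hD
      refine ⟨0, _, Multiset.replicate c 1, 0, Nat.zero_le _, hk, hrep.trans (oddPairs_le_tail _),
        Multiset.zero_le _, ?_⟩
      rwa [tsub_zero, hc]
    -- The c pairs of ones are reserved for the strings, so the selection is made within the rest
    -- `W` of λ_{o,o}.
    · obtain ⟨W, hW⟩ := exists_complement hrep
      have hWs : ((oddPairs lam).sum : ℤ) = c + W.sum := by
        rw [hW, Multiset.sum_add, Multiset.sum_replicate, smul_eq_mul, mul_one, Nat.cast_add]
      obtain ⟨A, F, H, hA, hF, hH, hw, hcd⟩ := exists_irredundant (l := 1)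
        (w := |excessLt lam mu b|) le_rfl (abs_nonneg _) _ _ W posO posE
        (fun n hn => posP n (by rw [hW]; exact Multiset.mem_add.2 (.inr hn))) (by
          -- By equality of the degrees, taking all available tails exceeds |t| by b + 2|μ_tail|, so
          -- an admissible triple exists.
          have hb0 := (odd_of_mem_single hb).pos
          rw [abs_of_neg ht, excessLt, total_erase hb]
          omega)
      have hH' : H + Multiset.replicate c 1 ≤ oddPairs lam := by
        rw [hW, add_comm]
        exact add_le_add_right hH _
      have hHo : H ≤ oddPairs lam := (Multiset.le_add_right _ _).trans hH'
      obtain ⟨hk, h⟩ := boundsEffectiveNumber_of_card_lt_of_neg (g := g) hsum hlam hmu hcard hb ht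
        hoo hD ⟨hA, hF, hHo, hw⟩ (hc ▸ hH') hcd
      refine ⟨H.card, _, A + F + H + Multiset.replicate c 1, 0, Multiset.card_le_card hHo, hk, ?_,
        Multiset.zero_le _, ?_⟩
      · rw [add_assoc]
        exact add_le_tail hA hF hH'
      · rwa [tsub_zero, hc]
  · obtain ⟨hoo, hD⟩ := hcond.of_card_eq hcard
    rcases hD with ⟨⟨t, ⟨a, ha, b, hb, rfl⟩, ht⟩, hD⟩ | ⟨-, t, ⟨⟨⟨a, ha, b, hb, rfl⟩, ht⟩, -⟩, hD⟩
    · obtain ⟨hk, h⟩ := boundsEffectiveNumber_of_card_eq_of_pos (g := g) hsum hlam hmu hcard ha hb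
        ht hoo hD
      refine ⟨0, _, 0, 0, Nat.zero_le _, hk, Multiset.zero_le _, Multiset.zero_le _, ?_⟩
      rwa [tsub_zero, tsub_zero]
    · have ha0 := (odd_of_mem_single ha).pos
      obtain ⟨A, F, H, hA, hF, hH, hw, hcd⟩ := exists_irredundant (l := a)
        (w := |excessEq lam mu a b|) (by omega) (abs_nonneg _) _ _ _ posO posE posP (by
          have hb0 := (odd_of_mem_single hb).pos
          rw [abs_of_neg ht, excessEq, total_erase ha, total_erase hb]
          omega)
      obtain ⟨hk, h⟩ := boundsEffectiveNumber_of_card_eq_of_neg (g := g) hsum hlam hmu hcard ha hb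
        ht hoo hD ⟨hA, hF, hH, hw⟩ hcd
      refine ⟨H.card, _, A + F + H, 0, Multiset.card_le_card hH, hk, add_le_tail hA hF hH,
        Multiset.zero_le _, ?_⟩
      rwa [tsub_zero]
  · obtain ⟨hone, hD⟩ := hcond.of_card_gt hcard
    have hpar := even_card_tsub_card hsum
    have hrep : Multiset.replicate (((single lam).card - (single mu).card - 2) / 2) 1
        ≤ tail mu :=
      (Multiset.le_count_iff_replicate_le.1 (by omega)).trans (oddPairs_le_tail _)
    rcases hD with ⟨⟨t, ⟨a, ha, b, hb, hab, rfl⟩, ht⟩, hD⟩ |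
      ⟨-, t, ⟨⟨⟨a, ha, b, hb, hab, rfl⟩, ht⟩, -⟩, hD⟩
    · obtain ⟨hk, h⟩ := boundsEffectiveNumber_of_card_gt_of_pos (g := g) hsum hlam hmu hcard hone
        ha hb hab ht hD
      refine ⟨0, _, 0, _, Nat.zero_le _, hk, Multiset.zero_le _, hrep, ?_⟩
      rwa [tsub_zero]
    · have ha0 := (odd_of_mem_single ha).pos
      by_cases hlt : |excessGt lam mu a b| < (a : ℤ) + 2 * ((oddHalves lam).sum : ℤ)
          + 2 * ((evenHalves lam).sum : ℤ) + 2 * ((oddPairs lam).sum : ℤ)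
      · obtain ⟨A, F, H, hA, hF, hH, hw, hcd⟩ := exists_irredundant (l := a)
          (w := |excessGt lam mu a b|) (by omega) (abs_nonneg _) _ _ _ posO posE posP hlt
        obtain ⟨hk, h⟩ := boundsEffectiveNumber_of_card_gt_of_neg (g := g) hsum hlam hmu hcard hone
          ha hb hab ht hD ⟨hA, hF, hH, hw⟩ hcd
        exact ⟨H.card, _, A + F + H, _, Multiset.card_le_card hH, hk, add_le_tail hA hF hH, hrep, h⟩
      -- Even all tails together do not exceed |t|. Since parts are at least one, their number is
      -- then so small that all of them fit before the junction.
      · have cO := card_le_sum posO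
        have cE := card_le_sum posE
        have cP := card_le_sum posP
        -- If μ₀ were empty, the excess would be a sum of terms λ₀ⁿ - 1, which cannot be negative.
        have hm : 1 ≤ (single mu).card := by
          by_contra h0
          have h1 := card_le_total (s := ((single lam).erase a).erase b) fun n hn =>
            odd_of_mem_single (Finset.mem_of_mem_erase (Finset.mem_of_mem_erase hn))
          have h2 := Finset.card_erase_add_one ha
          have h3 := Finset.card_erase_add_one (Finset.mem_erase.2 ⟨hab.symm, hb⟩)
          have h4 : total (single mu) = 0 := by
            rw [Finset.card_eq_zero.1 (show (single mu).card = 0 by omega)]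
            rfl
          rw [excessGt, h4] at ht
          omega
        have h := boundsEffectiveNumber_of_all_tails (g := g) hsum hlam hmu hcard hm hpar hone (by
          simp only [tail, Multiset.card_add]
          omega)
        -- Removing all tails leaves no steps, so B = 0 and the choice k = 1 is arbitrary.
        refine ⟨(oddPairs lam).card, 1, tail lam, tail mu, le_rfl, one_pos, le_rfl, le_rfl, ?_⟩
        rw [tsub_self, tsub_self, show maxSignChanges 1 (twice 0) (twice 0) = 0 by
          simp only [maxSignChanges, twice, Multiset.map_zero, add_zero, Finset.sup_eq_bot_iff,
            Multiset.mem_toFinset, Multiset.mem_lists_iff, ← Nat.bot_eq_zero]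
          intro i hi
          rw [(Multiset.coe_eq_zero i).1 hi.symm]
          rfl]
        exact h

theorem mainTheorem6 (g d : ℕ) (p q : Nat.Partition d) (lam mu : Multiset ℕ)
    (hlam : lam = p.parts) (hmu : mu = q.parts) (hcond : ExistenceCondition g lam mu) :
    -- the general form
    (∃ (n₁ : ℕ) (k : ℤ) (lam' mu' : Multiset ℕ),
      n₁ ≤ (oddPairs lam).card ∧ 0 < k ∧ lam' ≤ tail lam ∧ mu' ≤ tail mu ∧
      BoundsEffectiveNumber g lam mu (factorialBound lam mu n₁
        (maxSignChanges k (twice (tail lam - lam')) (twice (tail mu - mu'))))) ∧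
    -- the six explicit cases
    ((single lam).card = (single mu).card →
      ∀ a ∈ single lam, ∀ b ∈ single mu, 0 < excessEq lam mu a b →
      BoundsEffectiveNumber g lam mu (factorialBound lam mu 0
        (maxSignChanges (total (single lam) - total ((single mu).erase b))
          (twice (tail lam)) (twice (tail mu))))) ∧
    ((single lam).card = (single mu).card →
      (∀ t ∈ excessEqSet lam mu, t ≤ 0) →
      ∀ a ∈ single lam, ∀ b ∈ single mu,
      IsMaxNegative (excessEqSet lam mu) (excessEq lam mu a b) →
      ∀ A F H : Multiset ℕ, IsStarSelection lam a |excessEq lam mu a b| A F H →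
      BoundsEffectiveNumber g lam mu (factorialBound lam mu H.card
        (maxSignChanges
          (total (single lam) + 2 * (A.sum : ℤ) + 2 * (F.sum : ℤ) + 2 * (H.sum : ℤ)
            - total ((single mu).erase b))
          (twice (tail lam - (A + F + H))) (twice (tail mu))))) ∧
    ((single mu).card < (single lam).card →
      ∀ a ∈ single lam, ∀ b ∈ single lam, a ≠ b → 0 < excessGt lam mu a b →
      BoundsEffectiveNumber g lam mu (factorialBound lam mu 0
        (maxSignChanges
          (total ((single lam).erase b) - total (single mu)
            - (single lam).card + (single mu).card + 2)
          (twice (tail lam))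
          (twice (tail mu -
            Multiset.replicate (((single lam).card - (single mu).card - 2) / 2) 1))))) ∧
    ((single mu).card < (single lam).card →
      (∀ t ∈ excessGtSet lam mu, t ≤ 0) →
      ∀ a ∈ single lam, ∀ b ∈ single lam, a ≠ b →
      IsMaxNegative (excessGtSet lam mu) (excessGt lam mu a b) →
      ∀ A F H : Multiset ℕ, IsStarSelection lam a |excessGt lam mu a b| A F H →
      BoundsEffectiveNumber g lam mu (factorialBound lam mu H.card
        (maxSignChanges
          (total ((single lam).erase b) + 2 * (A.sum : ℤ) + 2 * (F.sum : ℤ) + 2 * (H.sum : ℤ)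
            - total (single mu) - (single lam).card + (single mu).card + 2)
          (twice (tail lam - (A + F + H)))
          (twice (tail mu -
            Multiset.replicate (((single lam).card - (single mu).card - 2) / 2) 1))))) ∧
    ((single lam).card < (single mu).card →
      ∀ b ∈ single mu, 0 < excessLt lam mu b →
      BoundsEffectiveNumber g lam mu (factorialBound lam mu 0
        (maxSignChanges
          (total (single lam) - total ((single mu).erase b)
            - (single lam).card + (single mu).card)
          (twice (tail lam -
            Multiset.replicate (((single mu).card - (single lam).card) / 2) 1))
          (twice (tail mu))))) ∧
    ((single lam).card < (single mu).card →
      (∀ t ∈ excessLtSet lam mu, t ≤ 0) →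
      ∀ b ∈ single mu, IsMaxNegative (excessLtSet lam mu) (excessLt lam mu b) →
      ∀ A F H : Multiset ℕ, IsStarSelection lam 1 |excessLt lam mu b| A F H →
      H + Multiset.replicate (((single mu).card - (single lam).card) / 2) 1 ≤ oddPairs lam →
      BoundsEffectiveNumber g lam mu (factorialBound lam mu H.card
        (maxSignChanges
          (total (single lam) + 2 * (A.sum : ℤ) + 2 * (F.sum : ℤ) + 2 * (H.sum : ℤ)
            - total ((single mu).erase b) - (single lam).card + (single mu).card)
          (twice (tail lam - (A + F + H +
            Multiset.replicate (((single mu).card - (single lam).card) / 2) 1)))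
          (twice (tail mu))))) := by
  subst hlam hmu
  have hsum : p.parts.sum = q.parts.sum := by rw [p.parts_sum, q.parts_sum]
  have hp : ∀ n ∈ p.parts, 0 < n := fun n hn => p.parts_pos hn
  have hq : ∀ n ∈ q.parts, 0 < n := fun n hn => q.parts_pos hn
  refine ⟨exists_boundsEffectiveNumber hsum hp hq hcond, fun hcard a ha b hb ht => ?_,
    fun hcard hle a ha b hb ht A F H hsel => ?_, fun hcard a ha b hb hab ht => ?_,
    fun hcard hle a ha b hb hab ht A F H hsel => ?_, fun hcard b hb ht => ?_,
    fun hcard hle b hb ht A F H hsel hone => ?_⟩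
  · obtain ⟨hoo, hD⟩ := hcond.of_card_eq hcard
    exact (boundsEffectiveNumber_of_card_eq_of_pos hsum hp hq hcard ha hb ht hoo
      (hD.pos ⟨a, ha, b, hb, rfl⟩ ht)).2
  · obtain ⟨hoo, hD⟩ := hcond.of_card_eq hcard
    exact (boundsEffectiveNumber_of_card_eq_of_neg hsum hp hq hcard ha hb ht.1.2 hoo
      (hD.abs_lt hle ht) hsel.1 (hsel.two_mul_card_le
        (by exact_mod_cast (odd_of_mem_single ha).pos) (abs_nonneg _) hp)).2
  · obtain ⟨hone, hD⟩ := hcond.of_card_gt hcard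
    exact (boundsEffectiveNumber_of_card_gt_of_pos hsum hp hq hcard hone ha hb hab ht
      (hD.pos ⟨a, ha, b, hb, hab, rfl⟩ ht)).2
  · obtain ⟨hone, hD⟩ := hcond.of_card_gt hcard
    exact (boundsEffectiveNumber_of_card_gt_of_neg hsum hp hq hcard hone ha hb hab ht.1.2
      (hD.abs_lt hle ht) hsel.1 (hsel.two_mul_card_le
        (by exact_mod_cast (odd_of_mem_single ha).pos) (abs_nonneg _) hp)).2
  · obtain ⟨hoo, hone, hD⟩ := hcond.of_card_lt hcard
    exact (boundsEffectiveNumber_of_card_lt_of_pos hsum hp hq hcard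
      (Multiset.le_count_iff_replicate_le.1 (by omega)) hb ht hoo (hD.pos ⟨b, hb, rfl⟩ ht)).2
  · obtain ⟨hoo, -, hD⟩ := hcond.of_card_lt hcard
    exact (boundsEffectiveNumber_of_card_lt_of_neg hsum hp hq hcard hb ht.1.2 hoo
      (hD.abs_lt hle ht) hsel.1 hone (hsel.two_mul_card_le le_rfl (abs_nonneg _) hp)).2
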